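/- **Conventions.** $\mathbf{Top}$ is the category of compactly generated Hausdorff spaces. A *topological io-sequence* is a family $X=(X(n_-,n_+))$ of objects of $\mathbf{Top}$ indexed by $(n_-,n_+)\in\mathbb N\times\mathbb N\setminus\{(0,0)\}$; maps are families of continuous maps. An *ioda-graph* is a finite connected directed graph without directed cycles, with at least one input or output leg, and with orderings of the sets of input legs, of output legs and, for every vertex $v$, of the sets $in(v)$ and $out(v)$ of edges and legs directed into and out of $v$. Isomorphisms of ioda-graphs preserve incidences and all orderings. For an io-sequence $X$ put $$\mathbb G(X)(n_-,n_+)=\coprod_{G}\ \prod_{v\in V(G)}X(|in(v)|,|out(v)|),$$ where $G$ runs over one representative of each isomorphism class of ioda-graphs with $n_-$ input and $n_+$ output legs. Substitution of graphs into vertices (forgetting the nesting of nested graphs) and the corollas make $\mathbb G$ a monad $(\mathbb G,\mu,\eta)$; an *io-properad* is a $\mathbb G$-algebra, and $\mathbb G\mathbf{Alg}$ is the category of io-properads. For an io-properad $P$, $B_\bullet P=B_\bullet(\mathbb G,\mathbb G,P)$ is the simplicial io-properad with $B_nP=\mathbb G^{n+1}P$, whose faces are $d_i=\mathbb G^i\mu$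 for $i<n$ and $d_n=\mathbb G^n$ applied to the structure map $\mathbb G P\to P$, and whose degeneracies $s_i=\mathbb G^{i+1}\eta$ insert the unit. The *geometric realization* of a simplicial io-properad $P_\bullet$ is the coend $$|P_\bullet|=\int^{[n]\in\Delta}P_n\odot\Delta^n\quad\text{in }\mathbb G\mathbf{Alg},$$ where $P\odot Z$ is the tensor of an io-properad with a space: maps of io-properads $P\odot Z\to Q$ are continuous families, parametrized by $Z$, of maps of io-properads $P\to Q$. A map of io-sequences is a *Hurewicz weak equivalence* (resp. *Hurewicz cofibration*) if every component is a homotopy equivalence (resp. has the homotopy extension property); a map of io-properads is a Hurewicz weak equivalence if the underlying map of io-sequences is one. **Proposition.** Let $$\begin{array}{ccccc}P&\longleftarrow&R&\longrightarrow&Q\\ \downarrow&&\downarrow&&\downarrow\\ P'&\longleftarrow&R'&\longrightarrow&Q'\end{array}$$ be a commutative diagram of io-properads such that 1. each vertical map is a Hurewicz weak equivalence, and 2. $R\to P$ and $R'\to P'$ are Hurewicz cofibrations of the underlying topological io-sequences. Then the induced map of pushouts in the category of io-properads $$|B_\bullet P|\coprod^{\mathbb G\mathbf{Alg}}_{|B_\bullet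 R|}|B_\bullet Q|\ \longrightarrow\ |B_\bullet P'|\coprod^{\mathbb G\mathbf{Alg}}_{|B_\bullet R'|}|B_\bullet Q'|$$ is a Hurewicz weak equivalence. -/

import Mathlib

universe u

/-! ### Input-output directed acyclic graphs -/

/-- The index set `ℕ × ℕ ∖ {(0, 0)}` of io-sequences: (number of inputs, number of outputs). -/
abbrev Arity : Type := {p : ℕ × ℕ // p ≠ (0, 0)}

/-- Number of inputs. -/
abbrev Arity.nIn (a : Arity) : ℕ := a.1.1

/-- Number of outputs. -/
abbrev Arity.nOut (a : Arity) : ℕ := a.1.2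

/-- A directed graph with vertex set `V`, set of (internal) edges `E`, and with `a.nIn` ordered
input legs and `a.nOut` ordered output legs (so at least one leg: the graph is input-output).
The bijection `inn` sends an edge or input leg to its target vertex `v` together with its place in
the ordering of the set `in(v)`, which has `(ar v).nIn` elements; `out` does the same for edges and
output legs, their sources and the ordered sets `out(v)`. -/
structure IoGraph (V E : Type) (a : Arity) where
  ar : V → Arity
  inn : E ⊕ Fin a.nIn ≃ Σ v, Fin (ar v).nIn
  out : E ⊕ Fin a.nOut ≃ Σ v, Fin (ar v).nOut

namespace IoGraph

variable {V E V' E' V'' E'' : Type} {a a' a'' : Arity}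

/-- Target vertex of an edge or input leg and its place in the ordering there. -/
def inPos (G : IoGraph V E a) (x : E ⊕ Fin a.nIn) : V × ℕ := ((G.inn x).1, (G.inn x).2.1)

/-- Source vertex of an edge or output leg and its place in the ordering there. -/
def outPos (G : IoGraph V E a) (x : E ⊕ Fin a.nOut) : V × ℕ := ((G.out x).1, (G.out x).2.1)

/-- There is an edge from `v` to `w`. -/
def Adj (G : IoGraph V E a) (v w : V) : Prop :=
  ∃ e : E, (G.outPos (.inl e)).1 = v ∧ (G.inPos (.inl e)).1 = w

/-- ioda-graphs: connected (as an undirected graph) and without directed cycles. -/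
structure IsIoda (G : IoGraph V E a) : Prop where
  connected : ∀ v w, Relation.EqvGen G.Adj v w
  acyclic : ∀ v, ¬ Relation.TransGen G.Adj v v

/-- Isomorphisms of graphs: bijections on vertices and on edges, preserving incidences, the
orderings of the legs, and the orderings at every vertex. (The arities are allowed to be
propositionally equal, for use with substitution of graphs.) -/
structure Iso (G : IoGraph V E a) (G' : IoGraph V' E' a') where
  fV : V ≃ V'
  fE : E ≃ E'
  arity : a = a'
  ar : ∀ v, G'.ar (fV v) = G.ar v
  inE : ∀ e, G'.inPos (.inl (fE e)) = Prod.map fV id (G.inPos (.inl e))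
  inL : ∀ (i : Fin a.nIn) (i' : Fin a'.nIn), i.1 = i'.1 →
    G'.inPos (.inr i') = Prod.map fV id (G.inPos (.inr i))
  outE : ∀ e, G'.outPos (.inl (fE e)) = Prod.map fV id (G.outPos (.inl e))
  outL : ∀ (i : Fin a.nOut) (i' : Fin a'.nOut), i.1 = i'.1 →
    G'.outPos (.inr i') = Prod.map fV id (G.outPos (.inr i))

theorem inPos_injective (G : IoGraph V E a) : Function.Injective G.inPos := by
  intro x y h
  apply G.inn.injective
  have h1 := congrArg Prod.fst h
  have h2 := congrArg Prod.snd h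
  simp only [inPos] at h1 h2
  revert h1 h2
  generalize G.inn x = p
  generalize G.inn y = q
  rcases p with ⟨v, i⟩
  rcases q with ⟨w, j⟩
  rintro rfl h
  simp only [] at h
  rw [Fin.ext h]

theorem outPos_injective (G : IoGraph V E a) : Function.Injective G.outPos := by
  intro x y h
  apply G.out.injective
  have h1 := congrArg Prod.fst h
  have h2 := congrArg Prod.snd h
  simp only [outPos] at h1 h2
  revert h1 h2
  generalize G.out x = p
  generalize G.out y = q
  rcases p with ⟨v, i⟩
  rcases q with ⟨w, j⟩
  rintro rfl h
  simp only [] at h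
  rw [Fin.ext h]

namespace Iso

/-- The identity isomorphism. -/
def refl (G : IoGraph V E a) : Iso G G where
  fV := Equiv.refl _
  fE := Equiv.refl _
  arity := rfl
  ar _ := rfl
  inE _ := rfl
  inL i i' h := by rw [Fin.ext h]; rfl
  outE _ := rfl
  outL i i' h := by rw [Fin.ext h]; rfl

/-- The inverse isomorphism. -/
def symm {G : IoGraph V E a} {G' : IoGraph V' E' a'} (f : Iso G G') : Iso G' G where
  fV := f.fV.symm
  fE := f.fE.symm
  arity := f.arity.symm
  ar v := by rw [← f.ar, Equiv.apply_symm_apply]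
  inE e := by
    have := f.inE (f.fE.symm e)
    rw [Equiv.apply_symm_apply] at this
    rw [this]
    ext <;> simp
  inL i i' h := by
    rw [f.inL i' i h.symm]
    ext <;> simp
  outE e := by
    have := f.outE (f.fE.symm e)
    rw [Equiv.apply_symm_apply] at this
    rw [this]
    ext <;> simp
  outL i i' h := by
    rw [f.outL i' i h.symm]
    ext <;> simp

/-- Composition of isomorphisms. -/
def trans {G : IoGraph V E a} {G' : IoGraph V' E' a'} {G'' : IoGraph V'' E'' a''}
    (f : Iso G G') (g : Iso G' G'') : Iso G G'' where
  fV := f.fV.trans g.fV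
  fE := f.fE.trans g.fE
  arity := f.arity.trans g.arity
  ar v := (g.ar _).trans (f.ar _)
  inE e := by rw [Equiv.trans_apply, g.inE, f.inE]; rfl
  inL i i' h := by
    have hi : i.1 < a'.nIn := by rw [← f.arity]; exact i.2
    rw [g.inL ⟨i.1, hi⟩ i' h, f.inL i ⟨i.1, hi⟩ rfl]
    rfl
  outE e := by rw [Equiv.trans_apply, g.outE, f.outE]; rfl
  outL i i' h := by
    have hi : i.1 < a'.nOut := by rw [← f.arity]; exact i.2
    rw [g.outL ⟨i.1, hi⟩ i' h, f.outL i ⟨i.1, hi⟩ rfl]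
    rfl

theorem adj {G : IoGraph V E a} {G' : IoGraph V' E' a'} (f : Iso G G') {v w : V}
    (h : G.Adj v w) : G'.Adj (f.fV v) (f.fV w) := by
  obtain ⟨e, rfl, rfl⟩ := h
  exact ⟨f.fE e, by rw [f.outE]; rfl, by rw [f.inE]; rfl⟩

theorem isIoda {G : IoGraph V E a} {G' : IoGraph V' E' a'} (f : Iso G G') (h : G.IsIoda) :
    G'.IsIoda where
  connected v w := by
    have key : ∀ x y, Relation.EqvGen G.Adj x y → Relation.EqvGen G'.Adj (f.fV x) (f.fV y) := by
      intro x y hxy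
      induction hxy with
      | rel x y h => exact .rel _ _ (f.adj h)
      | refl x => exact .refl _
      | symm x y _ ih => exact .symm _ _ ih
      | trans x y z _ _ ih ih' => exact .trans _ _ _ ih ih'
    simpa using key _ _ (h.connected (f.fV.symm v) (f.fV.symm w))
  acyclic v hv := h.acyclic (f.fV.symm v)
    (hv.lift f.fV.symm fun _ _ hxy => f.symm.adj hxy)

end Iso

theorem exists_leg_vertex (G : IoGraph V E a) :
    (∃ i, ∃ v, (G.inPos (.inr i)).1 = v) ∨ (∃ i, ∃ v, (G.outPos (.inr i)).1 = v) := by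
  by_cases h : a.nIn = 0
  · have h' : 0 < a.nOut := by
      rcases Nat.eq_zero_or_pos a.nOut with h' | h'
      · exact absurd (Prod.ext h h') a.2
      · exact h'
    exact .inr ⟨⟨0, h'⟩, _, rfl⟩
  · exact .inl ⟨⟨0, Nat.pos_of_ne_zero h⟩, _, rfl⟩

theorem nonempty (G : IoGraph V E a) : Nonempty V := by
  rcases G.exists_leg_vertex with ⟨_, v, _⟩ | ⟨_, v, _⟩ <;> exact ⟨v⟩

/-- ioda-graphs are rigid: an isomorphism is determined by its source and target. -/
theorem Iso.fV_unique {G : IoGraph V E a} {G' : IoGraph V' E' a'} (hG : G.IsIoda)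
    (f g : Iso G G') (v : V) : f.fV v = g.fV v := by
  have hE : ∀ x y, Relation.EqvGen G.Adj x y → (f.fV x = g.fV x ↔ f.fV y = g.fV y) := by
    intro x y hxy
    induction hxy with
    | rel x y h =>
      obtain ⟨e, rfl, rfl⟩ := h
      constructor
      · intro h
        have h1 : f.fE e = g.fE e := by
          have : G'.outPos (.inl (f.fE e)) = G'.outPos (.inl (g.fE e)) := by
            rw [f.outE, g.outE]; exact Prod.ext h rfl
          simpa using G'.outPos_injective this
        have := (f.inE e).symm.trans ((congrArg (fun x => G'.inPos (.inl x)) h1).trans (g.inE e))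
        exact congrArg Prod.fst this
      · intro h
        have h1 : f.fE e = g.fE e := by
          have : G'.inPos (.inl (f.fE e)) = G'.inPos (.inl (g.fE e)) := by
            rw [f.inE, g.inE]; exact Prod.ext h rfl
          simpa using G'.inPos_injective this
        have := (f.outE e).symm.trans ((congrArg (fun x => G'.outPos (.inl x)) h1).trans (g.outE e))
        exact congrArg Prod.fst this
    | refl x => exact Iff.rfl
    | symm x y _ ih => exact ih.symm
    | trans x y z _ _ ih ih' => exact ih.trans ih'
  rcases G.exists_leg_vertex with ⟨i, w, hw⟩ | ⟨i, w, hw⟩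
  · refine (hE w v (hG.connected _ _)).1 ?_
    subst hw
    have hi : i.1 < a'.nIn := by rw [← f.arity]; exact i.2
    exact congrArg Prod.fst ((f.inL i ⟨i.1, hi⟩ rfl).symm.trans (g.inL i ⟨i.1, hi⟩ rfl))
  · refine (hE w v (hG.connected _ _)).1 ?_
    subst hw
    have hi : i.1 < a'.nOut := by rw [← f.arity]; exact i.2
    exact congrArg Prod.fst ((f.outL i ⟨i.1, hi⟩ rfl).symm.trans (g.outL i ⟨i.1, hi⟩ rfl))

/-- Renaming vertices and edges. -/
def reindex (G : IoGraph V E a) (eV : V ≃ V') (eE : E ≃ E') : IoGraph V' E' a where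
  ar v := G.ar (eV.symm v)
  inn := ((eE.sumCongr (Equiv.refl _)).symm.trans G.inn).trans
    (Equiv.sigmaCongrLeft (β := fun v => Fin (G.ar v).nIn) eV.symm).symm
  out := ((eE.sumCongr (Equiv.refl _)).symm.trans G.out).trans
    (Equiv.sigmaCongrLeft (β := fun v => Fin (G.ar v).nOut) eV.symm).symm

theorem sigmaCongrLeft_symm_pos {β : V → ℕ} (e : V' ≃ V) (p : Σ v, Fin (β v)) :
    (((Equiv.sigmaCongrLeft (β := fun v => Fin (β v)) e).symm p).1,
      ((Equiv.sigmaCongrLeft (β := fun v => Fin (β v)) e).symm p).2.1) = (e.symm p.1, p.2.1) := by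
  obtain ⟨q, rfl⟩ := (Equiv.sigmaCongrLeft (β := fun v => Fin (β v)) e).surjective p
  rw [Equiv.symm_apply_apply]
  simp [Equiv.sigmaCongrLeft]

/-- A graph is isomorphic to each of its renamings. -/
def reindexIso (G : IoGraph V E a) (eV : V ≃ V') (eE : E ≃ E') : Iso G (G.reindex eV eE) where
  fV := eV
  fE := eE
  arity := rfl
  ar v := by simp [reindex]
  inE e := by
    refine (sigmaCongrLeft_symm_pos eV.symm _).trans ?_
    have h0 : (eE.sumCongr (Equiv.refl (Fin a.nIn))).symm (.inl (eE e)) = .inl e := by simp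
    rw [Equiv.trans_apply, h0]; rfl
  inL i i' h := by
    obtain rfl := Fin.ext h
    refine (sigmaCongrLeft_symm_pos eV.symm _).trans ?_
    have h0 : (eE.sumCongr (Equiv.refl (Fin a.nIn))).symm (.inr i) = .inr i := by simp
    rw [Equiv.trans_apply, h0]; rfl
  outE e := by
    refine (sigmaCongrLeft_symm_pos eV.symm _).trans ?_
    have h0 : (eE.sumCongr (Equiv.refl (Fin a.nOut))).symm (.inl (eE e)) = .inl e := by simp
    rw [Equiv.trans_apply, h0]; rfl
  outL i i' h := by
    obtain rfl := Fin.ext h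
    refine (sigmaCongrLeft_symm_pos eV.symm _).trans ?_
    have h0 : (eE.sumCongr (Equiv.refl (Fin a.nOut))).symm (.inr i) = .inr i := by simp
    rw [Equiv.trans_apply, h0]; rfl

/-- The corolla: one vertex and no edges, all orderings being the same. -/
def corolla (a : Arity) : IoGraph Unit Empty a where
  ar _ := a
  inn := (Equiv.emptySum Empty (Fin a.nIn)).trans (Equiv.uniqueSigma fun _ : Unit => Fin a.nIn).symm
  out := (Equiv.emptySum Empty (Fin a.nOut)).trans
    (Equiv.uniqueSigma fun _ : Unit => Fin a.nOut).symm

theorem corolla_isIoda (a : Arity) : (corolla a).IsIoda where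
  connected _ _ := .refl _
  acyclic v h := by
    induction h with
    | single h => exact h.choose.elim
    | tail _ h _ => exact h.choose.elim

section subst

variable {W F : V → Type}

/-- An auxiliary rearrangement: the flags entering (or leaving) the vertices of a graph obtained
by substitution. -/
def substEquiv {L : Type} {b : V → ℕ} {c : ∀ v, W v → ℕ} (k : E ⊕ L ≃ Σ v, Fin (b v))
    (h : ∀ v, F v ⊕ Fin (b v) ≃ Σ w, Fin (c v w)) :
    (E ⊕ Σ v, F v) ⊕ L ≃ Σ p : Σ v, W v, Fin (c p.1 p.2) where
  toFun
    | .inl (.inl e) => ⟨⟨(k (.inl e)).1, (h _ (.inr (k (.inl e)).2)).1⟩,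
        (h _ (.inr (k (.inl e)).2)).2⟩
    | .inl (.inr f) => ⟨⟨f.1, (h f.1 (.inl f.2)).1⟩, (h f.1 (.inl f.2)).2⟩
    | .inr l => ⟨⟨(k (.inr l)).1, (h _ (.inr (k (.inr l)).2)).1⟩,
        (h _ (.inr (k (.inr l)).2)).2⟩
  invFun p :=
    match (h p.1.1).symm ⟨p.1.2, p.2⟩ with
    | .inl f => .inl (.inr ⟨p.1.1, f⟩)
    | .inr i =>
      match k.symm ⟨p.1.1, i⟩ with
      | .inl e => .inl (.inl e)
      | .inr l => .inr l
  left_inv x := by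
    rcases x with (e | f) | l <;> simp
  right_inv p := by
    rcases p with ⟨⟨v, w⟩, i⟩
    simp only
    rcases hx : (h v).symm ⟨w, i⟩ with f | j
    · have := (h v).apply_symm_apply ⟨w, i⟩
      rw [hx] at this
      simp only
      rw [this]
    · have h1 := (h v).apply_symm_apply ⟨w, i⟩
      rw [hx] at h1
      rcases hy : k.symm ⟨v, j⟩ with e | l
      · have h2 := k.apply_symm_apply ⟨v, j⟩
        rw [hy] at h2
        simp only [hy]
        rw [h2, h1]
      · have h2 := k.apply_symm_apply ⟨v, j⟩
        rw [hy] at h2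
        simp only [hy]
        rw [h2, h1]

/-- Substitution of graphs: every vertex `v` of `K` is replaced by the graph `H v`, the ordered
legs of `H v` being glued to the ordered edges and legs of `K` at `v`. -/
def subst (K : IoGraph V E a) (H : ∀ v, IoGraph (W v) (F v) (K.ar v)) :
    IoGraph (Σ v, W v) (E ⊕ Σ v, F v) a where
  ar p := (H p.1).ar p.2
  inn := substEquiv (c := fun v w => ((H v).ar w).nIn) K.inn fun v => (H v).inn
  out := substEquiv (c := fun v w => ((H v).ar w).nOut) K.out fun v => (H v).out

end subst

end IoGraph

namespace IoGraph

section subst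

variable {V E V' E' : Type} {a a' : Arity} {W F : V → Type} {W' F' : V' → Type}

theorem subst_adj {K : IoGraph V E a} {H : ∀ v, IoGraph (W v) (F v) (K.ar v)}
    {p q : Σ v, W v} (h : (K.subst H).Adj p q) :
    K.Adj p.1 q.1 ∨ ∃ v w w', p = ⟨v, w⟩ ∧ q = ⟨v, w'⟩ ∧ (H v).Adj w w' := by
  obtain ⟨e | ⟨v, f⟩, rfl, rfl⟩ := h
  · exact .inl ⟨e, rfl, rfl⟩
  · exact .inr ⟨v, _, _, rfl, rfl, f, rfl, rfl⟩

theorem subst_isIoda {K : IoGraph V E a} {H : ∀ v, IoGraph (W v) (F v) (K.ar v)}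
    (hK : K.IsIoda) (hH : ∀ v, (H v).IsIoda) : (K.subst H).IsIoda where
  connected := by
    have h1 : ∀ v w w', Relation.EqvGen (K.subst H).Adj ⟨v, w⟩ ⟨v, w'⟩ := by
      intro v w w'
      have := (hH v).connected w w'
      induction this with
      | rel x y h =>
        obtain ⟨f, rfl, rfl⟩ := h
        exact .rel _ _ ⟨.inr ⟨v, f⟩, rfl, rfl⟩
      | refl x => exact .refl _
      | symm x y _ ih => exact .symm _ _ ih
      | trans x y z _ _ ih ih' => exact .trans _ _ _ ih ih'
    have h2 : ∀ v v', Relation.EqvGen K.Adj v v' →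
        ∀ w w', Relation.EqvGen (K.subst H).Adj ⟨v, w⟩ ⟨v', w'⟩ := by
      intro v v' h
      induction h with
      | rel x y h =>
        obtain ⟨e, rfl, rfl⟩ := h
        intro w w'
        exact .trans _ _ _ (h1 _ _ _) (.trans _ _ _ (.rel _ _ ⟨.inl e, rfl, rfl⟩) (h1 _ _ _))
      | refl x => exact h1 x
      | symm x y _ ih => exact fun w w' => .symm _ _ (ih w' w)
      | trans x y z _ _ ih ih' =>
        intro w w'
        obtain ⟨u⟩ := (H y).nonempty
        exact .trans _ _ _ (ih w u) (ih' u w')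
    rintro ⟨v, w⟩ ⟨v', w'⟩
    exact h2 v v' (hK.connected v v') w w'
  acyclic := by
    have key : ∀ p q, Relation.TransGen (K.subst H).Adj p q →
        Relation.TransGen K.Adj p.1 q.1 ∨
          ∃ v w w', p = ⟨v, w⟩ ∧ q = ⟨v, w'⟩ ∧ Relation.TransGen (H v).Adj w w' := by
      intro p q h
      induction h with
      | single h =>
        rcases subst_adj h with h | ⟨v, w, w', hp, hq, h⟩
        · exact .inl (.single h)
        · exact .inr ⟨v, w, w', hp, hq, .single h⟩
      | tail _ h ih =>
        rcases subst_adj h with h | ⟨v, w, w', rfl, rfl, h'⟩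
        · rcases ih with ih | ⟨v, w, w', rfl, rfl, ih⟩
          · exact .inl (ih.tail h)
          · exact .inl (.single h)
        · rcases ih with ih | ⟨v1, w1, w2, rfl, h2, ih⟩
          · exact .inl ih
          · obtain ⟨rfl, h2⟩ := Sigma.mk.inj h2
            obtain rfl := eq_of_heq h2
            exact .inr ⟨_, _, _, rfl, rfl, ih.tail h'⟩
    intro p hp
    rcases key p p hp with h | ⟨v, w, w', rfl, h2, h⟩
    · exact hK.acyclic _ h
    · obtain ⟨_, h2⟩ := Sigma.mk.inj h2
      obtain rfl := eq_of_heq h2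
      exact (hH v).acyclic _ h

/-- Substitution respects isomorphisms. -/
def substIso {K : IoGraph V E a} {K' : IoGraph V' E' a'}
    {H : ∀ v, IoGraph (W v) (F v) (K.ar v)} {H' : ∀ v, IoGraph (W' v) (F' v) (K'.ar v)}
    (f : Iso K K') (g : ∀ v, Iso (H v) (H' (f.fV v))) : Iso (K.subst H) (K'.subst H') where
  fV := Equiv.sigmaCongr f.fV fun v => (g v).fV
  fE := f.fE.sumCongr (Equiv.sigmaCongr f.fV fun v => (g v).fE)
  arity := f.arity
  ar p := (g p.1).ar p.2
  inE := by
    rintro (e | ⟨v, e⟩)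
    · have h := f.inE e
      change ((⟨(K'.inn (.inl (f.fE e))).1, ((H' _).inPos (.inr (K'.inn (.inl (f.fE e))).2)).1⟩ :
          Σ v, W' v), ((H' _).inPos (.inr (K'.inn (.inl (f.fE e))).2)).2) = Prod.map _ id
        ((⟨(K.inn (.inl e)).1, ((H _).inPos (.inr (K.inn (.inl e)).2)).1⟩ :
          Σ v, W v), ((H _).inPos (.inr (K.inn (.inl e)).2)).2)
      unfold inPos at h
      revert h
      generalize K'.inn (.inl (f.fE e)) = p'
      generalize K.inn (.inl e) = p
      rcases p with ⟨v, i⟩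
      rcases p' with ⟨v', i'⟩
      intro h
      obtain ⟨h1, h2⟩ := Prod.mk.inj h
      simp only at h1 h2
      subst h1
      rw [(g v).inL i i' h2.symm]
      rfl
    · change ((⟨f.fV v, ((H' _).inPos (.inl ((g v).fE e))).1⟩ : Σ v, W' v),
        ((H' _).inPos (.inl ((g v).fE e))).2) = _
      rw [(g v).inE]
      rfl
  inL l l' hl := by
    have h := f.inL l l' hl
    change ((⟨(K'.inn (.inr l')).1, ((H' _).inPos (.inr (K'.inn (.inr l')).2)).1⟩ :
        Σ v, W' v), ((H' _).inPos (.inr (K'.inn (.inr l')).2)).2) = Prod.map _ id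
      ((⟨(K.inn (.inr l)).1, ((H _).inPos (.inr (K.inn (.inr l)).2)).1⟩ :
        Σ v, W v), ((H _).inPos (.inr (K.inn (.inr l)).2)).2)
    unfold inPos at h
    revert h
    generalize K'.inn (.inr l') = p'
    generalize K.inn (.inr l) = p
    rcases p with ⟨v, i⟩
    rcases p' with ⟨v', i'⟩
    intro h
    obtain ⟨h1, h2⟩ := Prod.mk.inj h
    simp only at h1 h2
    subst h1
    rw [(g v).inL i i' h2.symm]
    rfl
  outE := by
    rintro (e | ⟨v, e⟩)
    · have h := f.outE e
      change ((⟨(K'.out (.inl (f.fE e))).1, ((H' _).outPos (.inr (K'.out (.inl (f.fE e))).2)).1⟩ :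
          Σ v, W' v), ((H' _).outPos (.inr (K'.out (.inl (f.fE e))).2)).2) = Prod.map _ id
        ((⟨(K.out (.inl e)).1, ((H _).outPos (.inr (K.out (.inl e)).2)).1⟩ :
          Σ v, W v), ((H _).outPos (.inr (K.out (.inl e)).2)).2)
      unfold outPos at h
      revert h
      generalize K'.out (.inl (f.fE e)) = p'
      generalize K.out (.inl e) = p
      rcases p with ⟨v, i⟩
      rcases p' with ⟨v', i'⟩
      intro h
      obtain ⟨h1, h2⟩ := Prod.mk.inj h
      simp only at h1 h2
      subst h1
      rw [(g v).outL i i' h2.symm]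
      rfl
    · change ((⟨f.fV v, ((H' _).outPos (.inl ((g v).fE e))).1⟩ : Σ v, W' v),
        ((H' _).outPos (.inl ((g v).fE e))).2) = _
      rw [(g v).outE]
      rfl
  outL l l' hl := by
    have h := f.outL l l' hl
    change ((⟨(K'.out (.inr l')).1, ((H' _).outPos (.inr (K'.out (.inr l')).2)).1⟩ :
        Σ v, W' v), ((H' _).outPos (.inr (K'.out (.inr l')).2)).2) = Prod.map _ id
      ((⟨(K.out (.inr l)).1, ((H _).outPos (.inr (K.out (.inr l)).2)).1⟩ :
        Σ v, W v), ((H _).outPos (.inr (K.out (.inr l)).2)).2)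
    unfold outPos at h
    revert h
    generalize K'.out (.inr l') = p'
    generalize K.out (.inr l) = p
    rcases p with ⟨v, i⟩
    rcases p' with ⟨v', i'⟩
    intro h
    obtain ⟨h1, h2⟩ := Prod.mk.inj h
    simp only at h1 h2
    subst h1
    rw [(g v).outL i i' h2.symm]
    rfl

/-- Substituting a graph into a corolla gives back the graph. -/
def corollaSubstIso (G : IoGraph V E a) :
    Iso ((corolla a).subst (W := fun _ => V) (F := fun _ => E) fun _ => G) G where
  fV := Equiv.uniqueSigma fun _ : Unit => V
  fE := (Equiv.emptySum Empty _).trans (Equiv.uniqueSigma fun _ : Unit => E)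
  arity := rfl
  ar _ := rfl
  inE := by
    rintro (e | e)
    · exact e.elim
    · rfl
  inL i i' h := by
    obtain rfl := Fin.ext h
    rfl
  outE := by
    rintro (e | e)
    · exact e.elim
    · rfl
  outL i i' h := by
    obtain rfl := Fin.ext h
    rfl

/-- Substituting corollas into a graph gives back the graph. -/
def substCorollaIso (G : IoGraph V E a) :
    Iso (G.subst (W := fun _ => Unit) (F := fun _ => Empty) fun v => corolla (G.ar v)) G where
  fV := Equiv.sigmaUnique V fun _ => Unit
  fE :=
    haveI : IsEmpty (Σ _ : V, Empty) := ⟨fun p => p.2.elim⟩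
    Equiv.sumEmpty E (Σ _ : V, Empty)
  arity := rfl
  ar _ := rfl
  inE := by
    rintro (e | e)
    · rfl
    · exact e.2.elim
  inL i i' h := by
    obtain rfl := Fin.ext h
    rfl
  outE := by
    rintro (e | e)
    · rfl
    · exact e.2.elim
  outL i i' h := by
    obtain rfl := Fin.ext h
    rfl

/-- Associativity of substitution. -/
def substAssocIso {U S : ∀ v, W v → Type} (K : IoGraph V E a)
    (H : ∀ v, IoGraph (W v) (F v) (K.ar v)) (L : ∀ v w, IoGraph (U v w) (S v w) ((H v).ar w)) :
    Iso ((K.subst H).subst (W := fun p => U p.1 p.2) (F := fun p => S p.1 p.2)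
        fun p => L p.1 p.2)
      (K.subst fun v => (H v).subst (L v)) where
  fV := Equiv.sigmaAssoc U
  fE :=
    { toFun := fun
        | .inl (.inl e) => .inl e
        | .inl (.inr f) => .inr ⟨f.1, .inl f.2⟩
        | .inr s => .inr ⟨s.1.1, .inr ⟨s.1.2, s.2⟩⟩
      invFun := fun
        | .inl e => .inl (.inl e)
        | .inr ⟨v, .inl f⟩ => .inl (.inr ⟨v, f⟩)
        | .inr ⟨v, .inr s⟩ => .inr ⟨⟨v, s.1⟩, s.2⟩
      left_inv := by rintro ((e | f) | s) <;> rfl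
      right_inv := by rintro (e | ⟨v, f | s⟩) <;> rfl }
  arity := rfl
  ar _ := rfl
  inE := by rintro ((e | f) | s) <;> rfl
  inL i i' h := by
    obtain rfl := Fin.ext h
    rfl
  outE := by rintro ((e | f) | s) <;> rfl
  outL i i' h := by
    obtain rfl := Fin.ext h
    rfl

end subst

end IoGraph

/-! ### The set `𝒢 a` of isomorphism classes of ioda-graphs -/

/-- ioda-graphs whose sets of vertices and of edges are `Fin k` and `Fin l`: a small model of all
finite ioda-graphs. -/
structure IodaGraph (a : Arity) where
  k : ℕ
  l : ℕ
  graph : IoGraph (Fin k) (Fin l) a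
  isIoda : graph.IsIoda

/-- Isomorphism of ioda-graphs. -/
instance IodaGraph.setoid (a : Arity) : Setoid (IodaGraph a) where
  r G G' := Nonempty (G.graph.Iso G'.graph)
  iseqv := ⟨fun G => ⟨.refl G.graph⟩, fun ⟨f⟩ => ⟨f.symm⟩, fun ⟨f⟩ ⟨g⟩ => ⟨f.trans g⟩⟩

/-- Isomorphism classes of ioda-graphs with the given numbers of input and output legs. -/
abbrev IodaClass (a : Arity) : Type := Quotient (IodaGraph.setoid a)

namespace IodaClass

variable {V E : Type} {a : Arity}

/-- The chosen representative of an isomorphism class. -/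
noncomputable def rep (s : IodaClass a) : IodaGraph a := Quotient.out s

/-- The vertices of the chosen representative. -/
abbrev Vert (s : IodaClass a) : Type := Fin s.rep.k

/-- The arities of the vertices of the chosen representative. -/
noncomputable abbrev ar (s : IodaClass a) (v : s.Vert) : Arity := s.rep.graph.ar v

theorem eq_of_iso {s t : IodaClass a} (f : s.rep.graph.Iso t.rep.graph) : s = t := by
  have : (⟦s.rep⟧ : Quotient (IodaGraph.setoid a)) = ⟦t.rep⟧ := Quotient.sound ⟨f⟩
  rwa [rep, rep, Quotient.out_eq, Quotient.out_eq] at this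

theorem exists_iso [Finite V] [Finite E] (G : IoGraph V E a) (hG : G.IsIoda) :
    ∃ s : IodaClass a, Nonempty (G.Iso s.rep.graph) := by
  let f := G.reindexIso (Finite.equivFin V) (Finite.equivFin E)
  let G' : IodaGraph a := ⟨_, _, _, f.isIoda hG⟩
  obtain ⟨g⟩ : (⟦G'⟧ : Quotient (IodaGraph.setoid a)).out ≈ G' := Quotient.mk_out G'
  exact ⟨⟦G'⟧, ⟨f.trans g.symm⟩⟩

/-- The isomorphism class of a finite ioda-graph. -/
noncomputable def of [Finite V] [Finite E] (G : IoGraph V E a) (hG : G.IsIoda) : IodaClass a :=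
  (exists_iso G hG).choose

/-- The (unique) isomorphism from a finite ioda-graph to the representative of its class. -/
noncomputable def ofIso [Finite V] [Finite E] (G : IoGraph V E a) (hG : G.IsIoda) :
    G.Iso (of G hG).rep.graph :=
  (exists_iso G hG).choose_spec.some

end IodaClass

/-! ### Labelled graphs (underlying sets) -/

/-- Isomorphism classes of ioda-graphs with vertices labelled by `X`: the disjoint union over `𝒢 a`
of the products of the `X (|in(v)|, |out(v)|)`. -/
def Lab (X : Arity → Type u) (a : Arity) : Type u :=
  Σ s : IodaClass a, ∀ v : s.Vert, X (s.ar v)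

namespace Lab

variable {V E V' E' : Type} {a a' : Arity} {X Y Z : Arity → Type u}

/-- The class of a labelled finite ioda-graph. -/
noncomputable def mk [Finite V] [Finite E] (G : IoGraph V E a) (hG : G.IsIoda)
    (x : ∀ v, X (G.ar v)) : Lab X a :=
  ⟨IodaClass.of G hG, fun u =>
    cast (congrArg X ((IodaClass.ofIso G hG).symm.ar u)) (x ((IodaClass.ofIso G hG).fV.symm u))⟩

/-- `z` is the class of the labelled graph `(G, x)`. -/
def Rep (G : IoGraph V E a) (x : ∀ v, X (G.ar v)) (z : Lab X a') : Prop :=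
  ∃ f : G.Iso z.1.rep.graph, ∀ v, HEq (z.2 (f.fV v)) (x v)

theorem rep_mk [Finite V] [Finite E] (G : IoGraph V E a) (hG : G.IsIoda)
    (x : ∀ v, X (G.ar v)) : Rep G x (mk G hG x) := by
  have key : ∀ v w, w = v → HEq (x w) (x v) := by rintro v _ rfl; rfl
  exact ⟨IodaClass.ofIso G hG, fun v =>
    (cast_heq _ _).trans (key _ _ (Equiv.symm_apply_apply (IodaClass.ofIso G hG).fV v))⟩

theorem rep_self (z : Lab X a) : Rep z.1.rep.graph z.2 z := ⟨.refl _, fun _ => HEq.rfl⟩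

theorem Rep.unique {G : IoGraph V E a} (hG : G.IsIoda) {x : ∀ v, X (G.ar v)} {z z' : Lab X a}
    (h : Rep G x z) (h' : Rep G x z') : z = z' := by
  obtain ⟨f, hf⟩ := h
  obtain ⟨g, hg⟩ := h'
  obtain ⟨s, y⟩ := z
  obtain ⟨t, y'⟩ := z'
  obtain rfl : s = t := IodaClass.eq_of_iso (f.symm.trans g)
  refine congrArg (Sigma.mk s) (funext fun u => ?_)
  obtain ⟨v, rfl⟩ := f.fV.surjective u
  have h1 := hg v
  rw [← f.fV_unique hG g v] at h1
  exact eq_of_heq ((hf v).trans h1.symm)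

theorem Rep.of_iso {G : IoGraph V E a} {G' : IoGraph V' E' a} {x : ∀ v, X (G.ar v)}
    {x' : ∀ v, X (G'.ar v)} (f : G.Iso G') (hf : ∀ v, HEq (x' (f.fV v)) (x v)) {z : Lab X a'}
    (h : Rep G' x' z) : Rep G x z := by
  obtain ⟨g, hg⟩ := h
  exact ⟨f.trans g, fun v => (hg _).trans (hf v)⟩

theorem Rep.congr {G : IoGraph V E a} {x : ∀ v, X (G.ar v)} {b c : Arity} (hbc : b = c)
    {z : Lab X b} {z' : Lab X c} (hz : HEq z' z) (h : Rep G x z) : Rep G x z' := by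
  subst hbc
  rwa [eq_of_heq hz]

/-- Functoriality in the labels. -/
noncomputable def map (f : ∀ a, X a → Y a) (z : Lab X a) : Lab Y a := ⟨z.1, fun v => f _ (z.2 v)⟩

theorem Rep.map (f : ∀ a, X a → Y a) {G : IoGraph V E a} {x : ∀ v, X (G.ar v)} {z : Lab X a'}
    (h : Rep G x z) : Rep G (fun v => f _ (x v)) (z.map f) := by
  obtain ⟨g, hg⟩ := h
  refine ⟨g, fun v => ?_⟩
  have key : ∀ (b c : Arity) (_ : b = c) (p : X b) (q : X c), HEq p q → HEq (f b p) (f c q) := by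
    rintro b _ rfl p q h
    rw [eq_of_heq h]
  exact key _ _ (g.ar v) _ _ (hg v)

/-- The unit: labelled corollas. -/
noncomputable def unit (x : X a) : Lab X a :=
  mk (IoGraph.corolla a) (IoGraph.corolla_isIoda a) fun _ => x

/-- The multiplication: a graph with vertices labelled by labelled graphs is turned into a labelled
graph by substitution. -/
noncomputable def mul (z : Lab (Lab X) a) : Lab X a :=
  mk (z.1.rep.graph.subst fun v => (z.2 v).1.rep.graph)
    (IoGraph.subst_isIoda z.1.rep.isIoda fun v => (z.2 v).1.rep.isIoda)
    fun p => (z.2 p.1).2 p.2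

theorem Rep.mul {K : IoGraph V E a} {y : ∀ v, Lab X (K.ar v)} {z : Lab (Lab X) a}
    (hz : Rep K y z) {W F : V → Type} {H : ∀ v, IoGraph (W v) (F v) (K.ar v)}
    {x : ∀ v w, X ((H v).ar w)} (hy : ∀ v, Rep (H v) (x v) (y v)) :
    Rep (K.subst H) (fun p => x p.1 p.2) z.mul := by
  obtain ⟨f, hf⟩ := hz
  have h : ∀ v, Rep (H v) (x v) (z.2 (f.fV v)) := fun v =>
    (hy v).congr (f.ar v).symm (hf v)
  choose g hg using h
  exact (rep_mk _ _ _).of_iso (IoGraph.substIso f g) fun p => hg p.1 p.2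

theorem mul_unit (z : Lab X a) : (unit z).mul = z := by
  have h := (rep_mk (IoGraph.corolla a) (IoGraph.corolla_isIoda a) fun _ => z).mul
    (fun _ => rep_self z)
  exact (h.of_iso (IoGraph.corollaSubstIso z.1.rep.graph).symm fun _ => HEq.rfl).unique
    z.1.rep.isIoda (rep_self z)

theorem mul_map_unit (z : Lab X a) : (z.map fun _ => unit).mul = z := by
  have h := ((rep_self z).map fun _ => unit).mul
    (fun v => rep_mk (IoGraph.corolla _) (IoGraph.corolla_isIoda _) fun _ => z.2 v)
  exact (h.of_iso (IoGraph.substCorollaIso z.1.rep.graph).symm fun _ => HEq.rfl).unique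
    z.1.rep.isIoda (rep_self z)

theorem mul_mul (z : Lab (Lab (Lab X)) a) : z.mul.mul = (z.map fun _ => Lab.mul).mul := by
  have h1 := ((rep_self z).mul fun v => rep_self (z.2 v)).mul
    (fun p => rep_self ((z.2 p.1).2 p.2))
  have h2 := ((rep_self z).map fun _ => Lab.mul).mul
    (fun v => (rep_self (z.2 v)).mul fun w => rep_self ((z.2 v).2 w))
  refine h1.unique ?_ (h2.of_iso (IoGraph.substAssocIso z.1.rep.graph
    (fun v => (z.2 v).1.rep.graph) (fun v w => ((z.2 v).2 w).1.rep.graph)) fun _ => HEq.rfl)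
  exact IoGraph.subst_isIoda (IoGraph.subst_isIoda z.1.rep.isIoda fun v => (z.2 v).1.rep.isIoda)
    fun p => ((z.2 p.1).2 p.2).1.rep.isIoda

theorem map_mk [Finite V] [Finite E] (f : ∀ a, X a → Y a) (G : IoGraph V E a) (hG : G.IsIoda)
    (x : ∀ v, X (G.ar v)) : (mk G hG x).map f = mk G hG fun v => f _ (x v) :=
  ((rep_mk G hG x).map f).unique hG (rep_mk G hG _)

theorem map_unit (f : ∀ a, X a → Y a) (x : X a) : (unit x).map f = unit (f a x) :=
  map_mk _ _ _ _

theorem map_mul (f : ∀ a, X a → Y a) (z : Lab (Lab X) a) :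
    z.mul.map f = (z.map fun _ => Lab.map f).mul :=
  map_mk _ _ _ _

end Lab

/-! ### Compactly generated Hausdorff spaces -/

open CategoryTheory

/-- Compactly generated Hausdorff spaces. -/
structure CGHaus : Type (u + 1) where
  carrier : Type u
  [top : TopologicalSpace carrier]
  [t2 : T2Space carrier]
  [cg : CompactlyGeneratedSpace carrier]

namespace CGHaus

instance : CoeSort CGHaus.{u} (Type u) := ⟨carrier⟩

attribute [instance] top t2 cg

/-- Morphisms of compactly generated Hausdorff spaces: continuous maps. -/
@[ext]
structure Hom (X Y : CGHaus.{u}) where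
  hom : C(X, Y)

instance : Category CGHaus.{u} where
  Hom X Y := Hom X Y
  id X := ⟨ContinuousMap.id X⟩
  comp f g := ⟨g.hom.comp f.hom⟩

@[ext]
theorem hom_ext {X Y : CGHaus.{u}} {f g : X ⟶ Y} (h : ∀ x, f.hom x = g.hom x) : f = g :=
  Hom.ext (ContinuousMap.ext h)

@[simp]
theorem id_hom (X : CGHaus.{u}) (x : X) : Hom.hom (𝟙 X) x = x := rfl

@[simp]
theorem comp_hom {X Y Z : CGHaus.{u}} (f : X ⟶ Y) (g : Y ⟶ Z) (x : X) :
    Hom.hom (f ≫ g) x = g.hom (f.hom x) := rfl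

theorem cg_of_compact (A : Type u) [TopologicalSpace A] [CompactSpace A] [T2Space A] :
    CompactlyGeneratedSpace A :=
  compactlyGeneratedSpace_of_continuous_maps fun _ h => h A id continuous_id

/-- The underlying set of the product in the category of compactly generated Hausdorff spaces. -/
def KProd {ι : Type} (X : ι → CGHaus.{u}) : Type u := ∀ i, X i

namespace KProd

variable {ι : Type} (X : ι → CGHaus.{u})

/-- The compactly generated topology associated with the product topology. -/
instance : TopologicalSpace (KProd X) := TopologicalSpace.compactlyGenerated.{u} (∀ i, X i)

theorem continuous_toPi : Continuous (fun (x : KProd X) (i : ι) => x i) := by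
  change @Continuous (∀ i, X i) (∀ i, X i)
    (TopologicalSpace.compactlyGenerated.{u} (∀ i, X i)) _ id
  exact continuous_from_compactlyGenerated (X := ∀ i, X i) (Y := ∀ i, X i) id
    fun _ g => g.continuous

theorem continuous_apply (i : ι) : Continuous (fun x : KProd X => x i) :=
  (_root_.continuous_apply i).comp (continuous_toPi X)

variable {X}

theorem continuous_mk {A : Type u} [TopologicalSpace A] [CompactlyGeneratedSpace A]
    {f : A → KProd X} (hf : ∀ i, Continuous fun a => f a i) : Continuous f := by
  refine continuous_from_uCompactlyGeneratedSpace f fun S g => ?_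
  let F : C(S, ∀ i, X i) := ⟨fun s i => f (g s) i, continuous_pi fun i => (hf i).comp g.continuous⟩
  have h : @Continuous (Σ i : (S : CompHaus.{u}) × C(S, ∀ i, X i), i.1) (∀ i, X i) _
      (TopologicalSpace.compactlyGenerated.{u} (∀ i, X i)) fun p => p.1.2 p.2 :=
    continuous_coinduced_rng
  let m : S → Σ i : (S : CompHaus.{u}) × C(S, ∀ i, X i), i.1 := fun s => ⟨⟨S, F⟩, s⟩
  have hm : Continuous m := continuous_sigmaMk
    (σ := fun i : (S : CompHaus.{u}) × C(S, ∀ i, X i) => (i.1 : Type u)) (i := ⟨S, F⟩)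
  exact @Continuous.comp _ _ _ _ _ (TopologicalSpace.compactlyGenerated.{u} (∀ i, X i)) m _ h hm

instance : T2Space (KProd X) :=
  T2Space.of_injective_continuous (f := fun (x : KProd X) (i : ι) => x i) (fun _ _ h => h)
    (continuous_toPi X)

instance : CompactlyGeneratedSpace (KProd X) :=
  uCompactlyGeneratedSpace_of_continuous_maps fun f h =>
    continuous_from_compactlyGenerated (X := ∀ i, X i) f fun S g =>
      have := cg_of_compact S.toTop
      h S ⟨g, continuous_mk fun i => (_root_.continuous_apply i).comp g.continuous⟩

end KProd

end CGHaus

/-- Topological io-sequences: families of compactly generated Hausdorff spaces indexed by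
`ℕ × ℕ ∖ {(0, 0)}`, with families of continuous maps as morphisms. -/
abbrev IoSeq : Type (u + 1) := Arity → CGHaus.{u}

/-! ### The monad `𝔾` -/

namespace IoSeq

/-- The component `𝔾(X)(a)`: the disjoint union, over isomorphism classes of ioda-graphs `G` with
legs `a`, of the products (in compactly generated Hausdorff spaces) `∏ v, X (|in(v)|, |out(v)|)`. -/
noncomputable def gObj (X : IoSeq.{u}) (a : Arity) : CGHaus.{u} :=
  CGHaus.mk (Σ s : IodaClass a, CGHaus.KProd fun v : s.Vert => X (s.ar v))

variable {X Y : IoSeq.{u}} {a : Arity}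

/-- Points of `𝔾(X)(a)` are labelled graphs. -/
def toLab (z : X.gObj a) : Lab (fun b => X b) a := z

theorem continuous_cast {b c : Arity} (h : b = c) :
    Continuous fun x : X b => (cast (congrArg (fun b => (X b).carrier) h) x : X c) := by
  subst h
  exact continuous_id

theorem continuous_labMk {V E : Type} [Finite V] [Finite E] (G : IoGraph V E a) (hG : G.IsIoda)
    {A : Type u} [TopologicalSpace A] [CompactlyGeneratedSpace A]
    {f : A → ∀ v, X (G.ar v)} (hf : ∀ v, Continuous fun t => f t v) :
    Continuous (Y := X.gObj a) fun t => Lab.mk (X := fun b => X b) G hG (f t) := by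
  refine (continuous_sigmaMk (σ := fun s : IodaClass a =>
    CGHaus.KProd fun v : s.Vert => X (s.ar v))).comp (CGHaus.KProd.continuous_mk fun u => ?_)
  exact (continuous_cast ((IodaClass.ofIso G hG).symm.ar u)).comp (hf _)

/-- Functoriality of `𝔾`. -/
noncomputable def gMap (f : X ⟶ Y) (a : Arity) : X.gObj a ⟶ Y.gObj a where
  hom :=
    { toFun := Lab.map fun b => (f b).hom
      continuous_toFun := by
        refine Continuous.sigma_map
          (τ := fun s : IodaClass a => CGHaus.KProd fun v : s.Vert => Y (s.ar v)) (f₁ := id)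
          (f₂ := fun (s : IodaClass a) (x : CGHaus.KProd fun v : s.Vert => X (s.ar v)) =>
            (fun v => (f _).hom (x v) : CGHaus.KProd fun v : s.Vert => Y (s.ar v))) fun s => ?_
        exact CGHaus.KProd.continuous_mk fun v =>
          (f _).hom.continuous.comp (CGHaus.KProd.continuous_apply _ v) }

/-- The unit of `𝔾`. -/
noncomputable def gUnit (X : IoSeq.{u}) (a : Arity) : X a ⟶ X.gObj a where
  hom := ⟨fun x => Lab.unit (X := fun b => X b) x, continuous_labMk _ _ fun _ => continuous_id⟩

theorem continuous_mul (X : IoSeq.{u}) (a : Arity) :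
    Continuous (X := IoSeq.gObj X.gObj a) (Y := X.gObj a) (Lab.mul (X := fun b => X b)) := by
  refine continuous_sigma (σ := fun s : IodaClass a =>
    CGHaus.KProd fun v : s.Vert => IoSeq.gObj X (s.ar v)) fun s => ?_
  refine continuous_from_uCompactlyGeneratedSpace _ fun S g => ?_
  have hy : ∀ v : s.Vert, Continuous fun t : S => (g t) v := fun v =>
    (CGHaus.KProd.continuous_apply _ v).comp g.continuous
  rw [continuous_iff_continuousAt]
  intro t₀
  let U : Set S := {t | ∀ v : s.Vert, ((g t) v).1 = ((g t₀) v).1}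
  have hU : IsClopen U := by
    have : U = ⋂ v : s.Vert, (fun t : S => (g t) v) ⁻¹' (Sigma.fst ⁻¹' {((g t₀) v).1}) := by
      ext t
      rw [Set.mem_iInter]
      rfl
    rw [this]
    refine isClopen_iInter_of_finite fun v => IsClopen.preimage ?_ (hy v)
    have h := isClopen_range_sigmaMk (X := fun c : IodaClass (s.ar v) =>
      CGHaus.KProd fun w : c.Vert => X (c.ar w)) (i := ((g t₀) v).1)
    rwa [Set.range_sigmaMk] at h
  have hcU : CompactSpace U := isCompact_iff_compactSpace.1 hU.isClosed.isCompact
  have hex : ∀ (t : U) (v : s.Vert), ∃ x : CGHaus.KProd fun w : ((g t₀) v).1.Vert =>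
      X (((g t₀) v).1.ar w), (g t) v = (⟨((g t₀) v).1, x⟩ : X.gObj _) := by
    intro t v
    have ht := t.2 v
    generalize (g t) v = z at ht
    generalize ((g t₀) v).1 = c at ht
    subst ht
    exact ⟨z.2, rfl⟩
  choose x hx using hex
  have hxc : ∀ v, Continuous fun t => x t v := by
    intro v
    have hemb := Topology.IsEmbedding.sigmaMk (σ := fun c : IodaClass (s.ar v) =>
      CGHaus.KProd fun w : c.Vert => X (c.ar w)) (i := ((g t₀) v).1)
    rw [hemb.continuous_iff]
    refine ((hy v).comp continuous_subtype_val).congr fun t => ?_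
    exact hx t v
  have hcont : Continuous (Y := X.gObj a) fun t : U =>
      Lab.mul (X := fun b => X b) (a := a) ⟨s, g t⟩ := by
    have := CGHaus.cg_of_compact U
    have h := continuous_labMk (X := X) (A := U)
      (s.rep.graph.subst fun v => ((g t₀) v).1.rep.graph)
      (IoGraph.subst_isIoda s.rep.isIoda fun v => ((g t₀) v).1.rep.isIoda)
      (f := fun t p => x t p.1 p.2)
      (fun p => (CGHaus.KProd.continuous_apply _ p.2).comp (hxc p.1))
    refine h.congr fun t => ?_
    have : g t = fun v => (⟨((g t₀) v).1, x t v⟩ : X.gObj _) := funext fun v => hx t v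
    rw [this]
    rfl
  have hU₀ : t₀ ∈ U := fun v => rfl
  exact (continuousOn_iff_continuous_domRestrict.2 hcont).continuousAt (hU.isOpen.mem_nhds hU₀)

/-- The multiplication of `𝔾`. -/
noncomputable def gMul (X : IoSeq.{u}) (a : Arity) : IoSeq.gObj X.gObj a ⟶ X.gObj a where
  hom := ⟨Lab.mul (X := fun b => X b), continuous_mul X a⟩

end IoSeq

/-- The monad `𝔾` on topological io-sequences. -/
noncomputable def gMonad : Monad IoSeq.{u} where
  obj X := X.gObj
  map f := IoSeq.gMap f
  map_id _ := rfl
  map_comp _ _ := rfl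
  η :=
    { app := fun X => X.gUnit
      naturality := fun _ _ f => funext fun _ => CGHaus.hom_ext fun x =>
        (Lab.map_unit (fun b => (f b).hom) x).symm }
  μ :=
    { app := fun X => X.gMul
      naturality := fun _ _ f => funext fun _ => CGHaus.hom_ext fun z =>
        (Lab.map_mul (fun b => (f b).hom) z).symm }
  assoc X := funext fun a => CGHaus.hom_ext fun z =>
    (Lab.mul_mul (X := fun b => X b) (a := a) z).symm
  left_unit X := funext fun a => CGHaus.hom_ext fun z =>
    Lab.mul_unit (X := fun b => X b) (a := a) z
  right_unit X := funext fun a => CGHaus.hom_ext fun z =>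
    Lab.mul_map_unit (X := fun b => X b) (a := a) z

/-- Topological io-properads: algebras over the monad `𝔾`. -/
abbrev IoProperad : Type (u + 1) := gMonad.{u}.Algebra

/-! ### Hurewicz weak equivalences and cofibrations -/

/-- Hurewicz cofibrations of compactly generated Hausdorff spaces: the homotopy extension property.
(The product of such a space with the unit interval is compactly generated.) -/
def CGHaus.IsHurewiczCofibration {X Y : CGHaus.{u}} (f : X ⟶ Y) : Prop :=
  ∀ (Z : CGHaus.{u}) (g : C(Y, Z)) (H : C(X × unitInterval, Z)),
    (∀ x, H (x, 0) = g (f.hom x)) →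
      ∃ H' : C(Y × unitInterval, Z), (∀ y, H' (y, 0) = g y) ∧ ∀ x t, H' (f.hom x, t) = H (x, t)

/-- A map of topological io-sequences which is componentwise a Hurewicz cofibration. -/
def IoSeq.IsHurewiczCofibration {X Y : IoSeq.{u}} (f : X ⟶ Y) : Prop :=
  ∀ a, CGHaus.IsHurewiczCofibration (f a)

/-- A map of topological io-sequences which is componentwise a homotopy equivalence. -/
def IoSeq.IsHurewiczWeakEquiv {X Y : IoSeq.{u}} (f : X ⟶ Y) : Prop :=
  ∀ a, ∃ e : ContinuousMap.HomotopyEquiv (X a) (Y a), e.toFun = (f a).hom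

/-- A map of io-properads is a Hurewicz weak equivalence if the underlying map of topological
io-sequences is one. -/
def IoProperad.IsHurewiczWeakEquiv {P Q : IoProperad.{u}} (f : P ⟶ Q) : Prop :=
  IoSeq.IsHurewiczWeakEquiv f.f

/-! ### The simplicial object of iterates of a comonad -/

namespace ComonadBar

open Opposite

universe v w

variable {D : Type w} [Category.{v} D] (K : Comonad D)

/-- The iterates `Kⁿ A`. -/
def iter : ℕ → D → D
  | 0, A => A
  | n + 1, A => K.obj (iter n A)

/-- The counit `Kⁿ⁺¹ A ⟶ Kⁿ A` at the outermost factor. -/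
def eps (n : ℕ) (A : D) : iter K (n + 1) A ⟶ iter K n A := K.ε.app (iter K n A)

/-- The comultiplication `Kⁿ⁺¹ A ⟶ Kⁿ⁺² A` at the outermost factor. -/
def del (n : ℕ) (A : D) : iter K (n + 1) A ⟶ iter K (n + 2) A := K.δ.app (iter K n A)

/-- The functor `K` on maps between iterates. -/
def kap {m n : ℕ} {A B : D} (f : iter K m A ⟶ iter K n B) :
    iter K (m + 1) A ⟶ iter K (n + 1) B := K.map f

section

variable {l m n : ℕ} {A B C : D}

theorem kap_id : kap K (𝟙 (iter K n A)) = 𝟙 _ := K.map_id _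

theorem kap_comp (f : iter K l A ⟶ iter K m B) (g : iter K m B ⟶ iter K n C) :
    kap K (f ≫ g) = kap K f ≫ kap K g := K.map_comp f g

theorem kap_eps (f : iter K m A ⟶ iter K n B) : kap K f ≫ eps K n B = eps K m A ≫ f :=
  K.ε.naturality f

theorem kap_del (f : iter K m A ⟶ iter K n B) :
    kap K f ≫ del K n B = del K m A ≫ kap K (kap K f) := K.δ.naturality f

theorem del_eps : del K n A ≫ eps K (n + 1) A = 𝟙 _ := K.left_counit _

theorem del_kap_eps : del K n A ≫ kap K (eps K n A) = 𝟙 _ := K.right_counit _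

theorem del_kap_del : del K n A ≫ kap K (del K n A) = del K n A ≫ del K (n + 1) A :=
  K.coassoc _

variable {X : D}

theorem kap_eps_assoc (f : iter K m A ⟶ iter K n B) (h : iter K n B ⟶ X) :
    kap K f ≫ eps K n B ≫ h = eps K m A ≫ f ≫ h := by
  rw [← Category.assoc, kap_eps, Category.assoc]

theorem kap_del_assoc (f : iter K m A ⟶ iter K n B) (h : iter K (n + 2) B ⟶ X) :
    kap K f ≫ del K n B ≫ h = del K m A ≫ kap K (kap K f) ≫ h := by
  rw [← Category.assoc, kap_del, Category.assoc]

theorem del_eps_assoc (h : iter K (n + 1) A ⟶ X) :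
    del K n A ≫ eps K (n + 1) A ≫ h = h := by
  rw [← Category.assoc, del_eps, Category.id_comp]

theorem del_kap_del_assoc (h : iter K (n + 3) A ⟶ X) :
    del K n A ≫ kap K (del K n A) ≫ h = del K n A ≫ del K (n + 1) A ≫ h := by
  rw [← Category.assoc, del_kap_del, Category.assoc]

end

/-- Functoriality of the iterates. -/
def iterMap {A B : D} (g : A ⟶ B) : ∀ n, iter K n A ⟶ iter K n B
  | 0 => g
  | n + 1 => kap K (iterMap g n)

theorem iterMap_succ {A B : D} (g : A ⟶ B) (n : ℕ) :
    iterMap K g (n + 1) = kap K (iterMap K g n) := rfl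

/-- The iterated counit `Kⁿ A ⟶ A`. -/
def aug (A : D) : ∀ n, iter K n A ⟶ iter K 0 A
  | 0 => 𝟙 _
  | n + 1 => eps K n A ≫ aug A n

/-- The first value removed from the domain. -/
def tail {m n : ℕ} (f : Fin (n + 1) →o Fin m) : Fin n →o Fin m :=
  f.comp ⟨Fin.succ, Fin.strictMono_succ.monotone⟩

/-- A monotone map missing `0`, with values shifted by one. -/
def lower {m n : ℕ} (f : Fin (n + 1) →o Fin (m + 1)) (h : f 0 ≠ 0) : Fin (n + 1) →o Fin m where
  toFun i := (f i).pred fun hi => h (Fin.le_zero_iff.1 (hi ▸ f.monotone (Fin.zero_le i)))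
  monotone' _ _ hij := Fin.pred_le_pred_iff.2 (f.monotone hij)

/-- Composition with `Fin.succ`. -/
def raise {m n : ℕ} (f : Fin n →o Fin m) : Fin n →o Fin (m + 1) :=
  OrderHom.comp ⟨Fin.succ, Fin.strictMono_succ.monotone⟩ f

theorem raise_lower {m n : ℕ} (f : Fin (n + 1) →o Fin (m + 1)) (h : f 0 ≠ 0) :
    raise (lower f h) = f :=
  OrderHom.ext _ _ (funext fun i => Fin.succ_pred (f i) fun hi =>
    h (Fin.le_zero_iff.1 (hi ▸ f.monotone (Fin.zero_le i))))

theorem lower_raise {m n : ℕ} (f : Fin (n + 1) →o Fin m) (h : raise f 0 ≠ 0) :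
    lower (raise f) h = f :=
  OrderHom.ext _ _ (funext fun i => Fin.pred_succ (f i) (h := Fin.succ_ne_zero _))

/-- The map `Kᵐ A ⟶ Kⁿ A` given by a monotone map `Fin n → Fin m`: a factor with `k` preimages is
comultiplied into `k` factors (by the counit if `k = 0`). -/
def barMap (A : D) : ∀ m n : ℕ, (Fin n →o Fin m) → (iter K m A ⟶ iter K n A)
  | m, 0, _ => aug K A m
  | 0, _ + 1, f => (f 0).elim0
  | m + 1, n + 1, f =>
    if h : f 0 = 0 then del K m A ≫ kap K (barMap A (m + 1) n (tail f))
    else eps K m A ≫ barMap A m (n + 1) (lower f h)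
termination_by m n => m + n

theorem barMap_zero (A : D) {m : ℕ} (f : Fin 0 →o Fin m) : barMap K A m 0 f = aug K A m := by
  rw [barMap]

theorem barMap_of_eq (A : D) {m n : ℕ} (f : Fin (n + 1) →o Fin (m + 1)) (h : f 0 = 0) :
    barMap K A (m + 1) (n + 1) f = del K m A ≫ kap K (barMap K A (m + 1) n (tail f)) := by
  rw [barMap, dif_pos h]

theorem barMap_raise (A : D) {m n : ℕ} (f : Fin n →o Fin m) :
    barMap K A (m + 1) n (raise f) = eps K m A ≫ barMap K A m n f := by
  cases n with
  | zero => rw [barMap_zero, barMap_zero]; rfl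
  | succ n =>
    have h : raise f 0 ≠ 0 := Fin.succ_ne_zero _
    rw [barMap, dif_neg h, lower_raise]

theorem barMap_id (A : D) (n : ℕ) : barMap K A n n OrderHom.id = 𝟙 _ := by
  induction n with
  | zero => rw [barMap_zero]; rfl
  | succ n ih =>
    rw [barMap_of_eq K A _ rfl]
    have : tail (OrderHom.id : Fin (n + 1) →o Fin (n + 1)) = raise OrderHom.id := rfl
    rw [this, barMap_raise, ih, Category.comp_id, del_kap_eps]

theorem barMap_comp (A : D) : ∀ (l m n : ℕ) (g : Fin m →o Fin l) (f : Fin n →o Fin m),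
    barMap K A l m g ≫ barMap K A m n f = barMap K A l n (g.comp f)
  | l, 0, 0, g, f => by
    rw [barMap_zero, barMap_zero, barMap_zero]
    exact Category.comp_id _
  | 0, m + 1, _, g, _ => (g 0).elim0
  | l, 0, n + 1, _, f => (f 0).elim0
  | l + 1, m + 1, n, g, f => by
    by_cases hg : g 0 = 0
    · by_cases hf : ∃ f', raise f' = f
      · obtain ⟨f', rfl⟩ := hf
        have ih := barMap_comp A (l + 1) m n (tail g) f'
        have e : (tail g).comp f' = g.comp (raise f') := rfl
        rw [barMap_raise, barMap_of_eq K A g hg, ← e, ← ih, Category.assoc, kap_eps_assoc,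
          del_eps_assoc]
      · match n, f, hf with
        | 0, f, hf => exact absurd ⟨⟨Fin.elim0, fun i => i.elim0⟩,
            OrderHom.ext _ _ (funext fun i => i.elim0)⟩ hf
        | n + 1, f, hf =>
          have hf0 : f 0 = 0 := by
            by_contra h
            exact hf ⟨_, raise_lower f h⟩
          have hgf : g.comp f 0 = 0 := (congrArg g hf0).trans hg
          have ih := barMap_comp A (l + 1) (m + 1) n g (tail f)
          have e : tail (g.comp f) = g.comp (tail f) := rfl
          rw [barMap_of_eq K A f hf0, barMap_of_eq K A (g.comp f) hgf, e, ← ih,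
            barMap_of_eq K A g hg, Category.assoc, kap_del_assoc, kap_comp, kap_comp,
            Category.assoc, del_kap_del_assoc]
    · obtain ⟨g', rfl⟩ : ∃ g', raise g' = g := ⟨_, raise_lower g hg⟩
      have ih := barMap_comp A l (m + 1) n g' f
      have e : (raise g').comp f = raise (g'.comp f) := rfl
      rw [e, barMap_raise, barMap_raise, Category.assoc, ih]
termination_by l m n => l + m + n

theorem aug_naturality {A B : D} (g : A ⟶ B) (m : ℕ) :
    iterMap K g m ≫ aug K B m = aug K A m ≫ iterMap K g 0 := by
  induction m with
  | zero => exact (Category.comp_id _).trans (Category.id_comp _).symm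
  | succ m ih => rw [aug, aug, iterMap_succ, kap_eps_assoc, ih, Category.assoc]

theorem barMap_naturality {A B : D} (g : A ⟶ B) : ∀ (m n : ℕ) (f : Fin n →o Fin m),
    iterMap K g m ≫ barMap K B m n f = barMap K A m n f ≫ iterMap K g n
  | m, 0, f => by
    rw [barMap_zero, barMap_zero]
    exact aug_naturality K g m
  | 0, _ + 1, f => (f 0).elim0
  | m + 1, n + 1, f => by
    by_cases h : f 0 = 0
    · rw [barMap_of_eq K A f h, barMap_of_eq K B f h]
      have ih := barMap_naturality g (m + 1) n (tail f)
      rw [iterMap_succ, kap_del_assoc, ← kap_comp, ← iterMap_succ, ih, kap_comp, Category.assoc,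
        iterMap_succ K g n]
    · obtain ⟨f', rfl⟩ : ∃ f', raise f' = f := ⟨_, raise_lower f h⟩
      have ih := barMap_naturality g m (n + 1) f'
      rw [barMap_raise, barMap_raise, Category.assoc, ← ih, iterMap_succ, kap_eps_assoc]
termination_by m n => m + n

/-- The simplicial object `n ↦ Kⁿ⁺¹ A`, functorially in `A`. -/
def bar : D ⥤ SimplicialObject D where
  obj A :=
    { obj := fun n => iter K (n.unop.len + 1) A
      map := fun f => barMap K A _ _ f.unop.toOrderHom
      map_id := fun n => barMap_id K A _
      map_comp := fun f g => (barMap_comp K A _ _ _ _ _).symm }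
  map g :=
    { app := fun n => iterMap K g _
      naturality := fun _ _ f => (barMap_naturality K g _ _ _).symm }
  map_id A := by
    have h : ∀ n, iterMap K (𝟙 A) n = 𝟙 _ := by
      intro n
      induction n with
      | zero => rfl
      | succ n ih => rw [iterMap, ih]; exact kap_id K
    ext n
    exact h _
  map_comp {A B C} f g := by
    have h : ∀ n, iterMap K (f ≫ g) n = iterMap K f n ≫ iterMap K g n := by
      intro n
      induction n with
      | zero => rfl
      | succ n ih => rw [iterMap, ih]; exact kap_comp K _ _
    ext n
    exact h _

theorem barMap_of_raise (A : D) {m n : ℕ} (f : Fin (n + 1) →o Fin (m + 1)) (f' : Fin n →o Fin m)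
    (h : f 0 = 0) (h' : ∀ i, f i.succ = (f' i).succ) :
    barMap K A (m + 1) (n + 1) f = kap K (barMap K A m n f') := by
  have e : tail f = raise f' := OrderHom.ext _ _ (funext h')
  rw [barMap_of_eq K A f h, e, barMap_raise, kap_comp, ← Category.assoc, del_kap_eps,
    Category.id_comp]

/-! The faces of `bar K` are `d₀ = ε` and `dᵢ₊₁ = K dᵢ`, i.e. `dᵢ = Kⁱ ε`; the degeneracies are
`s₀ = δ` and `sᵢ₊₁ = K sᵢ`, i.e. `sᵢ = Kⁱ δ`. -/

theorem bar_δ_zero (A : D) (n : ℕ) :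
    ((bar K).obj A).δ (0 : Fin (n + 2)) = K.ε.app (iter K (n + 1) A) := by
  have e : (SimplexCategory.δ (0 : Fin (n + 2))).toOrderHom =
      raise (OrderHom.id : Fin (n + 1) →o Fin (n + 1)) :=
    OrderHom.ext _ _ (funext fun i => Fin.succAbove_zero_apply i)
  change barMap K A (n + 2) (n + 1) (SimplexCategory.δ (0 : Fin (n + 2))).toOrderHom = _
  rw [e, barMap_raise, barMap_id]
  exact Category.comp_id _

theorem bar_δ_succ (A : D) (n : ℕ) (i : Fin (n + 2)) :
    ((bar K).obj A).δ i.succ = K.map (((bar K).obj A).δ i) :=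
  barMap_of_raise K A (m := n + 2) (n := n + 1) (SimplexCategory.δ i.succ).toOrderHom
    (SimplexCategory.δ i).toOrderHom (Fin.succ_succAbove_zero i) (Fin.succ_succAbove_succ i)

theorem bar_σ_zero (A : D) (n : ℕ) :
    ((bar K).obj A).σ (0 : Fin (n + 1)) = K.δ.app (iter K n A) := by
  change barMap K A (n + 1) (n + 2) (SimplexCategory.σ (0 : Fin (n + 1))).toOrderHom = _
  have e : tail (m := n + 1) (n := n + 1) (SimplexCategory.σ (0 : Fin (n + 1))).toOrderHom =
      OrderHom.id := OrderHom.ext _ _ (funext fun i => Fin.predAbove_zero_succ)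
  have h0 : (SimplexCategory.σ (0 : Fin (n + 1))).toOrderHom 0 = 0 :=
    Fin.predAbove_right_zero (i := (0 : Fin (n + 1)))
  rw [barMap_of_eq K A _ h0, e, barMap_id, kap_id]
  exact Category.comp_id _

theorem bar_σ_succ (A : D) (n : ℕ) (i : Fin (n + 1)) :
    ((bar K).obj A).σ i.succ = K.map (((bar K).obj A).σ i) :=
  barMap_of_raise K A (m := n + 1) (n := n + 2) (SimplexCategory.σ i.succ).toOrderHom
    (SimplexCategory.σ i).toOrderHom (Fin.predAbove_right_zero (i := i.succ))
    (fun j => Fin.succ_predAbove_succ i j)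

end ComonadBar

/-! ### The bar construction of io-properads -/

/-- The comonad on io-properads given by the free io-properad on the underlying io-sequence. -/
noncomputable abbrev freeComonad : Comonad IoProperad.{u} := gMonad.{u}.adj.toComonad

/-- The bar construction `B_•(𝔾, 𝔾, P)`, a simplicial io-properad with `n`-simplices `𝔾ⁿ⁺¹(P)`. -/
noncomputable def IoProperad.bar : IoProperad.{u} ⥤ SimplicialObject IoProperad.{u} :=
  ComonadBar.bar freeComonad

/-! ### Colimits of io-properads -/

/-- The structure map of an io-properad on labelled graphs: properad composition. -/
noncomputable def IoProperad.act (Y : IoProperad.{u}) {a : Arity} (z : Lab (fun b => Y.A b) a) : Y.A a :=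
  (Y.a a).hom z

namespace IoProperad

theorem act_unit (Y : IoProperad.{u}) {a : Arity} (y : Y.A a) :
    Y.act (Lab.unit (X := fun b => Y.A b) y) = y :=
  congrArg (fun f : Y.A ⟶ Y.A => (f a).hom y) Y.unit

theorem act_mul (Y : IoProperad.{u}) {a : Arity} (z : Lab (Lab fun b => Y.A b) a) :
    Y.act z.mul = Y.act (z.map fun _ => Y.act) :=
  congrArg (fun f : gMonad.obj (gMonad.obj Y.A) ⟶ Y.A => (f a).hom z) Y.assoc

theorem hom_act {Y Z : IoProperad.{u}} (h : Y ⟶ Z) {a : Arity} (z : Lab (fun b => Y.A b) a) :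
    (h.f a).hom (Y.act z) = Z.act (z.map fun b => (h.f b).hom) :=
  (congrArg (fun f : gMonad.obj Y.A ⟶ Z.A => (f a).hom z) h.h).symm

theorem hom_ext' {Y Z : IoProperad.{u}} {f g : Y ⟶ Z}
    (h : ∀ a (y : Y.A a), (f.f a).hom y = (g.f a).hom y) : f = g :=
  Monad.Algebra.Hom.ext (funext fun a => CGHaus.hom_ext (h a))

theorem compactlyGenerated_cg (X : Type u) [t : TopologicalSpace X] :
    @CompactlyGeneratedSpace X (TopologicalSpace.compactlyGenerated.{u} X) := by
  refine @uCompactlyGeneratedSpace_of_continuous_maps X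
    (TopologicalSpace.compactlyGenerated.{u} X) fun f h => ?_
  refine continuous_from_compactlyGenerated (X := X) f fun S g => ?_
  have hg : @Continuous S X _ (TopologicalSpace.compactlyGenerated.{u} X) g := by
    have h : @Continuous (Σ i : (S : CompHaus.{u}) × C(S, X), i.1) X _
        (TopologicalSpace.compactlyGenerated.{u} X) fun p => p.1.2 p.2 := continuous_coinduced_rng
    let m : S → Σ i : (S : CompHaus.{u}) × C(S, X), i.1 := fun s => ⟨⟨S, g⟩, s⟩
    have hm : Continuous m := continuous_sigmaMk
      (σ := fun i : (S : CompHaus.{u}) × C(S, X) => (i.1 : Type u)) (i := ⟨S, g⟩)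
    exact @Continuous.comp _ _ _ _ _ (TopologicalSpace.compactlyGenerated.{u} X) m _ h hm
  exact h S (@ContinuousMap.mk S X _ (TopologicalSpace.compactlyGenerated.{u} X) g hg)

theorem continuous_to_compactlyGenerated {A X : Type u} [TopologicalSpace A]
    [CompactlyGeneratedSpace A] [TopologicalSpace X] {f : A → X} (hf : Continuous f) :
    @Continuous A X _ (TopologicalSpace.compactlyGenerated.{u} X) f := by
  refine @continuous_from_uCompactlyGeneratedSpace A X _
    (TopologicalSpace.compactlyGenerated.{u} X) _ f fun S g => ?_
  have h : @Continuous (Σ i : (S : CompHaus.{u}) × C(S, X), i.1) X _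
      (TopologicalSpace.compactlyGenerated.{u} X) fun p => p.1.2 p.2 := continuous_coinduced_rng
  let F : C(S, X) := ⟨f ∘ g, hf.comp g.continuous⟩
  let m : S → Σ i : (S : CompHaus.{u}) × C(S, X), i.1 := fun s => ⟨⟨S, F⟩, s⟩
  have hm : Continuous m := continuous_sigmaMk
    (σ := fun i : (S : CompHaus.{u}) × C(S, X) => (i.1 : Type u)) (i := ⟨S, F⟩)
  exact @Continuous.comp _ _ _ _ _ (TopologicalSpace.compactlyGenerated.{u} X) m _ h hm

/-! #### Io-properads with prescribed generators and relations -/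

section Generated

variable (S : Arity → Type u) (C : ∀ Y : IoProperad.{u}, (∀ a, S a → Y.A a) → Prop)

/-- The value in `Y` of a formal composite of generators. -/
noncomputable def ev {S : Arity → Type u} {Y : IoProperad.{u}} (e : ∀ a, S a → Y.A a) {a : Arity}
    (z : Lab S a) : Y.A a := Y.act (z.map e)

/-- Two formal composites are identified if they agree in all admissible io-properads. -/
def genSetoid (a : Arity) : Setoid (Lab S a) where
  r z z' := ∀ (Y : IoProperad.{u}) (e : ∀ a, S a → Y.A a), C Y e → ev e z = ev e z'
  iseqv := ⟨fun _ _ _ _ => rfl, fun h Y e hC => (h Y e hC).symm,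
    fun h h' Y e hC => (h Y e hC).trans (h' Y e hC)⟩

/-- The underlying sets of the io-properad generated by `S`. -/
def Gen (a : Arity) : Type u := Quotient (genSetoid S C a)

variable {S C}

/-- The evaluation of the generated io-properad in an admissible one. -/
noncomputable def genEv {Y : IoProperad.{u}} {e : ∀ a, S a → Y.A a} (hC : C Y e) {a : Arity}
    (x : Gen S C a) : Y.A a :=
  Quotient.lift (s := genSetoid S C a) (ev e) (fun _ _ h => h Y e hC) x

theorem gen_ext {a : Arity} {x y : Gen S C a}
    (h : ∀ (Y : IoProperad.{u}) (e : ∀ a, S a → Y.A a) (hC : C Y e), genEv hC x = genEv hC y) :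
    x = y := by
  induction x using Quotient.inductionOn
  induction y using Quotient.inductionOn
  exact Quotient.sound h

variable (S C)

/-- The initial topology with respect to all evaluations. -/
@[reducible]
def genTop (a : Arity) : TopologicalSpace (Gen S C a) :=
  sInf {t | ∃ (Y : IoProperad.{u}) (e : ∀ a, S a → Y.A a) (hC : C Y e),
    t = TopologicalSpace.induced (genEv hC) inferInstance}

instance (a : Arity) : TopologicalSpace (Gen S C a) :=
  @TopologicalSpace.compactlyGenerated.{u} (Gen S C a) (genTop S C a)

instance (a : Arity) : CompactlyGeneratedSpace (Gen S C a) :=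
  @compactlyGenerated_cg _ (genTop S C a)

variable {S C}

theorem continuous_genEv {Y : IoProperad.{u}} {e : ∀ a, S a → Y.A a} (hC : C Y e) (a : Arity) :
    Continuous (genEv hC : Gen S C a → Y.A a) := by
  refine @continuous_from_compactlyGenerated (Gen S C a) (Y.A a) (genTop S C a) _ _ fun K g => ?_
  have h : @Continuous _ _ (genTop S C a) _ (genEv hC : Gen S C a → Y.A a) :=
    continuous_iff_le_induced.2 (sInf_le ⟨Y, e, hC, rfl⟩)
  exact @Continuous.comp _ _ _ _ (genTop S C a) _ _ _ h
    (@ContinuousMap.continuous _ _ _ (genTop S C a) g)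

theorem continuous_to_gen {A : Type u} [TopologicalSpace A] [CompactlyGeneratedSpace A] {a : Arity}
    {f : A → Gen S C a} (h : ∀ (Y : IoProperad.{u}) (e : ∀ a, S a → Y.A a) (hC : C Y e),
      Continuous fun t => genEv hC (f t)) : Continuous f := by
  refine @continuous_to_compactlyGenerated A _ _ _ (genTop S C a) f ?_
  refine continuous_sInf_rng.2 ?_
  rintro _ ⟨Y, e, hC, rfl⟩
  exact continuous_induced_rng.2 (h Y e hC)

instance (a : Arity) : T2Space (Gen S C a) where
  t2 x y hxy := by
    by_contra hcon
    refine hxy (gen_ext fun Y e hC => ?_)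
    by_contra hne
    exact hcon (separated_by_continuous (continuous_genEv hC a) hne)

/-- Composition in the generated io-properad. -/
noncomputable def genAct {a : Arity} (z : Lab (Gen S C) a) : Gen S C a :=
  Quotient.mk (genSetoid S C a) (z.map fun _ => Quotient.out).mul

theorem genEv_act {Y : IoProperad.{u}} {e : ∀ a, S a → Y.A a} (hC : C Y e) {a : Arity}
    (z : Lab (Gen S C) a) : genEv hC (genAct z) = Y.act (z.map fun _ => genEv hC) := by
  change Y.act (Lab.map e (Lab.mul _)) = _
  rw [Lab.map_mul, act_mul]
  refine congrArg Y.act (congrArg (Sigma.mk z.1) (funext fun v => ?_))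
  change ev e (Quotient.out (z.2 v)) = genEv hC (z.2 v)
  conv_rhs => rw [← Quotient.out_eq (s := genSetoid S C _) (z.2 v)]
  rfl

theorem genEv_act_unit {Y : IoProperad.{u}} {e : ∀ a, S a → Y.A a} (hC : C Y e) {a : Arity}
    (x : Gen S C a) : genEv hC (genAct (Lab.unit x)) = genEv hC x := by
  rw [genEv_act, Lab.map_unit]
  exact act_unit Y _

theorem genEv_act_mul {Y : IoProperad.{u}} {e : ∀ a, S a → Y.A a} (hC : C Y e) {a : Arity}
    (z : Lab (Lab (Gen S C)) a) :
    genEv hC (genAct z.mul) = genEv hC (genAct (z.map fun _ => genAct)) := by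
  rw [genEv_act, genEv_act, Lab.map_mul, act_mul]
  refine congrArg Y.act (congrArg (Sigma.mk z.1) (funext fun v => ?_))
  exact (genEv_act hC (z.2 v)).symm

variable (S C)

/-- The underlying io-sequence of the generated io-properad. -/
def genSeq : IoSeq.{u} := fun a => CGHaus.mk (Gen S C a)

/-- The io-properad generated by `S`, universal among the admissible ones. -/
noncomputable def gen : IoProperad.{u} where
  A := genSeq S C
  a := fun a => ⟨⟨fun z => genAct (S := S) (C := C) z, continuous_to_gen fun Y e hC => by
    let E : genSeq S C ⟶ Y.A := fun b => ⟨⟨genEv hC, continuous_genEv hC b⟩⟩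
    refine ((Y.a a).hom.continuous.comp (IoSeq.gMap E a).hom.continuous).congr fun z => ?_
    exact (genEv_act hC z).symm⟩⟩
  unit := funext fun a => CGHaus.hom_ext fun x => gen_ext fun Y e hC => by
    change genEv hC (genAct (Lab.unit (X := Gen S C) x)) = genEv hC x
    exact genEv_act_unit hC x
  assoc := funext fun a => CGHaus.hom_ext fun z => gen_ext fun Y e hC => by
    change genEv hC (genAct (Lab.mul (X := Gen S C) z)) =
      genEv hC (genAct (Lab.map (fun _ => genAct (S := S) (C := C)) z))
    exact genEv_act_mul hC z

variable {S C}

/-- The map from the generated io-properad to an admissible one. -/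
noncomputable def genDesc {Y : IoProperad.{u}} {e : ∀ a, S a → Y.A a} (hC : C Y e) : gen S C ⟶ Y where
  f := fun b => ⟨⟨genEv hC, continuous_genEv hC b⟩⟩
  h := funext fun _ => CGHaus.hom_ext fun z => (genEv_act hC z).symm

variable (S C)

/-- The generators. -/
noncomputable def genIn (a : Arity) (s : S a) : (gen S C).A a :=
  Quotient.mk (genSetoid S C a) (Lab.unit s)

variable {S C}

theorem genDesc_in {Y : IoProperad.{u}} {e : ∀ a, S a → Y.A a} (hC : C Y e) {a : Arity} (s : S a) :
    ((genDesc hC).f a).hom (genIn S C a s) = e a s := by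
  change Y.act (Lab.map e (Lab.unit s)) = _
  rw [Lab.map_unit]
  exact act_unit Y _

theorem gen_hom_ext {Y : IoProperad.{u}} {f g : gen S C ⟶ Y}
    (h : ∀ a s, (f.f a).hom (genIn S C a s) = (g.f a).hom (genIn S C a s)) : f = g := by
  refine hom_ext' fun a x => ?_
  obtain ⟨z, rfl⟩ : ∃ z : Lab S a, (gen S C).act (z.map (genIn S C)) = x := by
    obtain ⟨z, rfl⟩ := Quotient.exists_rep x
    refine ⟨z, gen_ext fun Y e hC => ?_⟩
    refine (genEv_act hC _).trans ?_
    refine congrArg Y.act (congrArg (Sigma.mk z.1) (funext fun v => ?_))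
    exact genDesc_in hC (z.2 v)
  rw [hom_act, hom_act]
  refine congrArg Y.act (congrArg (Sigma.mk z.1) (funext fun v => h _ _))

/-- If admissibility is detected by maps to admissible io-properads, then the generated io-properad
is admissible. -/
theorem gen_admissible
    (hC : ∀ (T : IoProperad.{u}) (e : ∀ a, S a → T.A a),
      (∀ (a : Arity) (A : Type u) [TopologicalSpace A] [CompactlyGeneratedSpace A] (g : A → T.A a),
        (∀ (Y : IoProperad.{u}) (h : T ⟶ Y), C Y (fun a s => (h.f a).hom (e a s)) →
          Continuous fun t => (h.f a).hom (g t)) → Continuous g) →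
      (∀ (a : Arity) (x y : T.A a),
        (∀ (Y : IoProperad.{u}) (h : T ⟶ Y), C Y (fun a s => (h.f a).hom (e a s)) →
          (h.f a).hom x = (h.f a).hom y) → x = y) →
      C T e) :
    C (gen S C) (genIn S C) := by
  have key : ∀ {Y : IoProperad.{u}} {e : ∀ a, S a → Y.A a} (hC : C Y e),
      C Y (fun a s => ((genDesc hC).f a).hom (genIn S C a s)) := by
    intro Y e hC
    have : (fun a s => ((genDesc hC).f a).hom (genIn S C a s)) = e :=
      funext fun a => funext fun s => genDesc_in hC s
    rwa [this]
  refine hC _ _ (fun a A _ _ g hg => ?_) (fun a x y h => ?_)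
  · exact continuous_to_gen fun Y e hC => hg Y (genDesc hC) (key hC)
  · exact gen_ext fun Y e hC => h Y (genDesc hC) (key hC)

end Generated

end IoProperad


/-! ### Geometric realization in io-properads -/

open Simplicial Opposite

/-- A continuous family, parametrized by `Z`, of maps of io-properads `P ⟶ Q`: a continuous map from
`Z` to the space `[P, Q]` of maps of io-properads, or equivalently a map of io-properads from the
tensor `P ⊙ Z` to `Q`. (We use this for compact Hausdorff spaces `Z`, for which the product of
`P(a)` and `Z` is compactly generated.) -/
structure IoProperad.Family (P : IoProperad.{u}) (Z : Type) [TopologicalSpace Z]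
    (Q : IoProperad.{u}) where
  hom : Z → (P ⟶ Q)
  continuous : ∀ a : Arity, Continuous fun p : P.A a × Z => ((hom p.2).f a).hom p.1

/-- Compatible families of maps `Bₙ ⊙ Δⁿ ⟶ X`: for `θ : [n] → [m]` the two maps from `Bₘ ⊙ Δⁿ` to
`X`, through `Bₙ ⊙ Δⁿ` and through `Bₘ ⊙ Δᵐ`, are equal. -/
structure IoProperad.Cocone (B : SimplicialObject IoProperad.{u}) (X : IoProperad.{u}) where
  ι : ∀ n : ℕ, IoProperad.Family (B.obj (op ⦋n⦌)) (stdSimplex ℝ (Fin (n + 1))) X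
  compat : ∀ {n m : ℕ} (θ : ⦋n⦌ ⟶ ⦋m⦌) (t : stdSimplex ℝ (Fin (n + 1))),
    B.map θ.op ≫ (ι n).hom t = (ι m).hom (stdSimplex.map θ.toOrderHom t)

/-- A geometric realization of a simplicial io-properad `B` in io-properads: the coend
`∫ Bₙ ⊙ Δⁿ`, that is, the coequalizer of
`∐_{[n] → [m]} Bₘ ⊙ Δⁿ ⇉ ∐_{[n]} Bₙ ⊙ Δⁿ` in the category of io-properads, given with its universal
property. It is unique up to unique isomorphism. -/
structure IoProperad.Realization (B : SimplicialObject IoProperad.{u}) where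
  pt : IoProperad.{u}
  cocone : IoProperad.Cocone B pt
  desc : ∀ {Y : IoProperad.{u}}, IoProperad.Cocone B Y → (pt ⟶ Y)
  fac : ∀ {Y : IoProperad.{u}} (c : IoProperad.Cocone B Y) (n : ℕ)
    (t : stdSimplex ℝ (Fin (n + 1))), (cocone.ι n).hom t ≫ desc c = (c.ι n).hom t
  hom_ext : ∀ {Y : IoProperad.{u}} {f g : pt ⟶ Y},
    (∀ (n : ℕ) (t : stdSimplex ℝ (Fin (n + 1))),
      (cocone.ι n).hom t ≫ f = (cocone.ι n).hom t ≫ g) → f = g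

namespace IoProperad

variable {B B' B'' : SimplicialObject IoProperad.{u}}

/-- Restriction of a cocone along a map of simplicial io-properads. -/
noncomputable def Cocone.precomp (φ : B ⟶ B') {X : IoProperad.{u}} (c : Cocone B' X) : Cocone B X where
  ι n :=
    { hom := fun t => φ.app (op ⦋n⦌) ≫ (c.ι n).hom t
      continuous := fun a => ((c.ι n).continuous a).comp
        ((((φ.app (op ⦋n⦌)).f a).hom.continuous.comp continuous_fst).prodMk continuous_snd) }
  compat {n m} θ t := by
    rw [← Category.assoc, φ.naturality, Category.assoc, c.compat]

/-- The map of geometric realizations induced by a map of simplicial io-properads. -/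
noncomputable def Realization.map (φ : B ⟶ B') (r : Realization B) (r' : Realization B') : r.pt ⟶ r'.pt :=
  r.desc (r'.cocone.precomp φ)

theorem Realization.map_comp (φ : B ⟶ B') (ψ : B' ⟶ B'') (r : Realization B)
    (r' : Realization B') (r'' : Realization B'') :
    r.map φ r' ≫ r'.map ψ r'' = r.map (φ ≫ ψ) r'' := by
  refine r.hom_ext fun n t => ?_
  simp only [Realization.map]
  rw [← Category.assoc, r.fac, r.fac]
  change (φ.app _ ≫ (r'.cocone.ι n).hom t) ≫ _ = (φ.app _ ≫ ψ.app _) ≫ _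
  rw [Category.assoc, r'.fac, Category.assoc]
  rfl


/-! #### Existence of geometric realizations and pushouts -/

theorem prod_cg (X : Type u) [TopologicalSpace X] [CompactlyGeneratedSpace X] (Z : Type)
    [TopologicalSpace Z] [CompactSpace Z] [T2Space Z] : CompactlyGeneratedSpace (X × Z) := by
  refine compactlyGeneratedSpace_of_continuous_maps fun {W} _ g hg => ?_
  let q : (Σ i : (S : CompHaus.{u}) × C(S, X), i.1) → X := fun p => p.1.2 p.2
  have hq : Topology.IsQuotientMap q := by
    refine ⟨⟨eq_compactlyGenerated.{u} (X := X)⟩, fun x => ?_⟩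
    exact ⟨⟨⟨CompHaus.of PUnit.{u + 1}, ContinuousMap.const _ x⟩, PUnit.unit⟩, rfl⟩
  refine hq.continuous_lift_prod_left ?_
  have h : Continuous fun p : Σ i : (S : CompHaus.{u}) × C(S, X), (i.1 : Type u) × Z =>
      g (p.1.2 p.2.1, p.2.2) :=
    continuous_sigma fun i => hg (i.1 × Z) (fun p => (i.2 p.1, p.2))
      ((i.2.continuous.comp continuous_fst).prodMk continuous_snd)
  exact h.comp (Homeomorph.sigmaProdDistrib
    (X := fun i : (S : CompHaus.{u}) × C(S, X) => (i.1 : Type u)) (Y := Z)).continuous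

theorem nonempty_realization (B : SimplicialObject IoProperad.{u}) :
    Nonempty (Realization B) := by
  let S : Arity → Type u := fun a =>
    Σ n : ℕ, (B.obj (op ⦋n⦌)).A a × stdSimplex ℝ (Fin (n + 1))
  let C : ∀ Y : IoProperad.{u}, (∀ a, S a → Y.A a) → Prop := fun Y e =>
    ∃ c : Cocone B Y, ∀ a n x t, e a ⟨n, x, t⟩ = (((c.ι n).hom t).f a).hom x
  obtain ⟨c, hc⟩ : C (gen S C) (genIn S C) := by
    refine gen_admissible fun T e hcont hsep => ?_
    have hact : ∀ (n : ℕ) (t : stdSimplex ℝ (Fin (n + 1))) (a : Arity)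
        (z : Lab (fun b => (B.obj (op ⦋n⦌)).A b) a),
        T.act (z.map fun b x => e b ⟨n, x, t⟩) = e a ⟨n, (B.obj (op ⦋n⦌)).act z, t⟩ := by
      intro n t a z
      refine hsep a _ _ ?_
      rintro Y h ⟨c, hc⟩
      beta_reduce at hc
      rw [hom_act, hc, hom_act]
      exact congrArg Y.act (congrArg (Sigma.mk z.1) (funext fun v => hc _ _ _ _))
    have hcompat : ∀ (n m : ℕ) (θ : ⦋n⦌ ⟶ ⦋m⦌) (t : stdSimplex ℝ (Fin (n + 1))) (a : Arity)
        (x : (B.obj (op ⦋m⦌)).A a), e a ⟨n, ((B.map θ.op).f a).hom x, t⟩ =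
          e a ⟨m, x, stdSimplex.map θ.toOrderHom t⟩ := by
      intro n m θ t a x
      refine hsep a _ _ ?_
      rintro Y h ⟨c, hc⟩
      beta_reduce at hc
      rw [hc, hc]
      exact congrArg (fun f : B.obj (op ⦋m⦌) ⟶ Y => (f.f a).hom x) (c.compat θ t)
    have hjoint : ∀ (n : ℕ) (a : Arity), Continuous
        fun p : (B.obj (op ⦋n⦌)).A a × stdSimplex ℝ (Fin (n + 1)) => e a ⟨n, p⟩ := by
      intro n a
      have := prod_cg ((B.obj (op ⦋n⦌)).A a) (stdSimplex ℝ (Fin (n + 1)))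
      refine hcont a _ _ ?_
      rintro Y h ⟨c, hc⟩
      beta_reduce at hc
      exact ((c.ι n).continuous a).congr fun p => (hc a n p.1 p.2).symm
    refine ⟨⟨fun n => ⟨fun t => ⟨fun a => ⟨⟨fun x => e a ⟨n, x, t⟩, ?_⟩⟩, ?_⟩, hjoint n⟩, ?_⟩,
      fun _ _ _ _ => rfl⟩
    · exact (hjoint n a).comp (continuous_id.prodMk continuous_const)
    · exact funext fun a => CGHaus.hom_ext fun z => hact n t a z
    · exact fun θ t => hom_ext' fun a x => hcompat _ _ θ t a x
  have hC : ∀ {Y : IoProperad.{u}} (c' : Cocone B Y),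
      C Y fun a s => (((c'.ι s.1).hom s.2.2).f a).hom s.2.1 :=
    fun c' => ⟨c', fun _ _ _ _ => rfl⟩
  refine ⟨⟨gen S C, c, fun {Y} c' => genDesc
    (e := fun a s => (((c'.ι s.1).hom s.2.2).f a).hom s.2.1) (hC c'), ?_, ?_⟩⟩
  · intro Y c' n t
    refine hom_ext' fun a x => ?_
    refine (congrArg _ (hc a n x t).symm).trans (genDesc_in (hC c') _)
  · intro Y f g h
    refine gen_hom_ext fun a s => ?_
    obtain ⟨n, x, t⟩ := s
    rw [hc]
    exact congrArg (fun f : B.obj (op ⦋n⦌) ⟶ Y => (f.f a).hom x) (h n t)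

instance : Limits.HasPushouts IoProperad.{u} := by
  suffices h : ∀ {R P Q : IoProperad.{u}} {i : R ⟶ P} {j : R ⟶ Q},
      Limits.HasColimit (Limits.span i j) from Limits.hasPushouts_of_hasColimit_span _
  intro R P Q i j
  let S : Arity → Type u := fun a => P.A a ⊕ Q.A a
  let C : ∀ Y : IoProperad.{u}, (∀ a, S a → Y.A a) → Prop := fun Y e =>
    ∃ (f : P ⟶ Y) (g : Q ⟶ Y), i ≫ f = j ≫ g ∧ (∀ a x, e a (.inl x) = (f.f a).hom x) ∧
      ∀ a x, e a (.inr x) = (g.f a).hom x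
  obtain ⟨f, g, hfg, hf, hg⟩ : C (gen S C) (genIn S C) := by
    refine gen_admissible fun T e hcont hsep => ?_
    refine ⟨⟨fun a => ⟨⟨fun x => e a (.inl x), ?_⟩⟩, ?_⟩, ⟨fun a => ⟨⟨fun x => e a (.inr x), ?_⟩⟩, ?_⟩,
      ?_, fun _ _ => rfl, fun _ _ => rfl⟩
    · refine hcont a _ _ ?_
      rintro Y h ⟨f, g, hfg, hf, hg⟩
      beta_reduce at hf hg
      exact (f.f a).hom.continuous.congr fun x => (hf a x).symm
    · refine funext fun a => CGHaus.hom_ext fun z => hsep a _ _ ?_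
      rintro Y h ⟨f, g, hfg, hf, hg⟩
      beta_reduce at hf hg
      refine (hom_act h _).trans (.trans ?_ (hf a (P.act z)).symm)
      refine .trans ?_ (hom_act f _).symm
      exact congrArg Y.act (congrArg (Sigma.mk z.1) (funext fun v => hf _ _))
    · refine hcont a _ _ ?_
      rintro Y h ⟨f, g, hfg, hf, hg⟩
      beta_reduce at hf hg
      exact (g.f a).hom.continuous.congr fun x => (hg a x).symm
    · refine funext fun a => CGHaus.hom_ext fun z => hsep a _ _ ?_
      rintro Y h ⟨f, g, hfg, hf, hg⟩
      beta_reduce at hf hg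
      refine (hom_act h _).trans (.trans ?_ (hg a (Q.act z)).symm)
      refine .trans ?_ (hom_act g _).symm
      exact congrArg Y.act (congrArg (Sigma.mk z.1) (funext fun v => hg _ _))
    · refine hom_ext' fun a x => hsep a _ _ ?_
      rintro Y h ⟨f, g, hfg, hf, hg⟩
      beta_reduce at hf hg
      change (h.f a).hom (e a (.inl ((i.f a).hom x))) = (h.f a).hom (e a (.inr ((j.f a).hom x)))
      rw [hf, hg]
      exact congrArg (fun f : R ⟶ Y => (f.f a).hom x) hfg
  have hC : ∀ s : Limits.PushoutCocone i j,
      C s.pt fun a => Sum.elim (s.inl.f a).hom (s.inr.f a).hom :=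
    fun s => ⟨s.inl, s.inr, s.condition, fun _ _ => rfl, fun _ _ => rfl⟩
  refine ⟨⟨⟨Limits.PushoutCocone.mk f g hfg, Limits.PushoutCocone.IsColimit.mk hfg
    (fun s => genDesc (hC s)) ?_ ?_ ?_⟩⟩⟩
  · intro s
    refine hom_ext' fun a x => ?_
    exact (congrArg _ (hf a x).symm).trans (genDesc_in (hC s) _)
  · intro s
    refine hom_ext' fun a x => ?_
    exact (congrArg _ (hg a x).symm).trans (genDesc_in (hC s) _)
  · intro s m h1 h2
    refine gen_hom_ext fun a x => ?_
    rw [genDesc_in]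
    rcases x with x | x
    · rw [hf]
      exact congrArg (fun f : P ⟶ s.pt => (f.f a).hom x) h1
    · rw [hg]
      exact congrArg (fun f : Q ⟶ s.pt => (f.f a).hom x) h2

/-- The geometric realization of simplicial io-properads. -/
noncomputable def realization : SimplicialObject IoProperad.{u} ⥤ IoProperad.{u} where
  obj B := (nonempty_realization B).some.pt
  map φ := Realization.map φ _ _
  map_id B := by
    refine (nonempty_realization B).some.hom_ext fun n t => ?_
    rw [Realization.map, Realization.fac, Category.comp_id]
    exact Category.id_comp _
  map_comp φ ψ := (Realization.map_comp φ ψ _ _ _).symm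

/-- The bar resolution `P ↦ |B_•(𝔾, 𝔾, P)|`. -/
noncomputable def barResolution : IoProperad.{u} ⥤ IoProperad.{u} := bar ⋙ realization

end IoProperad

open CategoryTheory
open Simplicial Opposite
open Topology
local notation "I" => unitInterval

/-! ### Neighbourhood deformation retracts and the homotopy extension property -/

section Spaces

variable {X Y Z A B S T W : Type*} [TopologicalSpace X] [TopologicalSpace Y] [TopologicalSpace Z]
  [TopologicalSpace A] [TopologicalSpace B] [TopologicalSpace S] [TopologicalSpace T]
  [TopologicalSpace W]

theorem IsProperMap.sumElim {f : X → Z} {g : Y → Z} (hf : IsProperMap f) (hg : IsProperMap g) :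
    IsProperMap (Sum.elim f g) := by
  rw [isProperMap_iff_isClosedMap_and_compact_fibers] at *
  refine ⟨hf.1.sumElim hg.1, hf.2.1.sumElim hg.2.1, fun z => ?_⟩
  have : Sum.elim f g ⁻¹' {z} = Sum.inl '' (f ⁻¹' {z}) ∪ Sum.inr '' (g ⁻¹' {z}) := by
    ext (x | y) <;> simp
  rw [this]
  exact ((hf.2.2 z).image continuous_inl).union ((hg.2.2 z).image continuous_inr)

theorem isProperMap_of_isEmpty [IsEmpty X] (f : X → Y) : IsProperMap f :=
  (Topology.IsClosedEmbedding.of_continuous_injective_isClosedMap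
    (continuous_of_const fun x => isEmptyElim x) (fun x => isEmptyElim x) fun s _ => by
      rw [Set.eq_empty_of_isEmpty s, Set.image_empty]; exact isClosed_empty).isProperMap

/-- A continuous map descends along a surjective proper map. -/
theorem exists_descend {e : A → W} (he : IsProperMap e) (hs : Function.Surjective e) (f : C(A, Z))
    (hf : ∀ a a', e a = e a' → f a = f a') : ∃ F : C(W, Z), ∀ a, F (e a) = f a := by
  have hq : IsQuotientMap e := he.isClosedMap.isQuotientMap he.continuous hs
  refine ⟨hq.lift (f := (⟨e, he.continuous⟩ : C(A, W))) f hf, fun a => ?_⟩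
  exact congrArg (fun g : C(A, Z) => g a)
    (Topology.IsQuotientMap.lift_comp (f := (⟨e, he.continuous⟩ : C(A, W))) hq f hf)

/-- Gluing of two continuous maps along closed subsets. -/
theorem exists_glue {s t : Set W} (hs : IsClosed s) (ht : IsClosed t) (hst : ∀ w, w ∈ s ∨ w ∈ t)
    (f : C(s, Z)) (g : C(t, Z)) (h : ∀ w (h₁ : w ∈ s) (h₂ : w ∈ t), f ⟨w, h₁⟩ = g ⟨w, h₂⟩) :
    ∃ F : C(W, Z), (∀ w (h : w ∈ s), F w = f ⟨w, h⟩) ∧ ∀ w (h : w ∈ t), F w = g ⟨w, h⟩ := by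
  obtain ⟨F, hF⟩ := exists_descend (e := Sum.elim (Subtype.val : s → W) (Subtype.val : t → W))
    (hs.isProperMap_subtypeVal.sumElim ht.isProperMap_subtypeVal)
    (fun w => (hst w).elim (fun h => ⟨.inl ⟨w, h⟩, rfl⟩) fun h => ⟨.inr ⟨w, h⟩, rfl⟩)
    ⟨Sum.elim f g, f.continuous.sumElim g.continuous⟩ (by
      rintro (⟨a, ha⟩ | ⟨a, ha⟩) (⟨b, hb⟩ | ⟨b, hb⟩) hab <;> obtain rfl : a = b := hab
      · rfl
      · exact h _ _ _
      · exact (h _ _ _).symm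
      · rfl)
  exact ⟨F, fun w h => hF (.inl ⟨w, h⟩), fun w h => hF (.inr ⟨w, h⟩)⟩

/-- `A` is a neighbourhood deformation retract: the point `x` is moved into `A` at the time `u x`
if `u x ≤ 1`. -/
def IsNDR (A : Set X) : Prop :=
  ∃ (u : C(X, ℝ)) (h : C(X × ℝ, X)), (∀ x, 0 ≤ u x) ∧ (∀ a ∈ A, u a = 0) ∧ (∀ x, h (x, 0) = x) ∧
    ∀ x, u x ≤ 1 → h (x, u x) ∈ A

theorem IsNDR.empty : IsNDR (∅ : Set X) :=
  ⟨⟨fun _ => 2, continuous_const⟩, ⟨Prod.fst, continuous_fst⟩, fun _ => zero_le_two,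
    fun _ h => h.elim, fun _ => rfl, fun _ (h : (2 : ℝ) ≤ 1) => absurd h (by norm_num)⟩

theorem IsNDR.prod_union {A : Set X} {B : Set Y} (hA : IsNDR A) (hB : IsNDR B) :
    IsNDR ({p | p.1 ∈ A ∨ p.2 ∈ B} : Set (X × Y)) := by
  obtain ⟨u, h, hu, hA, h0, h1⟩ := hA
  obtain ⟨v, k, hv, hB, k0, k1⟩ := hB
  refine ⟨⟨fun p => min (u p.1) (v p.2), by fun_prop⟩,
    ⟨fun p => (h (p.1.1, p.2), k (p.1.2, p.2)), by fun_prop⟩, fun p => le_min (hu _) (hv _), ?_,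
    fun p => Prod.ext (h0 _) (k0 _), ?_⟩
  · rintro p (hp | hp)
    · exact (min_eq_left ((hA _ hp).trans_le (hv _))).trans (hA _ hp)
    · exact (min_eq_right ((hB _ hp).trans_le (hu _))).trans (hB _ hp)
  · intro p hp
    simp only [ContinuousMap.coe_mk] at hp ⊢
    rcases le_total (u p.1) (v p.2) with hl | hl
    · rw [min_eq_left hl] at hp ⊢
      exact .inl (h1 _ hp)
    · rw [min_eq_right hl] at hp ⊢
      exact .inr (k1 _ hp)

theorem IsNDR.interval_ends : IsNDR ({0, 1} : Set I) := by
  refine ⟨⟨fun t => 4 * min (t : ℝ) (1 - t), by fun_prop⟩,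
    ⟨fun p => Set.projIcc 0 1 zero_le_one
      ((p.1 : ℝ) + p.2 * max (-(1 / 4)) (min (1 / 4) ((p.1 : ℝ) - 1 / 2))),
      continuous_projIcc.comp (by fun_prop)⟩, ?_, ?_, ?_, ?_⟩
  · intro t
    have := le_min t.2.1 (sub_nonneg.2 t.2.2)
    exact mul_nonneg (by norm_num) this
  · rintro t (rfl | rfl) <;> norm_num
  · intro t
    simp
  · intro t ht
    simp only [ContinuousMap.coe_mk] at ht ⊢
    have h0 := t.2.1
    have h1 := t.2.2
    rcases le_total (t : ℝ) (1 - t) with hl | hl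
    · rw [min_eq_left hl] at ht ⊢
      refine .inl ?_
      rw [min_eq_right (by linarith), max_eq_left (by linarith)]
      have : (t : ℝ) + 4 * t * -(1 / 4) = 0 := by ring
      rw [this]
      exact Set.projIcc_left _
    · rw [min_eq_right hl] at ht ⊢
      refine .inr ?_
      rw [min_eq_left (by linarith), max_eq_right (by linarith)]
      have : (t : ℝ) + 4 * (1 - t) * (1 / 4) = 1 := by ring
      rw [this]
      exact Set.projIcc_right _

/-- The homotopy extension property of neighbourhood deformation retracts. -/
theorem IsNDR.hep {e : C(A, X)} (he : IsProperMap e) (hN : IsNDR (Set.range e)) (g : C(X, Z))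
    (H : C(A × I, Z)) (hc : ∀ a a' t, e a = e a' → H (a, t) = H (a', t))
    (h0 : ∀ a, H (a, 0) = g (e a)) :
    ∃ H' : C(X × I, Z), (∀ x, H' (x, 0) = g x) ∧ ∀ a t, H' (e a, t) = H (a, t) := by
  obtain ⟨u, h, hu, hA, k0, k1⟩ := hN
  have hp : IsProperMap (Set.rangeFactorization e) :=
    isProperMap_of_comp_of_inj (g := (Subtype.val : Set.range e → X)) (by fun_prop)
      continuous_subtype_val he Subtype.val_injective
  obtain ⟨K, hK⟩ := exists_descend (hp.prodMap (isProperMap_id (X := I)))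
    (Set.rangeFactorization_surjective.prodMap Function.surjective_id) H (by
      rintro ⟨a, t⟩ ⟨a', t'⟩ h
      obtain ⟨h₁, rfl⟩ := Prod.mk.inj h
      have h' := congrArg Subtype.val h₁
      exact hc a a' t h')
  obtain ⟨F, hF1, hF2⟩ := exists_glue (W := X × I) (Z := Z)
    (s := {p | (p.2 : ℝ) ≤ u p.1}) (t := {p | u p.1 ≤ p.2})
    (isClosed_le (by fun_prop) (by fun_prop)) (isClosed_le (by fun_prop) (by fun_prop))
    (fun p => le_total (p.2 : ℝ) (u p.1))
    ⟨fun p => g (h (p.1.1, p.1.2)), by fun_prop⟩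
    ⟨fun p => K (⟨h (p.1.1, u p.1.1), k1 _ (p.2.trans p.1.2.2.2)⟩,
      ⟨p.1.2 - u p.1.1, Set.mem_Icc.2 ⟨sub_nonneg.2 p.2, (sub_le_self _ (hu _)).trans p.1.2.2.2⟩⟩), by fun_prop⟩ (by
      rintro ⟨x, t⟩ h₁ h₂
      have ht : u x = t := le_antisymm h₂ h₁
      obtain ⟨a, ha⟩ := k1 x (h₂.trans t.2.2)
      have := hK (a, 0)
      have h2 : g (h (x, t)) = K (Set.rangeFactorization e a, 0) :=
        (congrArg (fun s => g (h (x, s))) ht.symm).trans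
          ((congrArg g ha).symm.trans ((h0 a).symm.trans this.symm))
      refine h2.trans (congrArg K (Prod.ext (Subtype.ext ha) (Subtype.ext ?_)))
      change (0 : ℝ) = t - u x
      rw [ht, sub_self])
  refine ⟨F, fun x => ?_, fun a t => ?_⟩
  · rw [hF1 (x, 0) (hu x)]
    exact congrArg g (k0 x)
  · have ha : u (e a) = 0 := hA _ ⟨a, rfl⟩
    have := hK (a, t)
    rw [hF2 (e a, t) (ha.trans_le t.2.1), ← this]
    refine congrArg K (Prod.ext (Subtype.ext ?_) (Subtype.ext ?_))
    · change h (e a, u (e a)) = e a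
      rw [ha, k0]
    · change (t : ℝ) - u (e a) = t
      rw [ha, sub_zero]

/-- Filling of squares: `b`, `l`, `r` are three sides of a square of maps out of `X`, the whole
square being prescribed on `A`. -/
theorem IsNDR.fill {e : C(A, X)} (he : IsProperMap e) (hinj : Function.Injective e)
    (hN : IsNDR (Set.range e)) (b l r : C(X × I, Z)) (q : C((A × I) × I, Z))
    (hl : ∀ x, l (x, 0) = b (x, 0)) (hr : ∀ x, r (x, 0) = b (x, 1))
    (qb : ∀ a t, q ((a, t), 0) = b (e a, t)) (ql : ∀ a s, q ((a, 0), s) = l (e a, s))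
    (qr : ∀ a s, q ((a, 1), s) = r (e a, s)) :
    ∃ Q : C((X × I) × I, Z), (∀ x t, Q ((x, t), 0) = b (x, t)) ∧ (∀ x s, Q ((x, 0), s) = l (x, s)) ∧
      (∀ x s, Q ((x, 1), s) = r (x, s)) ∧ ∀ a t s, Q ((e a, t), s) = q ((a, t), s) := by
  let j0 : C(X, X × I) := ⟨fun x => (x, 0), by fun_prop⟩
  let j1 : C(X, X × I) := ⟨fun x => (x, 1), by fun_prop⟩
  let E : C(X ⊕ X ⊕ (A × I), X × I) := ⟨Sum.elim j0 (Sum.elim j1 (Prod.map e id)), by fun_prop⟩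
  have hcl : ∀ t : I, IsProperMap fun x : X => (x, t) := fun t =>
    (Topology.IsClosedEmbedding.of_continuous_injective_isClosedMap (by fun_prop)
      (fun x y h => (Prod.mk.inj h).1) (fun s hs => by
        have : (fun x : X => (x, t)) '' s = s ×ˢ {t} := by ext ⟨x, t'⟩; simp [eq_comm]
        rw [this]
        exact hs.prod isClosed_singleton)).isProperMap
  have hE : IsProperMap E := (hcl 0).sumElim ((hcl 1).sumElim (he.prodMap isProperMap_id))
  have hNE : IsNDR (Set.range E) := by
    convert hN.prod_union IsNDR.interval_ends using 1
    ext ⟨x, t⟩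
    constructor
    · rintro ⟨x | x | x, h⟩
      · exact .inr (.inl (Prod.mk.inj h).2.symm)
      · exact .inr (.inr (Prod.mk.inj h).2.symm)
      · exact .inl ⟨x.1, (Prod.mk.inj h).1⟩
    · rintro (⟨a, rfl⟩ | rfl | rfl)
      · exact ⟨.inr (.inr (a, t)), rfl⟩
      · exact ⟨.inl x, rfl⟩
      · exact ⟨.inr (.inl x), rfl⟩
  let H : C((X ⊕ X ⊕ (A × I)) × I, Z) :=
    ⟨fun p => Sum.elim (fun p => l p) (Sum.elim (fun p => r p) q)
      ((Sum.map id (Homeomorph.sumProdDistrib (X := X) (Y := A × I) (Z := I)))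
        (Homeomorph.sumProdDistrib p)),
      (l.continuous.sumElim (r.continuous.sumElim q.continuous)).comp
        ((continuous_id.sumMap (Homeomorph.continuous _)).comp (Homeomorph.continuous _))⟩
  obtain ⟨Q, hQ0, hQ⟩ := IsNDR.hep hE hNE b H (by
    have h01 : (0 : I) ≠ 1 := zero_ne_one
    rintro (x | x | ⟨x, t⟩) (y | y | ⟨y, t'⟩) s h <;> obtain ⟨h, h'⟩ := Prod.mk.inj h
    · obtain rfl : x = y := h; rfl
    · exact (h01 h').elim
    · obtain rfl : x = e y := h
      obtain rfl : 0 = t' := h'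
      exact (ql _ _).symm
    · exact (h01 h'.symm).elim
    · obtain rfl : x = y := h; rfl
    · obtain rfl : x = e y := h
      obtain rfl : 1 = t' := h'
      exact (qr _ _).symm
    · obtain rfl : e x = y := h
      obtain rfl : t = 0 := h'
      exact (ql _ _)
    · obtain rfl : e x = y := h
      obtain rfl : t = 1 := h'
      exact (qr _ _)
    · obtain rfl := hinj h
      obtain rfl : t = t' := h'
      rfl) (by
    rintro (x | x | ⟨x, t⟩)
    · exact hl x
    · exact hr x
    · exact qb x t)
  exact ⟨Q, fun x t => hQ0 (x, t), fun x s => hQ (.inl x) s, fun x s => hQ (.inr (.inl x)) s,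
    fun a t s => hQ (.inr (.inr (a, t))) s⟩

/-- The map `f` has a homotopy inverse. -/
def IsHomotopyEquiv (f : C(X, Y)) : Prop :=
  ∃ (g : C(Y, X)) (G : C(X × I, X)) (G' : C(Y × I, Y)), (∀ x, G (x, 0) = x) ∧
    (∀ x, G (x, 1) = g (f x)) ∧ (∀ y, G' (y, 0) = y) ∧ ∀ y, G' (y, 1) = f (g y)

/-- The homotopy extension property with parameters in `T`, relative to a subset `S`. -/
theorem IsNDR.hep_param {S : Set T} (hS : IsClosed S) (hN : IsNDR S) (g : C(X × T, Z))
    (H : C((X × S) × I, Z)) (h0 : ∀ x s, H ((x, s), 0) = g (x, s)) :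
    ∃ H' : C((X × T) × I, Z), (∀ p, H' (p, 0) = g p) ∧
      ∀ x (s : S) t, H' ((x, (s : T)), t) = H ((x, s), t) := by
  let e : C(X × S, X × T) := ⟨Prod.map id Subtype.val, by fun_prop⟩
  have he : IsProperMap e := isProperMap_id.prodMap hS.isProperMap_subtypeVal
  have hNe : IsNDR (Set.range e) := by
    convert (IsNDR.empty (X := X)).prod_union hN using 1
    ext ⟨x, t⟩
    constructor
    · rintro ⟨⟨y, s⟩, h⟩
      obtain ⟨rfl, rfl⟩ := Prod.mk.inj h
      exact .inr s.2
    · rintro (h | h)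
      · exact h.elim
      · exact ⟨(x, ⟨t, h⟩), rfl⟩
  obtain ⟨H', h1, h2⟩ := IsNDR.hep he hNe g H (by
    rintro ⟨a, s⟩ ⟨a', s'⟩ t h
    obtain ⟨rfl, h₁⟩ := Prod.mk.inj h
    obtain rfl := Subtype.ext h₁
    rfl) fun p => h0 _ _
  exact ⟨H', h1, fun x s t => h2 (x, s) t⟩

/-- Precomposition with a homotopy equivalence `f`: a family `u` of maps out of `X`, deformed over
`S ⊆ T` into a family of maps factoring through `f`, can be so deformed over `T`. -/
theorem IsHomotopyEquiv.extend {f : C(X, Y)} (hf : IsHomotopyEquiv f) {S : Set T} (hS : IsClosed S)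
    (hN : IsNDR S) (u : C(X × T, Z)) (w' : C(Y × S, Z)) (w : C((X × I) × S, Z))
    (h0 : ∀ x s, w ((x, 0), s) = u (x, s)) (h1 : ∀ x s, w ((x, 1), s) = w' (f x, s)) :
    ∃ (u' : C(Y × T, Z)) (H : C((X × I) × T, Z)), (∀ y (s : S), u' (y, s) = w' (y, s)) ∧
      (∀ p (s : S), H (p, s) = w (p, s)) ∧ (∀ x t, H ((x, 0), t) = u (x, t)) ∧
      ∀ x t, H ((x, 1), t) = u' (f x, t) := by
  obtain ⟨g, G, G', hG0, hG1, hG'0, hG'1⟩ := hf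
  let e : C(X × S, X × T) := ⟨Prod.map id Subtype.val, by fun_prop⟩
  have he : IsProperMap e := isProperMap_id.prodMap hS.isProperMap_subtypeVal
  have hinj : Function.Injective e := Function.injective_id.prodMap Subtype.val_injective
  have hNe : IsNDR (Set.range e) := by
    convert (IsNDR.empty (X := X)).prod_union hN using 1
    ext ⟨x, t⟩
    constructor
    · rintro ⟨⟨y, s⟩, h⟩
      obtain ⟨rfl, rfl⟩ := Prod.mk.inj h
      exact .inr s.2
    · rintro (h | h)
      · exact h.elim
      · exact ⟨(x, ⟨t, h⟩), rfl⟩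
  let eE : C(Empty, X × S) := ⟨Empty.elim, continuous_of_const fun x => x.elim⟩
  obtain ⟨Q, Qb, Ql, Qr, -⟩ := IsNDR.fill (X := X × S) (e := eE) (Z := Z)
    (isProperMap_of_isEmpty _) (fun x => x.elim)
    (by rw [Set.range_eq_empty]; exact IsNDR.empty)
    ⟨fun p => w' (G' (f p.1.1, p.2), p.1.2), by fun_prop⟩
    ⟨fun p => w ((p.1.1, unitInterval.symm p.2), p.1.2), by fun_prop⟩
    ⟨fun p => w' (f (G (p.1.1, unitInterval.symm p.2)), p.1.2), by fun_prop⟩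
    ⟨fun p => p.1.1.elim, continuous_of_const fun x => x.1.1.elim⟩
    (by
      rintro ⟨x, s⟩
      simp [h1, hG'0])
    (by
      rintro ⟨x, s⟩
      simp [hG1, hG'1])
    (fun x => x.elim) (fun x => x.elim) (fun x => x.elim)
  simp only [ContinuousMap.coe_mk, Prod.forall] at Qb Ql Qr
  obtain ⟨V, hV0, hVS⟩ := IsNDR.hep_param hS hN u
    ⟨fun p => Q ((p.1, p.2), 1), by fun_prop⟩ (by
      intro x s
      simp [Ql, h0])
  obtain ⟨U, hU0, hUS⟩ := IsNDR.hep_param hS hN (X := Y)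
    ⟨fun p => V ((g p.1, p.2), 1), by fun_prop⟩
    ⟨fun p => w' (G' (p.1.1, unitInterval.symm p.2), p.1.2), by fun_prop⟩ (by
      intro y s
      simp [hVS, Qr, hG0, hG'1])
  simp only [ContinuousMap.coe_mk, Prod.forall] at hVS hUS hU0 hV0
  obtain ⟨R, -, Rl, Rr, Rq⟩ := IsNDR.fill (X := X × T) (e := e) he hinj hNe (Z := Z)
    ⟨fun p => V ((G (p.1.1, p.2), p.1.2), 1), by fun_prop⟩
    ⟨fun p => V (p.1, unitInterval.symm p.2), by fun_prop⟩
    ⟨fun p => U ((f p.1.1, p.1.2), p.2), by fun_prop⟩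
    ⟨fun p => Q ((p.1.1, unitInterval.symm p.2), unitInterval.symm p.1.2), by fun_prop⟩
    (by
      rintro ⟨x, t⟩
      simp [hG0])
    (by
      rintro ⟨x, t⟩
      simp [hG1, hU0])
    (by
      rintro ⟨x, s⟩ t
      simp [e, hVS, Qr, hG0])
    (by
      rintro ⟨x, s⟩ t
      simp [e, hVS])
    (by
      rintro ⟨x, s⟩ t
      simp [e, hUS, Qb])
  simp only [ContinuousMap.coe_mk, Prod.forall] at Rl Rr Rq
  refine ⟨⟨fun p => U (p, 1), by fun_prop⟩, ⟨fun p => R (((p.1.1, p.2), p.1.2), 1), by fun_prop⟩,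
    ?_, ?_, ?_, ?_⟩
  · intro y s
    simp [hUS, hG'0]
  · rintro ⟨x, t⟩ s
    have := Rq x s t 1
    simpa [e, Ql] using this
  · intro x t
    simp [Rl, hV0]
  · intro x t
    simp [Rr]

end Spaces

section Spaces

variable {X Y Z A B S T W : Type*} [TopologicalSpace X] [TopologicalSpace Y] [TopologicalSpace Z]
  [TopologicalSpace A] [TopologicalSpace B] [TopologicalSpace S] [TopologicalSpace T]
  [TopologicalSpace W]

/-- `IsHomotopyEquiv.extend` for families given on the image of a proper map. -/
theorem IsHomotopyEquiv.extend_proper {f : C(X, Y)} (hf : IsHomotopyEquiv f) {e : C(S, T)}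
    (he : IsProperMap e) (hN : IsNDR (Set.range e)) (u : C(X × T, Z)) (w' : C(Y × S, Z))
    (w : C((X × I) × S, Z)) (hw' : ∀ y s s', e s = e s' → w' (y, s) = w' (y, s'))
    (hw : ∀ p s s', e s = e s' → w (p, s) = w (p, s'))
    (h0 : ∀ x s, w ((x, 0), s) = u (x, e s)) (h1 : ∀ x s, w ((x, 1), s) = w' (f x, s)) :
    ∃ (u' : C(Y × T, Z)) (H : C((X × I) × T, Z)), (∀ y s, u' (y, e s) = w' (y, s)) ∧
      (∀ p s, H (p, e s) = w (p, s)) ∧ (∀ x t, H ((x, 0), t) = u (x, t)) ∧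
      ∀ x t, H ((x, 1), t) = u' (f x, t) := by
  have hp : IsProperMap (Set.rangeFactorization e) :=
    isProperMap_of_comp_of_inj (g := (Subtype.val : Set.range e → T)) (by fun_prop)
      continuous_subtype_val he Subtype.val_injective
  obtain ⟨v', hv'⟩ := exists_descend ((isProperMap_id (X := Y)).prodMap hp)
    (Function.surjective_id.prodMap Set.rangeFactorization_surjective) w' (by
      rintro ⟨y, s⟩ ⟨y', s'⟩ h
      obtain ⟨rfl, h₁⟩ := Prod.mk.inj h
      have h' := congrArg Subtype.val h₁
      exact hw' _ _ _ h')
  obtain ⟨v, hv⟩ := exists_descend ((isProperMap_id (X := X × I)).prodMap hp)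
    (Function.surjective_id.prodMap Set.rangeFactorization_surjective) w (by
      rintro ⟨y, s⟩ ⟨y', s'⟩ h
      obtain ⟨rfl, h₁⟩ := Prod.mk.inj h
      have h' := congrArg Subtype.val h₁
      exact hw _ _ _ h')
  obtain ⟨u', H, h1, h2, h3, h4⟩ := hf.extend he.isClosed_range hN u v' v
    (by
      rintro x ⟨_, s, rfl⟩
      exact (hv ((x, 0), s)).trans (h0 _ _))
    (by
      rintro x ⟨_, s, rfl⟩
      exact (hv ((x, 1), s)).trans ((h1 _ _).trans (hv' (f x, s)).symm))
  exact ⟨u', H, fun y s => (h1 y ⟨_, s, rfl⟩).trans (hv' (y, s)),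
    fun p s => (h2 p ⟨_, s, rfl⟩).trans (hv (p, s)), h3, h4⟩

/-- Continuous maps out of `A × (S ⊕ T)`. -/
def prodSumElim (f : C(A × S, Z)) (g : C(A × T, Z)) : C(A × (S ⊕ T), Z) :=
  ⟨fun p => Sum.elim f g (Homeomorph.prodSumDistrib p),
    (f.continuous.sumElim g.continuous).comp (Homeomorph.continuous _)⟩

/-- Continuous maps out of `(S ⊕ T) × A`. -/
def sumProdElim (f : C(S × A, Z)) (g : C(T × A, Z)) : C((S ⊕ T) × A, Z) :=
  ⟨fun p => Sum.elim f g (Homeomorph.sumProdDistrib p),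
    (f.continuous.sumElim g.continuous).comp (Homeomorph.continuous _)⟩

theorem isProperMap_prodMk_right (t : T) (ht : IsClosed {t}) :
    IsProperMap fun x : X => (x, t) :=
  (Topology.IsClosedEmbedding.of_continuous_injective_isClosedMap (by fun_prop)
    (fun x y h => (Prod.mk.inj h).1) (fun s hs => by
      have : (fun x : X => (x, t)) '' s = s ×ˢ {t} := by ext ⟨x, t'⟩; simp [eq_comm]
      rw [this]
      exact hs.prod ht)).isProperMap

theorem prodSumElim_compat {S : Set T} (f0 f1 : C(A × T, Z))
    (hff : ∀ v (t : S), f0 (v, t) = f1 (v, t)) {E : T ⊕ T ⊕ (S × I) → T × I}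
    (hE : E = Sum.elim (fun t => (t, 0)) (Sum.elim (fun t => (t, 1)) (Prod.map Subtype.val id)))
    (v : A) (p q : T ⊕ T ⊕ (S × I)) (h : E p = E q) :
    prodSumElim f0 (prodSumElim f1 ⟨fun p : A × (S × I) => f1 (p.1, p.2.1), by fun_prop⟩) (v, p) =
      prodSumElim f0 (prodSumElim f1 ⟨fun p : A × (S × I) => f1 (p.1, p.2.1), by fun_prop⟩) (v, q) := by
  subst hE
  have key : ∀ p, prodSumElim f0 (prodSumElim f1 ⟨fun p : A × (S × I) => f1 (p.1, p.2.1), by fun_prop⟩)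
      (v, p) = if (Sum.elim (fun t => (t, 0)) (Sum.elim (fun t => (t, 1))
        (Prod.map Subtype.val id)) p : T × I).2 = 0 then f0 (v, (Sum.elim (fun t => (t, 0))
        (Sum.elim (fun t => (t, 1)) (Prod.map Subtype.val id)) p : T × I).1)
      else f1 (v, (Sum.elim (fun t => (t, 0)) (Sum.elim (fun t => (t, 1))
        (Prod.map Subtype.val id)) p : T × I).1) := by
    rintro (t | t | ⟨t, r⟩)
    · exact (if_pos rfl).symm
    · exact (if_neg (zero_ne_one (α := I)).symm).symm
    · change f1 (v, t) = if r = 0 then f0 (v, t) else f1 (v, t)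
      split_ifs
      · exact (hff v t).symm
      · rfl
  rw [key, key, h]

/-- Two pairs `i : A ⟶ X` and `i' : B ⟶ Y` of spaces with the homotopy extension property and
homotopy equivalences `k : A ⟶ B` and `f : X ⟶ Y` between them: a family `u` of maps out of `X`,
deformed over `S ⊆ T` into a family of maps factoring through `f`, and on `A` into a family of maps
factoring through `k`, can be so deformed over all of `T` and `X`. -/
theorem IsHomotopyEquiv.extend_rel {f : C(X, Y)} {k : C(A, B)} (hf : IsHomotopyEquiv f)
    (hk : IsHomotopyEquiv k) {i : C(A, X)} {i' : C(B, Y)} (hi : IsClosedEmbedding i)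
    (hi' : IsClosedEmbedding i') (hiN : IsNDR (Set.range i)) (hiN' : IsNDR (Set.range i'))
    (hcomm : ∀ a, f (i a) = i' (k a)) {S : Set T} (hS : IsClosed S) (hN : IsNDR S)
    (u : C(X × T, Z)) (a' : C(B × T, Z)) (a : C((A × I) × T, Z)) (s' : C(Y × S, Z))
    (s : C((X × I) × S, Z)) (ha0 : ∀ x t, a ((x, 0), t) = u (i x, t))
    (ha1 : ∀ x t, a ((x, 1), t) = a' (k x, t)) (hs0 : ∀ x t, s ((x, 0), t) = u (x, t))
    (hs1 : ∀ x t, s ((x, 1), t) = s' (f x, t)) (has' : ∀ b (t : S), s' (i' b, t) = a' (b, t))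
    (has : ∀ x r (t : S), s ((i x, r), t) = a ((x, r), t)) :
    ∃ (u' : C(Y × T, Z)) (H : C((X × I) × T, Z)), (∀ y (t : S), u' (y, t) = s' (y, t)) ∧
      (∀ p (t : S), H (p, t) = s (p, t)) ∧ (∀ b t, u' (i' b, t) = a' (b, t)) ∧
      (∀ x r t, H ((i x, r), t) = a ((x, r), t)) ∧ (∀ x t, H ((x, 0), t) = u (x, t)) ∧
      ∀ x t, H ((x, 1), t) = u' (f x, t) := by
  have h01 : (0 : I) ≠ 1 := zero_ne_one
  obtain ⟨u1, H1, hu1, hH1, h10, h11⟩ := hf.extend hS hN u s' s hs0 hs1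
  have hpS : IsProperMap (Subtype.val : S → T) := hS.isProperMap_subtypeVal
  let E : C(T ⊕ T ⊕ (S × I), T × I) :=
    ⟨Sum.elim (fun t => (t, 0)) (Sum.elim (fun t => (t, 1)) (Prod.map Subtype.val id)),
      by fun_prop⟩
  have hE : IsProperMap E := (isProperMap_prodMk_right _ isClosed_singleton).sumElim
    ((isProperMap_prodMk_right _ isClosed_singleton).sumElim (hpS.prodMap isProperMap_id))
  have hNE : IsNDR (Set.range E) := by
    convert hN.prod_union IsNDR.interval_ends using 1
    ext ⟨x, t⟩
    constructor
    · rintro ⟨x | x | x, h⟩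
      · exact .inr (.inl (Prod.mk.inj h).2.symm)
      · exact .inr (.inr (Prod.mk.inj h).2.symm)
      · exact .inl ((Prod.mk.inj h).1 ▸ x.1.2)
    · rintro (h | rfl | rfl)
      · exact ⟨.inr (.inr (⟨x, h⟩, t)), rfl⟩
      · exact ⟨.inl x, rfl⟩
      · exact ⟨.inr (.inl x), rfl⟩
  obtain ⟨c', c, hc', hc, hc0, hc1⟩ := hk.extend_proper hE hNE (Z := Z)
    ⟨fun p => u (i p.1, p.2.1), by fun_prop⟩
    (prodSumElim ⟨fun p => u1 (i' p.1, p.2), by fun_prop⟩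
      (prodSumElim a' ⟨fun p => a' (p.1, p.2.1), by fun_prop⟩))
    (prodSumElim ⟨fun p => H1 ((i p.1.1, p.1.2), p.2), by fun_prop⟩
      (prodSumElim a ⟨fun p => a (p.1, p.2.1), by fun_prop⟩))
    (prodSumElim_compat ⟨fun p => u1 (i' p.1, p.2), by fun_prop⟩ a'
      (fun b t => (hu1 (i' b) t).trans (has' b t)) rfl)
    (prodSumElim_compat ⟨fun p => H1 ((i p.1.1, p.1.2), p.2), by fun_prop⟩ a
      (fun b t => (hH1 (i b.1, b.2) t).trans (has b.1 b.2 t)) rfl)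
    (by
      rintro x (t | t | ⟨t, r⟩)
      · exact h10 _ _
      · exact ha0 _ _
      · exact ha0 _ _)
    (by
      rintro x (t | t | ⟨t, r⟩)
      · exact (h11 _ _).trans (congrArg (fun y => u1 (y, t)) (hcomm x))
      · exact ha1 _ _
      · exact ha1 _ _)
  have c'0 : ∀ b t, c' (b, (t, 0)) = u1 (i' b, t) := fun b t => hc' b (.inl t)
  have c'1 : ∀ b t, c' (b, (t, 1)) = a' (b, t) := fun b t => hc' b (.inr (.inl t))
  have c'S : ∀ b (t : S) r, c' (b, (t, r)) = a' (b, t) := fun b t r => hc' b (.inr (.inr (t, r)))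
  have c0 : ∀ p t, c (p, (t, 0)) = H1 ((i p.1, p.2), t) := fun b t => hc b (.inl t)
  have c1 : ∀ p t, c (p, (t, 1)) = a (p, t) := fun b t => hc b (.inr (.inl t))
  have cS : ∀ p (t : S) r, c (p, (t, r)) = a (p, t) := fun b t r => hc b (.inr (.inr (t, r)))
  have hp' := hi'.isProperMap
  have hp := hi.isProperMap
  let E' : C((B × T) ⊕ (Y × S), Y × T) :=
    ⟨Sum.elim (Prod.map i' id) (Prod.map id Subtype.val), by fun_prop⟩
  have hE' : IsProperMap E' := (hp'.prodMap isProperMap_id).sumElim (isProperMap_id.prodMap hpS)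
  have hNE' : IsNDR (Set.range E') := by
    convert hiN'.prod_union hN using 1
    ext ⟨x, t⟩
    constructor
    · rintro ⟨x | x, h⟩
      · exact .inl ⟨x.1, (Prod.mk.inj h).1⟩
      · exact .inr ((Prod.mk.inj h).2 ▸ x.2.2)
    · rintro (⟨b, rfl⟩ | h)
      · exact ⟨.inl (b, t), rfl⟩
      · exact ⟨.inr (x, ⟨t, h⟩), rfl⟩
  obtain ⟨U, hU0, hU⟩ := IsNDR.hep hE' hNE' u1
    (sumProdElim ⟨fun p => c' (p.1.1, (p.1.2, p.2)), by fun_prop⟩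
      ⟨fun p => s' p.1, by fun_prop⟩) (by
    have key : ∀ b (t : S) r, c' (b, (t, r)) = s' (i' b, t) := fun b t r => by rw [c'S, has']
    rintro (⟨b, t⟩ | ⟨y, t⟩) (⟨b', t'⟩ | ⟨y', t'⟩) r h <;> obtain ⟨h₁, h₂⟩ := Prod.mk.inj h
    · obtain rfl := hi'.injective h₁
      obtain rfl : t = t' := h₂
      rfl
    · obtain rfl : i' b = y' := h₁
      obtain rfl : t = t' := h₂
      exact key _ _ _
    · obtain rfl : y = i' b' := h₁
      obtain rfl : t = t' := h₂
      exact (key _ _ _).symm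
    · obtain rfl : y = y' := h₁
      obtain rfl : t = t' := Subtype.ext h₂
      rfl) (by
    rintro (⟨b, t⟩ | ⟨y, t⟩)
    · exact c'0 _ _
    · exact (hu1 _ _).symm)
  have hUB : ∀ b t r, U ((i' b, t), r) = c' (b, (t, r)) := fun b t r => hU (.inl (b, t)) r
  have hUS : ∀ y (t : S) r, U ((y, (t : T)), r) = s' (y, t) := fun y t r => hU (.inr (y, t)) r
  let F : C((X × T) ⊕ (X × T) ⊕ ((A × I) × T) ⊕ ((X × I) × S), (X × I) × T) :=
    ⟨Sum.elim (fun p => ((p.1, 0), p.2)) (Sum.elim (fun p => ((p.1, 1), p.2))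
      (Sum.elim (Prod.map (Prod.map i id) id) (Prod.map id Subtype.val))), by fun_prop⟩
  have hF : IsProperMap F := ((isProperMap_prodMk_right _ isClosed_singleton).prodMap
      isProperMap_id).sumElim (((isProperMap_prodMk_right _ isClosed_singleton).prodMap
      isProperMap_id).sumElim (((hp.prodMap isProperMap_id).prodMap isProperMap_id).sumElim
      (isProperMap_id.prodMap hpS)))
  have hNF : IsNDR (Set.range F) := by
    convert (hiN.prod_union IsNDR.interval_ends).prod_union hN using 1
    ext ⟨⟨x, r⟩, t⟩
    constructor
    · rintro ⟨x | x | x | x, h⟩ <;> obtain ⟨h₁, h₂⟩ := Prod.mk.inj h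
      · exact .inl (.inr (.inl (Prod.mk.inj h₁).2.symm))
      · exact .inl (.inr (.inr (Prod.mk.inj h₁).2.symm))
      · exact .inl (.inl ⟨x.1.1, (Prod.mk.inj h₁).1⟩)
      · exact .inr (h₂ ▸ x.2.2)
    · rintro ((⟨b, rfl⟩ | rfl | rfl) | h)
      · exact ⟨.inr (.inr (.inl ((b, r), t))), rfl⟩
      · exact ⟨.inl (x, t), rfl⟩
      · exact ⟨.inr (.inl (x, t)), rfl⟩
      · exact ⟨.inr (.inr (.inr ((x, r), ⟨t, h⟩))), rfl⟩
  have val0 : ∀ x t q, c ((x, 0), (t, q)) = u (i x, t) := fun x t q => hc0 _ _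
  have val1 : ∀ x t q, c ((x, 1), (t, q)) = U ((f (i x), t), q) := fun x t q => by
    rw [hcomm, hUB]; exact hc1 _ _
  have valS0 : ∀ x (t : S), s ((x, 0), t) = u (x, t) := hs0
  have valS1 : ∀ x (t : S) q, s ((x, 1), t) = U ((f x, (t : T)), q) := fun x t q => by
    rw [hUS, hs1]
  have valSA : ∀ x r (t : S) q, c ((x, r), ((t : T), q)) = s ((i x, r), t) := fun x r t q => by
    rw [cS, has]
  obtain ⟨R, hR0, hR⟩ := IsNDR.hep hF hNF H1
    (sumProdElim ⟨fun p => u p.1, by fun_prop⟩ (sumProdElim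
      ⟨fun p => U ((f p.1.1, p.1.2), p.2), by fun_prop⟩ (sumProdElim
      ⟨fun p => c (p.1.1, (p.1.2, p.2)), by fun_prop⟩ ⟨fun p => s p.1, by fun_prop⟩))) (by
    rintro (⟨x, t⟩ | ⟨x, t⟩ | ⟨⟨x, r⟩, t⟩ | ⟨⟨x, r⟩, t⟩)
      (⟨y, t'⟩ | ⟨y, t'⟩ | ⟨⟨y, r'⟩, t'⟩ | ⟨⟨y, r'⟩, t'⟩) q h <;>
      obtain ⟨h₁, h₂⟩ := Prod.mk.inj h <;> obtain ⟨h₁, h₃⟩ := Prod.mk.inj h₁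
    · subst h₁ h₂; rfl
    · exact (h01 h₃).elim
    · subst h₁ h₂ h₃; exact (val0 _ _ _).symm
    · subst h₁ h₂ h₃; exact (valS0 _ _).symm
    · exact (h01 h₃.symm).elim
    · subst h₁ h₂; rfl
    · subst h₁ h₂ h₃; exact (val1 _ _ _).symm
    · subst h₁ h₂ h₃; exact (valS1 _ _ _).symm
    · subst h₁ h₂ h₃; exact (val0 _ _ _)
    · subst h₁ h₂ h₃; exact (val1 _ _ _)
    · obtain rfl := hi.injective h₁
      subst h₂ h₃; rfl
    · subst h₁ h₂ h₃; exact valSA _ _ _ _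
    · subst h₁ h₂ h₃; exact (valS0 _ _)
    · subst h₁ h₂ h₃; exact (valS1 _ _ _)
    · subst h₁ h₂ h₃; exact (valSA _ _ _ _).symm
    · obtain rfl := Subtype.ext h₂
      subst h₁ h₃; rfl) (by
    rintro (⟨x, t⟩ | ⟨x, t⟩ | ⟨⟨x, r⟩, t⟩ | ⟨⟨x, r⟩, t⟩)
    · exact (h10 _ _).symm
    · exact (hU0 _).trans (h11 _ _).symm
    · exact c0 _ _
    · exact (hH1 _ _).symm)
  refine ⟨⟨fun p => U (p, 1), by fun_prop⟩, ⟨fun p => R (p, 1), by fun_prop⟩,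
    fun y t => hUS _ _ _, fun p t => hR (.inr (.inr (.inr (p, t)))) 1,
    fun b t => (hUB _ _ _).trans (c'1 _ _),
    fun x r t => (hR (.inr (.inr (.inl ((x, r), t)))) 1).trans (c1 _ _),
    fun x t => hR (.inl (x, t)) 1, fun x t => hR (.inr (.inl (x, t))) 1⟩

end Spaces

theorem IsNDR.stdSimplex_boundary (n : ℕ) :
    IsNDR ({t | ∃ i, t i = 0} : Set (stdSimplex ℝ (Fin (n + 1)))) := by
  have happ : ∀ i, Continuous fun t : stdSimplex ℝ (Fin (n + 1)) => t i := fun i =>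
    (continuous_apply i).comp continuous_subtype_val
  let m : stdSimplex ℝ (Fin (n + 1)) → ℝ := fun t => Finset.univ.inf' Finset.univ_nonempty fun i => t i
  have hm : Continuous m := Continuous.finset_inf'_apply _ fun i _ => happ i
  have hmi : ∀ t i, m t ≤ t i := fun t i => Finset.inf'_le _ (Finset.mem_univ i)
  have hmex : ∀ t, ∃ i, m t = t i := fun t => by
    obtain ⟨i, -, hi⟩ := Finset.exists_mem_eq_inf' Finset.univ_nonempty fun i => t i
    exact ⟨i, hi⟩
  have hm0 : ∀ t, 0 ≤ m t := fun t => by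
    obtain ⟨i, hi⟩ := hmex t
    exact hi ▸ stdSimplex.zero_le t i
  let N : ℝ := n + 1
  have hN : 0 < N := by positivity
  let c : stdSimplex ℝ (Fin (n + 1)) × ℝ → ℝ := fun p => min (1 / 2) (max 0 (min (p.2 / 2) (N * m p.1)))
  have hc : Continuous c := by fun_prop
  have hc2 : ∀ p, c p ≤ 1 / 2 := fun p => min_le_left _ _
  have hcm : ∀ p i, c p / N ≤ p.1 i := fun p i => by
    rw [div_le_iff₀ hN]
    refine (min_le_right _ _).trans (max_le (mul_nonneg (stdSimplex.zero_le _ _) hN.le) ?_)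
    refine (min_le_right _ _).trans ?_
    rw [mul_comm]
    exact mul_le_mul_of_nonneg_right (hmi _ _) hN.le
  refine ⟨⟨fun t => 2 * N * m t, by fun_prop⟩,
    ⟨fun p => ⟨fun i => (p.1 i - c p / N) / (1 - c p), fun i => ?_, ?_⟩, ?_⟩, ?_, ?_, ?_, ?_⟩
  · exact div_nonneg (sub_nonneg.2 (hcm p i)) (by linarith [hc2 p])
  · rw [← Finset.sum_div, Finset.sum_sub_distrib, stdSimplex.sum_eq_one, Finset.sum_const,
      Finset.card_univ, Fintype.card_fin, nsmul_eq_mul, div_eq_one_iff_eq (by linarith [hc2 p])]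
    push_cast
    change 1 - N * (c p / N) = _
    rw [mul_div_cancel₀ _ hN.ne']
  · refine Continuous.subtype_mk (continuous_pi fun i => ?_) _
    refine Continuous.div ?_ (by fun_prop) fun p => by linarith [hc2 p]
    exact ((happ i).comp continuous_fst).sub (hc.div_const _)
  · exact fun t => mul_nonneg (by positivity) (hm0 t)
  · rintro t ⟨i, hi⟩
    have : m t = 0 := le_antisymm ((hmi t i).trans_eq hi) (hm0 t)
    simp [this]
  · intro t
    have : c (t, 0) = 0 := by
      simp only [c]
      rw [zero_div, min_eq_left (mul_nonneg hN.le (hm0 t)), max_self, min_eq_right (by norm_num)]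
    refine Subtype.ext (funext fun i => ?_)
    simp only [ContinuousMap.coe_mk, this]
    rw [zero_div, sub_zero, sub_zero, div_one]
    rfl
  · intro t ht
    simp only [ContinuousMap.coe_mk] at ht
    have : c (t, 2 * N * m t) = N * m t := by
      have h0 := mul_nonneg hN.le (hm0 t)
      simp only [c]
      have h2 : 2 * N * m t / 2 = N * m t := by ring
      rw [h2, min_self, max_eq_right h0, min_eq_right (by linarith)]
    obtain ⟨i, hi⟩ := hmex t
    refine ⟨i, ?_⟩
    change (t i - c (t, 2 * N * m t) / N) / (1 - c (t, 2 * N * m t)) = 0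
    rw [this, mul_div_cancel_left₀ _ hN.ne', hi, sub_self, zero_div]

/-! ### Hurewicz cofibrations are closed embeddings of neighbourhood deformation retracts -/

theorem compactlyGenerated_of_isClosed {X : Type u} [TopologicalSpace X]
    [CompactlyGeneratedSpace X] {s : Set X} (hs : IsClosed s) : CompactlyGeneratedSpace s := by
  refine uCompactlyGeneratedSpace_of_isClosed fun C hC => ?_
  have h : IsClosed (Subtype.val '' C) := by
    refine UCompactlyGeneratedSpace.isClosed.{u} fun S f => ?_
    have hK : IsClosed (f ⁻¹' s) := hs.preimage f.continuous
    have : CompactSpace (f ⁻¹' s) := isCompact_iff_compactSpace.1 hK.isCompact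
    have := hC (CompHaus.of (f ⁻¹' s)) ⟨fun t => ⟨f t.1, t.2⟩, by fun_prop⟩
    convert hK.isClosedEmbedding_subtypeVal.isClosedMap _ this using 1
    ext t
    constructor
    · rintro ⟨c, hc, h⟩
      have ht : f t ∈ s := by rw [← h]; exact c.2
      refine ⟨⟨t, ht⟩, ?_, rfl⟩
      change (⟨f t, ht⟩ : s) ∈ C
      rwa [← (Subtype.ext h : c = ⟨f t, ht⟩)]
    · rintro ⟨t, ht, rfl⟩
      exact ⟨_, ht, rfl⟩
  convert h.preimage continuous_subtype_val using 1
  exact (Set.preimage_image_eq _ Subtype.val_injective).symm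

namespace CGHaus

variable {A X : CGHaus.{u}}

/-- The relation on `A × [0, 1]` collapsing the bottom. -/
def coneSetoid (A : CGHaus.{u}) : Setoid (A × I) where
  r p q := p = q ∨ (p.2 = 0 ∧ q.2 = 0)
  iseqv := ⟨fun _ => .inl rfl, fun h => h.elim (fun h => .inl h.symm) fun h => .inr h.symm, by
    rintro p q r (rfl | h) (rfl | h')
    · exact .inl rfl
    · exact .inr h'
    · exact .inr h
    · exact .inr ⟨h.1, h'.2⟩⟩

/-- The height of a point of the cone. -/
def coneHeight (z : Quotient (coneSetoid A)) : I :=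
  Quotient.lift Prod.snd (by
    rintro p q (h | h)
    · rw [h]
    · rw [h.1, h.2]) z

theorem continuous_coneHeight : Continuous (coneHeight (A := A)) :=
  continuous_snd.quotient_lift _

instance : T2Space (Quotient (coneSetoid A)) where
  t2 x y hxy := by
    by_cases h : coneHeight x = coneHeight y
    · obtain ⟨⟨a, t⟩, rfl⟩ := Quotient.exists_rep x
      obtain ⟨⟨b, s⟩, rfl⟩ := Quotient.exists_rep y
      obtain rfl : t = s := h
      have ht : t ≠ 0 := fun h0 => hxy (Quotient.sound (.inr ⟨h0, h0⟩))
      have hab : a ≠ b := fun h => hxy (by rw [h])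
      obtain ⟨U, V, hU, hV, haU, hbV, hUV⟩ := t2_separation hab
      have key : ∀ W : Set A, IsOpen W → IsOpen
          (Quotient.mk (coneSetoid A) '' (W ×ˢ {0}ᶜ)) := by
        intro W hW
        change IsOpen (Quotient.mk (coneSetoid A) ⁻¹' _)
        convert hW.prod (isClosed_singleton (x := (0 : I))).isOpen_compl using 1
        ext p
        constructor
        · rintro ⟨q, hq, h⟩
          rcases Quotient.exact h with h | h
          · exact h ▸ hq
          · exact (hq.2 h.1).elim
        · exact fun hp => ⟨p, hp, rfl⟩
      refine ⟨_, _, key U hU, key V hV, ⟨(a, t), ⟨haU, ht⟩, rfl⟩,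
        ⟨(b, t), ⟨hbV, ht⟩, rfl⟩, ?_⟩
      rw [Set.disjoint_left]
      rintro _ ⟨p, hp, rfl⟩ ⟨q, hq, h⟩
      rcases Quotient.exact h with h | h
      · exact Set.disjoint_left.1 hUV hp.1 (h ▸ hq.1)
      · exact hq.2 h.1
    · exact separated_by_continuous continuous_coneHeight h

/-- The cone on a compactly generated Hausdorff space. -/
def cone (A : CGHaus.{u}) : CGHaus.{u} :=
  have := IoProperad.prod_cg A I
  CGHaus.mk (Quotient (coneSetoid A))

theorem IsHurewiczCofibration.isClosedEmbedding {f : A ⟶ X} (hf : IsHurewiczCofibration f) :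
    IsClosedEmbedding f.hom := by
  rcases isEmpty_or_nonempty A with hA | ⟨⟨a₀⟩⟩
  · exact Topology.IsClosedEmbedding.of_continuous_injective_isClosedMap f.hom.continuous
      (fun x => isEmptyElim x)
      fun s _ => by rw [Set.eq_empty_of_isEmpty s, Set.image_empty]; exact isClosed_empty
  obtain ⟨H, -, hH⟩ := hf (cone A) (ContinuousMap.const _ (Quotient.mk (coneSetoid A) (a₀, 0)))
    ⟨Quotient.mk (coneSetoid A), continuous_quotient_mk'⟩
    fun a => Quotient.sound (.inr ⟨rfl, rfl⟩)
  let j : A → cone A := fun a => Quotient.mk (coneSetoid A) (a, 1)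
  have hj : IsClosedEmbedding j := by
    refine Topology.IsClosedEmbedding.of_continuous_injective_isClosedMap
      (continuous_quotient_mk'.comp (by fun_prop)) (fun a b h => ?_) fun s hs => ?_
    · rcases Quotient.exact h with h | h
      · exact (Prod.mk.inj h).1
      · exact (one_ne_zero h.1).elim
    · have : IsClosed (Quotient.mk (coneSetoid A) ⁻¹' (j '' s)) := by
        convert hs.prod (isClosed_singleton (x := (1 : I))) using 1
        ext p
        constructor
        · rintro ⟨a, ha, h⟩
          rcases Quotient.exact h with h | h
          · exact h ▸ ⟨ha, rfl⟩
          · exact (one_ne_zero h.1).elim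
        · rintro ⟨hp, h1⟩
          exact ⟨p.1, hp, congrArg (Quotient.mk (coneSetoid A)) (Prod.ext rfl h1.symm)⟩
      exact isQuotientMap_quotient_mk'.isClosed_preimage.1 this
  let k : C(X, cone A) := ⟨fun x => H (x, 1), by fun_prop⟩
  have hk : ∀ a, k (f.hom a) = j a := fun a => hH a 1
  have hemb : IsEmbedding f.hom := by
    refine IsEmbedding.of_comp f.hom.continuous k.continuous ?_
    convert hj.isEmbedding using 1
    exact funext hk
  refine ⟨hemb, ?_⟩
  have hV : IsClosed (k ⁻¹' Set.range j) := hj.isClosed_range.preimage k.continuous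
  let ρ : k ⁻¹' Set.range j → A := fun x => hj.isEmbedding.toHomeomorph.symm ⟨k x, x.2⟩
  have hρ : Continuous ρ := (Homeomorph.continuous _).comp (by fun_prop)
  have hcl : IsClosed ({x | f.hom (ρ x) = x} : Set (k ⁻¹' Set.range j)) :=
    isClosed_eq (f.hom.continuous.comp hρ) continuous_subtype_val
  convert hV.isClosedEmbedding_subtypeVal.isClosedMap _ hcl using 1
  ext x
  constructor
  · rintro ⟨a, rfl⟩
    refine ⟨⟨f.hom a, a, (hk a).symm⟩, ?_, rfl⟩
    refine congrArg f.hom ?_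
    refine (congrArg hj.isEmbedding.toHomeomorph.symm (Subtype.ext (hk a))).trans
      (hj.isEmbedding.toHomeomorph.symm_apply_apply a)
  · rintro ⟨x, hx, rfl⟩
    exact ⟨_, hx⟩

theorem IsHurewiczCofibration.isNDR {f : A ⟶ X} (hf : IsHurewiczCofibration f) :
    IsNDR (Set.range f.hom) := by
  have hcl : IsClosed ({p | p.1 ∈ Set.range f.hom ∨ p.2 = 0} : Set (X × I)) :=
    (hf.isClosedEmbedding.isClosed_range.preimage continuous_fst).union
      (isClosed_singleton.preimage continuous_snd)
  have := IoProperad.prod_cg X I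
  have := compactlyGenerated_of_isClosed hcl
  obtain ⟨H, hH0, hH⟩ := hf (CGHaus.mk ({p | p.1 ∈ Set.range f.hom ∨ p.2 = 0} : Set (X × I)))
    ⟨fun x => ⟨(x, 0), .inr rfl⟩, by fun_prop⟩
    ⟨fun p => ⟨(f.hom p.1, p.2), .inl ⟨_, rfl⟩⟩, by fun_prop⟩ fun _ => rfl
  have hR : Continuous fun p => (H p).1 := continuous_subtype_val.comp H.continuous
  have hR1 : Continuous fun p => (H p).1.1 := continuous_fst.comp hR
  let D : X → I → ℝ := fun x t => (t : ℝ) - (H (x, t)).1.2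
  have hD : Continuous (Function.uncurry D) := by
    refine Continuous.sub (by fun_prop) ?_
    exact continuous_subtype_val.comp (continuous_snd.comp hR)
  let v : X → ℝ := fun x => sSup (D x '' Set.univ)
  have hv : Continuous v := isCompact_univ.continuous_sSup hD
  have hDv : ∀ x t, D x t ≤ v x := fun x t =>
    le_csSup (isCompact_univ.image (hD.comp (by fun_prop : Continuous fun t => (x, t)))).bddAbove
      ⟨t, trivial, rfl⟩
  have hv0 : ∀ x, 0 ≤ v x := fun x => by
    refine le_trans ?_ (hDv x 0)
    simp only [D, hH0]
    simp
  refine ⟨⟨fun x => 2 * v x, by fun_prop⟩,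
    ⟨fun p => (H (p.1, Set.projIcc 0 1 zero_le_one (p.2 / 2))).1.1, ?_⟩,
    fun x => mul_nonneg zero_le_two (hv0 x), ?_, fun x => ?_, fun x hx => ?_⟩
  · refine hR1.comp (continuous_fst.prodMk (continuous_projIcc.comp (by fun_prop)))
  · rintro _ ⟨a, rfl⟩
    have : ∀ t, D (f.hom a) t = 0 := fun t => by simp only [D, hH]; simp
    have : v (f.hom a) = 0 := le_antisymm (csSup_le (Set.univ_nonempty.image _) (by
      rintro _ ⟨t, -, rfl⟩
      exact (this t).le)) (hv0 _)
    simp [this]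
  · change (H (x, Set.projIcc 0 1 zero_le_one (0 / 2))).1.1 = x
    rw [zero_div, Set.projIcc_left]
    exact congrArg (fun w => w.1.1) (hH0 x)
  · have hx' : v x ≤ 1 / 2 := by
      change 2 * v x ≤ 1 at hx
      linarith
    let s : I := ⟨v x, hv0 x, by linarith⟩
    have hs : Set.projIcc (0 : ℝ) 1 zero_le_one (2 * v x / 2) = s := by
      rw [mul_div_cancel_left₀ _ two_ne_zero]
      exact Set.projIcc_of_mem _ s.2
    change (H (x, Set.projIcc 0 1 zero_le_one (2 * v x / 2))).1.1 ∈ _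
    rw [hs]
    have hC : IsClosed ((fun t => (H (x, t)).1.1) ⁻¹' Set.range f.hom) :=
      hf.isClosedEmbedding.isClosed_range.preimage (hR1.comp (by fun_prop))
    have hsub : Set.Ioi s ⊆ (fun t => (H (x, t)).1.1) ⁻¹' Set.range f.hom := by
      intro t ht
      refine (H (x, t)).2.resolve_right fun h0 => ?_
      have h1 := hDv x t
      simp only [D] at h1
      rw [h0] at h1
      have h2 : v x < t := ht
      simp at h1
      linarith
    have h1 : s < 1 := Subtype.coe_lt_coe.1 (by change v x < 1; linarith)
    have := hC.closure_subset_iff.2 hsub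
    rw [closure_Ioi' (a := s) ⟨1, h1⟩] at this
    exact this (le_refl s)

end CGHaus

/-! ### The monad `𝔾` preserves homotopy equivalences and cofibrations -/

namespace IoSeq

variable {X Y : IoSeq.{u}} {a : Arity}

theorem continuous_gObj_prod {Z : Type*} [TopologicalSpace Z] {T : Type} [TopologicalSpace T]
    {φ : X.gObj a × T → Z} (h : ∀ s : IodaClass a, Continuous
      fun p : (CGHaus.KProd fun v : s.Vert => X (s.ar v)) × T => φ (⟨s, p.1⟩, p.2)) :
    Continuous φ :=
  (continuous_sigma (f := fun q : Σ s : IodaClass a,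
    (CGHaus.KProd fun v : s.Vert => X (s.ar v)) × T => φ (⟨q.1, q.2.1⟩, q.2.2)) h).comp
    (Homeomorph.sigmaProdDistrib
      (X := fun s : IodaClass a => CGHaus.KProd fun v : s.Vert => X (s.ar v)) (Y := T)).continuous

theorem continuous_map_param {T : Type} [TopologicalSpace T] [CompactSpace T] [T2Space T]
    (F : ∀ b, C(X b × T, Y b)) (a : Arity) :
    Continuous (Y := Y.gObj a) fun p : X.gObj a × T =>
      Lab.map (X := fun b => X b) (Y := fun b => Y b) (fun b x => F b (x, p.2)) p.1 := by
  refine continuous_gObj_prod fun s => ?_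
  refine (continuous_sigmaMk (σ := fun s : IodaClass a =>
    CGHaus.KProd fun v : s.Vert => Y (s.ar v))).comp ?_
  have := IoProperad.prod_cg (CGHaus.KProd fun v : s.Vert => X (s.ar v)) T
  refine CGHaus.KProd.continuous_mk (A := (CGHaus.KProd fun v : s.Vert => X (s.ar v)) × T)
    (X := fun v : s.Vert => Y (s.ar v)) (f := fun p v => F (s.ar v) (p.1 v, p.2))
    fun v => ?_
  exact (F _).continuous.comp (((CGHaus.KProd.continuous_apply _ v).comp continuous_fst).prodMk
    continuous_snd)

theorem gMap_isHomotopyEquiv {f : X ⟶ Y} (hf : ∀ b, _root_.IsHomotopyEquiv (f b).hom) (a : Arity) :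
    _root_.IsHomotopyEquiv (gMap f a).hom := by
  choose g G G' h0 h1 h2 h3 using hf
  refine ⟨(gMap (fun b => ⟨g b⟩ : Y ⟶ X) a).hom, ⟨_, continuous_map_param G a⟩,
    ⟨_, continuous_map_param G' a⟩, fun x => ?_, fun x => ?_, fun x => ?_, fun x => ?_⟩
  · exact congrArg (Sigma.mk x.1) (funext fun v => h0 _ _)
  · exact congrArg (Sigma.mk x.1) (funext fun v => h1 _ _)
  · exact congrArg (Sigma.mk x.1) (funext fun v => h2 _ _)
  · exact congrArg (Sigma.mk x.1) (funext fun v => h3 _ _)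

theorem range_gMap (f : X ⟶ Y) (a : Arity) :
    Set.range (gMap f a).hom = {z | ∀ v, z.2 v ∈ Set.range (f (z.1.ar v)).hom} := by
  ext z
  constructor
  · rintro ⟨x, rfl⟩ v
    exact ⟨x.2 v, rfl⟩
  · intro h
    choose x hx using h
    exact ⟨⟨z.1, x⟩, congrArg (Sigma.mk z.1) (funext hx)⟩

theorem isClosed_forall_mem {C : ∀ b, Set (Y b)} (hC : ∀ b, IsClosed (C b)) (a : Arity) :
    IsClosed ({z | ∀ v, z.2 v ∈ C (z.1.ar v)} : Set (Y.gObj a)) := by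
  refine isClosed_sigma_iff.2 fun s => ?_
  change IsClosed ({x | ∀ v, x v ∈ C (s.ar v)} : Set (CGHaus.KProd fun v : s.Vert => Y (s.ar v)))
  rw [Set.ofPred_forall]
  exact isClosed_iInter fun v => (hC _).preimage (CGHaus.KProd.continuous_apply _ v)

theorem isOpen_forall_mem {C : ∀ b, Set (Y b)} (hC : ∀ b, IsOpen (C b)) (a : Arity) :
    IsOpen ({z | ∀ v, z.2 v ∈ C (z.1.ar v)} : Set (Y.gObj a)) := by
  refine isOpen_sigma_iff.2 fun s => ?_
  change IsOpen ({x | ∀ v, x v ∈ C (s.ar v)} : Set (CGHaus.KProd fun v : s.Vert => Y (s.ar v)))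
  rw [Set.ofPred_forall]
  exact isOpen_iInter_of_finite fun v => (hC _).preimage (CGHaus.KProd.continuous_apply _ v)

theorem gMap_isClopen_range {f : X ⟶ Y} (hf : ∀ b, IsClopen (Set.range (f b).hom)) (a : Arity) :
    IsClopen (Set.range (gMap f a).hom) := by
  rw [range_gMap]
  exact ⟨isClosed_forall_mem (fun b => (hf b).1) a, isOpen_forall_mem (fun b => (hf b).2) a⟩

theorem gMap_isClosedEmbedding {f : X ⟶ Y} (hf : ∀ b, IsClosedEmbedding (f b).hom) (a : Arity) :
    IsClosedEmbedding (gMap f a).hom := by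
  refine Topology.IsClosedEmbedding.of_continuous_injective_isClosedMap (ContinuousMap.continuous _)
    ?_ fun S hS => ?_
  · rintro ⟨s, x⟩ ⟨t, y⟩ h
    obtain rfl : s = t := congrArg Sigma.fst h
    have := eq_of_heq (Sigma.mk.inj h).2
    exact congrArg (Sigma.mk s) (funext fun v => (hf _).injective (congrFun this v))
  · refine isClosed_sigma_iff.2 fun s => ?_
    let D : Set (CGHaus.KProd fun v : s.Vert => Y (s.ar v)) :=
      {y | ∀ v, y v ∈ Set.range (f (s.ar v)).hom}
    have hR : IsClosed D :=
      isClosed_sigma_iff.1 (isClosed_forall_mem (fun b => (hf b).isClosed_range) a) s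
    have := compactlyGenerated_of_isClosed hR
    let g : D → CGHaus.KProd fun v : s.Vert => X (s.ar v) :=
      fun y v => (hf (s.ar v)).isEmbedding.toHomeomorph.symm ⟨y.1 v, y.2 v⟩
    have hg : Continuous g := CGHaus.KProd.continuous_mk fun v =>
      (Homeomorph.continuous _).comp
        (((CGHaus.KProd.continuous_apply _ v).comp continuous_subtype_val).subtype_mk _)
    have hcl := hR.isClosedEmbedding_subtypeVal.isClosedMap _
      ((isClosed_sigma_iff.1 hS s).preimage hg)
    convert hcl using 1
    have hfg : ∀ y v, (f (s.ar v)).hom (g y v) = y.1 v := fun y v =>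
      congrArg Subtype.val ((hf (s.ar v)).isEmbedding.toHomeomorph.apply_symm_apply ⟨y.1 v, y.2 v⟩)
    ext y
    constructor
    · rintro ⟨⟨t, x⟩, hx, h⟩
      obtain rfl : t = s := congrArg Sigma.fst h
      have h' : (fun v => (f _).hom (x v)) = y := eq_of_heq (Sigma.mk.inj h).2
      subst h'
      refine ⟨⟨_, fun v => ⟨x v, rfl⟩⟩, ?_, rfl⟩
      have hgx : g ⟨fun v => (f _).hom (x v), fun v => ⟨x v, rfl⟩⟩ = x :=
        funext fun v => (hf (t.ar v)).injective (hfg _ v)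
      change (⟨t, g _⟩ : X.gObj a) ∈ S
      rwa [hgx]
    · rintro ⟨y, hy, rfl⟩
      exact ⟨⟨s, g y⟩, hy, congrArg (Sigma.mk s) (funext fun v => hfg y v)⟩

theorem gMap_isNDR {f : X ⟶ Y} (hf : ∀ b, IsNDR (Set.range (f b).hom)) (a : Arity) :
    IsNDR (Set.range (gMap f a).hom) := by
  choose w h hw hA h0 h1 using hf
  let k : C(Y.gObj a × I, Y.gObj a) := ⟨_, continuous_map_param (T := I)
    (fun b => ⟨fun p => h b (p.1, min (p.2 : ℝ) (w b p.1)), by fun_prop⟩) a⟩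
  let U : C(Y.gObj a, ℝ) := ⟨fun z => ∑ v, w (z.1.ar v) (z.2 v), by
    refine continuous_sigma (σ := fun s : IodaClass a =>
      CGHaus.KProd fun v : s.Vert => Y (s.ar v)) fun s => ?_
    exact continuous_finsetSum (X := CGHaus.KProd fun v : s.Vert => Y (s.ar v))
      (f := fun v x => w (s.ar v) (x v)) Finset.univ fun v _ =>
      (w _).continuous.comp (CGHaus.KProd.continuous_apply _ v)⟩
  have hU : ∀ z, U z = ∑ v, w (z.1.ar v) (z.2 v) := fun z => rfl
  have hU0 : ∀ z, 0 ≤ U z := fun z => hU z ▸ Finset.sum_nonneg fun v _ => hw _ _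
  refine ⟨U, ⟨fun p => k (p.1, Set.projIcc 0 1 zero_le_one p.2), ?_⟩, hU0, ?_, ?_, ?_⟩
  · exact k.continuous.comp (continuous_fst.prodMk (continuous_projIcc.comp continuous_snd))
  · rintro _ ⟨x, rfl⟩
    exact (hU _).trans (Finset.sum_eq_zero fun v _ => hA _ _ ⟨x.2 v, rfl⟩)
  · intro z
    change k (z, Set.projIcc 0 1 zero_le_one 0) = z
    rw [Set.projIcc_left]
    refine congrArg (Sigma.mk z.1) (funext fun v => ?_)
    change h _ (z.2 v, min 0 (w _ (z.2 v))) = z.2 v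
    rw [min_eq_left (hw _ _), h0]
  · intro z hz
    change k (z, Set.projIcc 0 1 zero_le_one (U z)) ∈ _
    rw [Set.projIcc_of_mem _ ⟨hU0 z, hz⟩, range_gMap]
    intro v
    have hv : w _ (z.2 v) ≤ U z :=
      Finset.single_le_sum (f := fun v => w (z.1.ar v) (z.2 v)) (fun v _ => hw _ _)
        (Finset.mem_univ v)
    change h (z.1.ar v) (z.2 v, min (U z) (w (z.1.ar v) (z.2 v))) ∈
      Set.range (f (z.1.ar v)).hom
    rw [min_eq_right hv]
    exact h1 _ _ (hv.trans hz)

theorem range_gUnit (X : IoSeq.{u}) (a : Arity) :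
    Set.range (gUnit X a).hom =
      {z | z.1 = IodaClass.of (IoGraph.corolla a) (IoGraph.corolla_isIoda a)} := by
  ext z
  constructor
  · rintro ⟨x, rfl⟩
    rfl
  · obtain ⟨s, z⟩ := z
    rintro rfl
    let e := IodaClass.ofIso (IoGraph.corolla a) (IoGraph.corolla_isIoda a)
    let x : X a := cast (congrArg (fun b => (X b).carrier) (e.ar ())) (z (e.fV ()))
    refine ⟨x, ?_⟩
    refine (Lab.rep_mk (X := fun b => X b) (IoGraph.corolla a) (IoGraph.corolla_isIoda a)
      fun _ => x).unique (IoGraph.corolla_isIoda a) ⟨e, fun v => (cast_heq _ _).symm⟩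

theorem gUnit_isClopen_range (X : IoSeq.{u}) (a : Arity) : IsClopen (Set.range (gUnit X a).hom) := by
  rw [range_gUnit]
  have h := isClopen_range_sigmaMk (X := fun c : IodaClass a =>
      CGHaus.KProd fun w : c.Vert => X (c.ar w))
      (i := IodaClass.of (IoGraph.corolla a) (IoGraph.corolla_isIoda a))
  rwa [Set.range_sigmaMk] at h

end IoSeq

/-! ### Maps out of free io-properads -/

namespace IoProperad

variable {X Y : IoProperad.{u}} {T : Type} [TopologicalSpace T]

/-- The generators of a free io-properad. -/
noncomputable def ofGen (X : IoProperad.{u}) {a : Arity} (x : X.A a) : (freeComonad.obj X).A a :=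
  (IoSeq.gUnit X.A a).hom x

theorem continuous_ofGen (X : IoProperad.{u}) (a : Arity) :
    Continuous fun x : X.A a => ofGen X x := (IoSeq.gUnit X.A a).hom.continuous

theorem free_hom_ext {f g : freeComonad.obj X ⟶ Y}
    (h : ∀ a (x : X.A a), (f.f a).hom (ofGen X x) = (g.f a).hom (ofGen X x)) : f = g := by
  refine hom_ext' fun a z => ?_
  have hz : (freeComonad.obj X).act (Lab.map (fun b x => ofGen X x) z) = z :=
    Lab.mul_map_unit (X := fun b => X.A b) z
  rw [← hz, hom_act, hom_act]
  exact congrArg Y.act (congrArg (Sigma.mk z.1) (funext fun v => h _ _))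

theorem act_map_mul {S : Arity → Type u} (φ : ∀ b, S b → Y.A b) {a : Arity} (z : Lab (Lab S) a) :
    Y.act (Lab.map φ z.mul) = Y.act (Lab.map (fun _ w => Y.act (Lab.map φ w)) z) := by
  rw [Lab.map_mul, act_mul]
  rfl

/-- The family of maps out of a free io-properad with given values on the generators. -/
noncomputable def Family.ofGen [CompactSpace T] [T2Space T] (F : ∀ a, C(X.A a × T, Y.A a)) :
    Family (freeComonad.obj X) T Y where
  hom τ :=
    { f := fun a => ⟨⟨fun z => Y.act (Lab.map (X := fun b => X.A b) (Y := fun b => Y.A b)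
        (fun b x => F b (x, τ)) z), (Y.a a).hom.continuous.comp
          ((IoSeq.continuous_map_param F a).comp (by fun_prop : Continuous fun z => (z, τ)))⟩⟩
      h := funext fun a => CGHaus.hom_ext fun z => (act_map_mul (fun b x => F b (x, τ)) z).symm }
  continuous a := (Y.a a).hom.continuous.comp (IoSeq.continuous_map_param F a)

theorem Family.ofGen_hom [CompactSpace T] [T2Space T] (F : ∀ a, C(X.A a × T, Y.A a)) (τ : T)
    {a : Arity} (x : X.A a) :
    (((Family.ofGen F).hom τ).f a).hom (IoProperad.ofGen X x) = F a (x, τ) := by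
  change Y.act (Lab.map _ (Lab.unit _)) = _
  rw [Lab.map_unit]
  exact act_unit Y _

/-- The values on the generators. -/
noncomputable def Family.gen (φ : Family (freeComonad.obj X) T Y) (a : Arity) :
    C(X.A a × T, Y.A a) :=
  ⟨fun p => ((φ.hom p.2).f a).hom (IoProperad.ofGen X p.1), (φ.continuous a).comp
    (((continuous_ofGen X a).comp continuous_fst).prodMk continuous_snd)⟩

end IoProperad

/-! ### Cotensors of io-properads with compact Hausdorff spaces -/

namespace IoProperad

section cotensor

variable (K : Type) [TopologicalSpace K] (Y : IoProperad.{u})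

/-- The points of the components of the cotensor. -/
def CotensorPt (a : Arity) : Type u := C(K, Y.A a)

instance (a : Arity) : TopologicalSpace (CotensorPt K Y a) :=
  @TopologicalSpace.compactlyGenerated.{u} C(K, Y.A a) inferInstance

instance (a : Arity) : CompactlyGeneratedSpace (CotensorPt K Y a) :=
  compactlyGenerated_cg C(K, Y.A a)

variable {K Y}

/-- Evaluation at a parameter. -/
def CotensorPt.eval {a : Arity} (x : CotensorPt K Y a) (k : K) : Y.A a :=
  (show C(K, Y.A a) from x) k

theorem CotensorPt.ext {a : Arity} {x y : CotensorPt K Y a} (h : ∀ k, x.eval k = y.eval k) :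
    x = y :=
  ContinuousMap.ext (f := (x : C(K, Y.A a))) h

theorem CotensorPt.continuous_eval [CompactSpace K] (a : Arity) :
    Continuous fun p : CotensorPt K Y a × K => p.1.eval p.2 := by
  have h : Continuous (X := CotensorPt K Y a) (Y := C(K, Y.A a)) id :=
    continuous_from_compactlyGenerated (X := C(K, Y.A a)) (Y := C(K, Y.A a)) id
      fun S g => g.continuous
  exact (ContinuousEval.continuous_eval (F := C(K, Y.A a))).comp (h.prodMap continuous_id)

theorem CotensorPt.continuous_mk {A : Type u} [TopologicalSpace A] [CompactlyGeneratedSpace A]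
    {a : Arity} (f : C(A × K, Y.A a)) :
    Continuous (Y := CotensorPt K Y a) fun x => f.curry x :=
  continuous_to_compactlyGenerated (X := C(K, Y.A a)) f.curry.continuous

variable [CompactSpace K] [T2Space K]

instance (a : Arity) : T2Space (CotensorPt K Y a) where
  t2 x y hxy := by
    by_contra hcon
    refine hxy (CotensorPt.ext fun k => ?_)
    by_contra hne
    exact hcon (separated_by_continuous
      ((CotensorPt.continuous_eval a).comp (continuous_id.prodMk (continuous_const (y := k)))) hne)

variable (K Y)

/-- The underlying io-sequence of the cotensor. -/
def cotensorSeq : IoSeq.{u} := fun a => CGHaus.mk (CotensorPt K Y a)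

/-- Composition in the cotensor, as a parametrized map. -/
noncomputable def cotensorAct (a : Arity) : C((cotensorSeq K Y).gObj a × K, Y.A a) :=
  ⟨fun p => Y.act (Lab.map (X := fun b => cotensorSeq K Y b) (Y := fun b => Y.A b)
    (fun _ x => CotensorPt.eval x p.2) p.1), (Y.a a).hom.continuous.comp
      (IoSeq.continuous_map_param (X := cotensorSeq K Y)
        (fun b => ⟨_, CotensorPt.continuous_eval b⟩) a)⟩

/-- The cotensor of an io-properad with a compact Hausdorff space: pointwise operations on
continuous maps. -/
noncomputable def cotensor : IoProperad.{u} where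
  A := cotensorSeq K Y
  a := fun a => ⟨⟨fun z => (cotensorAct K Y a).curry z, CotensorPt.continuous_mk _⟩⟩
  unit := funext fun a => CGHaus.hom_ext fun x => CotensorPt.ext fun k => by
    change Y.act (Lab.map (X := fun b => cotensorSeq K Y b) _ (Lab.unit x)) = _
    rw [Lab.map_unit]
    exact act_unit Y _
  assoc := funext fun a => CGHaus.hom_ext fun z => CotensorPt.ext fun k =>
    act_map_mul (S := fun b => cotensorSeq K Y b) (fun b x => CotensorPt.eval x k) z

variable {K Y}

/-- Evaluation at a point is a map of io-properads. -/
noncomputable def cotensorEv (k : K) : cotensor K Y ⟶ Y where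
  f := fun a => ⟨⟨fun x => CotensorPt.eval x k,
    (CotensorPt.continuous_eval a).comp (continuous_id.prodMk continuous_const)⟩⟩
  h := rfl

theorem cotensor_hom_ext {W : IoProperad.{u}} {f g : W ⟶ cotensor K Y}
    (h : ∀ k, f ≫ cotensorEv k = g ≫ cotensorEv k) : f = g :=
  hom_ext' fun a x => CotensorPt.ext fun k =>
    congrArg (fun φ : W ⟶ Y => (φ.f a).hom x) (h k)

variable {W : IoProperad.{u}}

/-- A family of maps as a map to the cotensor. -/
noncomputable def Family.toCotensor (φ : Family W K Y) : W ⟶ cotensor K Y where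
  f := fun a => ⟨⟨fun x => ContinuousMap.curry ⟨_, φ.continuous a⟩ x, CotensorPt.continuous_mk _⟩⟩
  h := funext fun _ => CGHaus.hom_ext fun z => CotensorPt.ext fun k =>
    (hom_act (φ.hom k) z).symm

/-- A map to the cotensor as a family of maps. -/
noncomputable def Family.ofCotensor (f : W ⟶ cotensor K Y) : Family W K Y where
  hom k := f ≫ cotensorEv k
  continuous a := (CotensorPt.continuous_eval a).comp
    (((f.f a).hom.continuous.comp continuous_fst).prodMk continuous_snd)

end cotensor

end IoProperad

/-! ### Faces of simplices -/

section Simplex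

theorem stdSimplex_map_apply {X Y : Type*} [Fintype X] [Fintype Y] [DecidableEq Y] (f : X → Y)
    (t : stdSimplex ℝ X) (y : Y) :
    stdSimplex.map f t y = ∑ x with f x = y, t x := by
  change FunOnFinite.linearMap ℝ ℝ f t y = _
  rw [FunOnFinite.linearMap_apply_apply]

theorem stdSimplex_map_map {l m n : ℕ} (θ : ⦋l⦌ ⟶ ⦋m⦌) (η : ⦋m⦌ ⟶ ⦋n⦌)
    (t : stdSimplex ℝ (Fin (l + 1))) :
    stdSimplex.map η.toOrderHom (stdSimplex.map θ.toOrderHom t) =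
      stdSimplex.map (θ ≫ η).toOrderHom t :=
  stdSimplex.map_comp_apply _ _ _

theorem stdSimplex_map_eq_self {X : Type*} [Fintype X] (f : X → X) (t : stdSimplex ℝ X)
    (h : ∀ x, t x ≠ 0 → f x = x) : stdSimplex.map f t = t := by
  classical
  refine Subtype.ext (funext fun y => ?_)
  refine (stdSimplex_map_apply f t y).trans ?_
  rw [Finset.sum_filter, Finset.sum_eq_single y]
  · by_cases hy : t y = 0
    · exact (ite_eq_left_iff.2 fun _ => hy.symm)
    · exact if_pos (h y hy)
  · intro x _ hxy
    by_cases hx : t x = 0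
    · simp [hx]
    · rw [if_neg]
      rw [h x hx]
      exact hxy
  · exact fun h => absurd (Finset.mem_univ y) h

theorem exists_retraction_δ {n : ℕ} (i : Fin (n + 2)) :
    ∃ σ : ⦋n + 1⦌ ⟶ ⦋n⦌, SimplexCategory.δ i ≫ σ = 𝟙 _ := by
  refine i.lastCases ⟨SimplexCategory.σ (Fin.last n), ?_⟩ fun j => ⟨SimplexCategory.σ j, ?_⟩
  · rw [← Fin.succ_last, SimplexCategory.δ_comp_σ_succ]
  · exact SimplexCategory.δ_comp_σ_self

theorem stdSimplex_map_face {n : ℕ} {i : Fin (n + 2)} {σ : ⦋n + 1⦌ ⟶ ⦋n⦌}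
    (hσ : SimplexCategory.δ i ≫ σ = 𝟙 _) {t : stdSimplex ℝ (Fin (n + 2))} (ht : t i = 0) :
    stdSimplex.map (SimplexCategory.δ i).toOrderHom (stdSimplex.map σ.toOrderHom t) = t := by
  rw [stdSimplex_map_map]
  refine stdSimplex_map_eq_self _ _ fun x hx => ?_
  obtain ⟨y, rfl⟩ := Fin.exists_succAbove_eq (x := x) (y := i) (by rintro rfl; exact hx ht)
  have h := congrArg (fun f : ⦋n⦌ ⟶ ⦋n⦌ => f.toOrderHom y) hσ
  exact congrArg (i.succAbove) h

theorem stdSimplex_map_eq_zero {m n : ℕ} {θ : ⦋m⦌ ⟶ ⦋n⦌} {i : Fin (n + 1)}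
    (hi : ∀ x, θ.toOrderHom x ≠ i) (s : stdSimplex ℝ (Fin (m + 1))) :
    stdSimplex.map θ.toOrderHom s i = 0 := by
  classical
  refine (stdSimplex_map_apply _ s i).trans (Finset.sum_eq_zero fun x hx => ?_)
  exact absurd (Finset.mem_filter.1 hx).2 (hi x)

theorem stdSimplex_map_δ_apply {n : ℕ} (i : Fin (n + 2)) (s : stdSimplex ℝ (Fin (n + 1)))
    (j : Fin (n + 1)) :
    stdSimplex.map (SimplexCategory.δ i).toOrderHom s (i.succAbove j) = s j := by
  classical
  refine (stdSimplex_map_apply _ s _).trans ?_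
  have : (Finset.univ.filter fun x : Fin (n + 1) => i.succAbove x = i.succAbove j) = {j} := by
    ext x
    simp
  exact (congrArg (fun F => ∑ x ∈ F, s x) this).trans (Finset.sum_singleton _ _)

theorem SimplexCategory.not_surjective_of_lt {m n : ℕ} (h : m < n) (θ : ⦋m⦌ ⟶ ⦋n⦌) :
    ¬ Function.Surjective θ.toOrderHom := fun hs => by
  have := Fintype.card_le_of_surjective _ hs
  simp at this
  omega

theorem SimplexCategory.not_injective_of_lt {m n : ℕ} (h : m < n) (θ : ⦋n⦌ ⟶ ⦋m⦌) :
    ¬ Function.Injective θ.toOrderHom := fun hs => by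
  have := Fintype.card_le_of_injective _ hs
  simp at this
  omega

end Simplex

namespace IoSeq

theorem mem_range_gMap {X Y X' Y' : IoSeq.{u}} {s : X ⟶ Y} {s' : X' ⟶ Y'} {g : Y ⟶ Y'}
    (h : ∀ b y, (g b).hom y ∈ Set.range (s' b).hom → y ∈ Set.range (s b).hom) (a : Arity)
    (z : Y.gObj a) (hz : (gMap g a).hom z ∈ Set.range (gMap s' a).hom) :
    z ∈ Set.range (gMap s a).hom := by
  rw [range_gMap] at hz ⊢
  exact fun v => h _ _ (hz v)

theorem mem_range_gUnit {X X' : IoSeq.{u}} (g : X ⟶ X') (a : Arity) (z : X.gObj a)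
    (hz : (gMap g a).hom z ∈ Set.range (gUnit X' a).hom) : z ∈ Set.range (gUnit X a).hom := by
  rw [range_gUnit] at hz ⊢
  exact hz

end IoSeq

namespace IoProperad

/-! ### The levels of the bar construction -/

section levels

variable {P P' Y : IoProperad.{u}} {m n : ℕ} {a : Arity}

/-- The io-properad `𝔾ⁿ P` whose underlying io-sequence generates the `n`-simplices of the bar
construction. -/
noncomputable abbrev lev (n : ℕ) (P : IoProperad.{u}) : IoProperad.{u} :=
  ComonadBar.iter freeComonad n P

/-- The `n`-simplices of the bar construction. -/
noncomputable abbrev barObj (n : ℕ) (P : IoProperad.{u}) : IoProperad.{u} := (bar.obj P).obj (op ⦋n⦌)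

/-- The map of generators induced by a map of io-properads. -/
noncomputable abbrev levMap (n : ℕ) (f : P ⟶ P') : lev n P ⟶ lev n P' :=
  ComonadBar.iterMap freeComonad f n

/-- The map of `n`-simplices induced by a map of io-properads. -/
noncomputable abbrev barObjMap (n : ℕ) (f : P ⟶ P') : barObj n P ⟶ barObj n P' :=
  (bar.map f).app (op ⦋n⦌)

theorem levMap_comp {P'' : IoProperad.{u}} (n : ℕ) (f : P ⟶ P') (g : P' ⟶ P'') :
    levMap n (f ≫ g) = levMap n f ≫ levMap n g := by
  induction n with
  | zero => rfl
  | succ n ih =>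
    exact (congrArg (ComonadBar.kap freeComonad) ih).trans (ComonadBar.kap_comp freeComonad _ _)

theorem levMap_isHomotopyEquiv {f : P ⟶ P'} (hf : ∀ b, _root_.IsHomotopyEquiv (f.f b).hom) (n : ℕ) :
    ∀ b, _root_.IsHomotopyEquiv ((levMap n f).f b).hom := by
  induction n with
  | zero => exact hf
  | succ n ih => exact IoSeq.gMap_isHomotopyEquiv ih

theorem levMap_isClosedEmbedding {f : P ⟶ P'} (hf : ∀ b, IsClosedEmbedding (f.f b).hom) (n : ℕ) :
    ∀ b, IsClosedEmbedding ((levMap n f).f b).hom := by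
  induction n with
  | zero => exact hf
  | succ n ih => exact IoSeq.gMap_isClosedEmbedding ih

theorem levMap_isNDR {f : P ⟶ P'} (hf : ∀ b, IsNDR (Set.range (f.f b).hom)) (n : ℕ) :
    ∀ b, IsNDR (Set.range ((levMap n f).f b).hom) := by
  induction n with
  | zero => exact hf
  | succ n ih => exact IoSeq.gMap_isNDR ih

/-- The generators of the `n`-simplices of the bar construction. -/
noncomputable def barGen (n : ℕ) (x : (lev n P).A a) : (barObj n P).A a := ofGen (lev n P) x

theorem continuous_barGen (n : ℕ) (P : IoProperad.{u}) (a : Arity) :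
    Continuous fun x : (lev n P).A a => barGen n x := continuous_ofGen _ _

theorem barObjMap_barGen (f : P ⟶ P') (x : (lev n P).A a) :
    ((barObjMap n f).f a).hom (barGen n x) = barGen n (((levMap n f).f a).hom x) :=
  Lab.map_unit (fun b => ((levMap n f).f b).hom) x

theorem bar_hom_ext {f g : barObj n P ⟶ Y}
    (h : ∀ a (x : (lev n P).A a), (f.f a).hom (barGen n x) = (g.f a).hom (barGen n x)) : f = g :=
  free_hom_ext (X := lev n P) h

/-- The simplicial operators of the bar construction. -/
noncomputable def barAct (P : IoProperad.{u}) (θ : ⦋m⦌ ⟶ ⦋n⦌) : barObj n P ⟶ barObj m P :=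
  (bar.obj P).map θ.op

theorem barAct_comp {l : ℕ} (θ : ⦋l⦌ ⟶ ⦋m⦌) (η : ⦋m⦌ ⟶ ⦋n⦌) :
    barAct P (θ ≫ η) = barAct P η ≫ barAct P θ := by
  rw [barAct, op_comp, Functor.map_comp]
  rfl

theorem barAct_id : barAct P (𝟙 ⦋n⦌) = 𝟙 _ := (bar.obj P).map_id _

theorem barAct_naturality (f : P ⟶ P') (θ : ⦋m⦌ ⟶ ⦋n⦌) :
    barObjMap n f ≫ barAct P' θ = barAct P θ ≫ barObjMap m f :=
  ((bar.map f).naturality θ.op).symm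

theorem barAct_comp_apply {l : ℕ} (θ : ⦋l⦌ ⟶ ⦋m⦌) (η : ⦋m⦌ ⟶ ⦋n⦌) (z : (barObj n P).A a) :
    ((barAct P θ).f a).hom (((barAct P η).f a).hom z) = ((barAct P (θ ≫ η)).f a).hom z := by
  rw [barAct_comp]
  rfl

theorem barAct_naturality_apply (f : P ⟶ P') (θ : ⦋m⦌ ⟶ ⦋n⦌) (z : (barObj n P).A a) :
    ((barAct P' θ).f a).hom (((barObjMap n f).f a).hom z) =
      ((barObjMap m f).f a).hom (((barAct P θ).f a).hom z) :=
  congrArg (fun g : barObj n P ⟶ barObj m P' => (g.f a).hom z) (barAct_naturality f θ)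

theorem barAct_σ_zero_f (P : IoProperad.{u}) (n : ℕ) :
    (barAct P (SimplexCategory.σ (0 : Fin (n + 1)))).f = IoSeq.gMap (IoSeq.gUnit (lev n P).A) :=
  congrArg Monad.Algebra.Hom.f (ComonadBar.bar_σ_zero freeComonad P n)

theorem barAct_σ_succ_f (P : IoProperad.{u}) (n : ℕ) (j : Fin (n + 1)) :
    (barAct P (SimplexCategory.σ j.succ)).f =
      IoSeq.gMap (barAct P (SimplexCategory.σ j)).f :=
  congrArg Monad.Algebra.Hom.f (ComonadBar.bar_σ_succ freeComonad P n j)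

theorem barAct_σ_barGen (j : Fin (n + 1)) (x : (lev n P).A a) :
    ∃ y : (lev (n + 1) P).A a,
      ((barAct P (SimplexCategory.σ j)).f a).hom (barGen n x) = barGen (n + 1) y := by
  cases j using Fin.cases with
  | zero =>
    rw [barAct_σ_zero_f]
    exact ⟨_, Lab.map_unit (fun b => (IoSeq.gUnit (lev n P).A b).hom) x⟩
  | succ j =>
    cases n with
    | zero => exact j.elim0
    | succ n =>
      rw [barAct_σ_succ_f]
      exact ⟨_, Lab.map_unit (fun b => ((barAct P (SimplexCategory.σ j)).f b).hom) x⟩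

theorem isClopen_range_barAct_σ (P : IoProperad.{u}) (n : ℕ) (j : Fin (n + 1)) (a : Arity) :
    IsClopen (Set.range ((barAct P (SimplexCategory.σ j)).f a).hom) := by
  induction n generalizing a with
  | zero =>
    obtain rfl : j = 0 := Subsingleton.elim (α := Fin 1) _ _
    rw [barAct_σ_zero_f]
    exact IoSeq.gMap_isClopen_range (fun b => IoSeq.gUnit_isClopen_range _ b) a
  | succ n ih =>
    cases j using Fin.cases with
    | zero =>
      rw [barAct_σ_zero_f]
      exact IoSeq.gMap_isClopen_range (fun b => IoSeq.gUnit_isClopen_range _ b) a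
    | succ j =>
      rw [barAct_σ_succ_f]
      exact IoSeq.gMap_isClopen_range (fun b => ih j b) a

theorem mem_range_barAct_σ (f : P ⟶ P') (n : ℕ) (j : Fin (n + 1)) (a : Arity)
    (z : (barObj (n + 1) P).A a) (hz : ((barObjMap (n + 1) f).f a).hom z ∈
      Set.range ((barAct P' (SimplexCategory.σ j)).f a).hom) :
    z ∈ Set.range ((barAct P (SimplexCategory.σ j)).f a).hom := by
  have h0 : ∀ n a (z : (barObj (n + 1) P).A a), ((barObjMap (n + 1) f).f a).hom z ∈
      Set.range ((barAct P' (SimplexCategory.σ (0 : Fin (n + 1)))).f a).hom →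
      z ∈ Set.range ((barAct P (SimplexCategory.σ (0 : Fin (n + 1)))).f a).hom := by
    intro n a z hz
    rw [barAct_σ_zero_f] at hz ⊢
    exact IoSeq.mem_range_gMap (IoSeq.mem_range_gUnit (levMap n f).f) a z hz
  induction n generalizing a with
  | zero =>
    obtain rfl : j = 0 := Subsingleton.elim (α := Fin 1) _ _
    exact h0 _ _ _ hz
  | succ n ih =>
    cases j using Fin.cases with
    | zero => exact h0 _ _ _ hz
    | succ j =>
      rw [barAct_σ_succ_f] at hz ⊢
      exact IoSeq.mem_range_gMap (fun b y hy => ih j b y hy) a z hz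

end levels

end IoProperad

namespace IoProperad

/-! ### Boundary values of maps out of the bar construction -/

section boundary

variable {P P' Y : IoProperad.{u}} {l m n : ℕ} {a : Arity}

/-- The topological simplex. -/
abbrev simplex (n : ℕ) : Type := stdSimplex ℝ (Fin (n + 1))

/-- Functoriality of the topological simplex. -/
noncomputable abbrev simplexMap (θ : ⦋m⦌ ⟶ ⦋n⦌) : simplex m → simplex n :=
  stdSimplex.map θ.toOrderHom

theorem simplexMap_comp (θ : ⦋l⦌ ⟶ ⦋m⦌) (η : ⦋m⦌ ⟶ ⦋n⦌) (t : simplex l) :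
    simplexMap η (simplexMap θ t) = simplexMap (θ ≫ η) t := stdSimplex_map_map θ η t

/-- Compatibility of maps out of the simplices of two dimensions. -/
def Compat (φ : simplex l → (barObj l P ⟶ Y)) (ψ : simplex m → (barObj m P ⟶ Y)) : Prop :=
  ∀ (θ : ⦋l⦌ ⟶ ⦋m⦌) (t : simplex l), barAct P θ ≫ φ t = ψ (simplexMap θ t)

theorem Compat.apply {φ : simplex l → (barObj l P ⟶ Y)} {ψ : simplex m → (barObj m P ⟶ Y)}
    (h : Compat φ ψ) (θ : ⦋l⦌ ⟶ ⦋m⦌) (t : simplex l) (z : (barObj m P).A a) :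
    ((φ t).f a).hom (((barAct P θ).f a).hom z) = ((ψ (simplexMap θ t)).f a).hom z :=
  congrArg (fun g : barObj m P ⟶ Y => (g.f a).hom z) (h θ t)

/-- The degenerate generators. -/
def degen (n : ℕ) (P : IoProperad.{u}) (a : Arity) : Set ((lev n P).A a) :=
  {x | ∃ m, m < n ∧ ∃ (θ : ⦋n⦌ ⟶ ⦋m⦌) (w : (barObj m P).A a),
    ((barAct P θ).f a).hom w = barGen n x}

theorem mem_degen_succ {x : (lev (n + 1) P).A a} :
    x ∈ degen (n + 1) P a ↔ ∃ j : Fin (n + 1),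
      barGen (n + 1) x ∈ Set.range ((barAct P (SimplexCategory.σ j)).f a).hom := by
  constructor
  · rintro ⟨m, hm, θ, w, hw⟩
    obtain ⟨j, θ', rfl⟩ := SimplexCategory.eq_σ_comp_of_not_injective θ
      (SimplexCategory.not_injective_of_lt hm θ)
    exact ⟨j, ((barAct P θ').f a).hom w, (barAct_comp_apply _ _ _).trans hw⟩
  · rintro ⟨j, w, hw⟩
    exact ⟨n, n.lt_succ_self, _, w, hw⟩

theorem isClopen_degen (n : ℕ) (P : IoProperad.{u}) (a : Arity) : IsClopen (degen n P a) := by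
  cases n with
  | zero =>
    convert isClopen_empty
    ext x
    exact ⟨fun ⟨m, hm, _⟩ => absurd hm m.not_lt_zero, False.elim⟩
  | succ n =>
    have : degen (n + 1) P a = ⋃ j : Fin (n + 1),
        (fun x => barGen (n + 1) x) ⁻¹' Set.range ((barAct P (SimplexCategory.σ j)).f a).hom := by
      ext x
      rw [mem_degen_succ, Set.mem_iUnion]
      rfl
    rw [this]
    exact isClopen_iUnion_of_finite fun j =>
      (isClopen_range_barAct_σ P n j a).preimage (continuous_barGen _ _ _)

theorem levMap_mem_degen (f : P ⟶ P') {x : (lev n P).A a} :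
    ((levMap n f).f a).hom x ∈ degen n P' a ↔ x ∈ degen n P a := by
  constructor
  · intro h
    cases n with
    | zero => exact absurd h.choose_spec.1 (Nat.not_lt_zero _)
    | succ n =>
      rw [mem_degen_succ] at h ⊢
      obtain ⟨j, hj⟩ := h
      rw [← barObjMap_barGen] at hj
      exact ⟨j, mem_range_barAct_σ f n j a _ hj⟩
  · rintro ⟨m, hm, θ, w, hw⟩
    exact ⟨m, hm, θ, ((barObjMap m f).f a).hom w, by
      rw [barAct_naturality_apply, hw, barObjMap_barGen]⟩

/-- The pairs of a generator and a point of the simplex at which a map is determined by its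
restriction to lower dimensional simplices. -/
def OnBoundary (x : (lev n P).A a) (t : simplex n) : Prop := (∃ i, t i = 0) ∨ x ∈ degen n P a

/-- The value at such a pair prescribed by maps in lower dimensions. -/
def IsBoundaryValue (h : ∀ m, m < n → simplex m → (barObj m P ⟶ Y)) (x : (lev n P).A a)
    (t : simplex n) (y : Y.A a) : Prop :=
  (∀ m (hm : m < n) (θ : ⦋m⦌ ⟶ ⦋n⦌) (s : simplex m), simplexMap θ s = t →
    y = ((h m hm s).f a).hom (((barAct P θ).f a).hom (barGen n x))) ∧
  ∀ m (hm : m < n) (θ : ⦋n⦌ ⟶ ⦋m⦌) (w : (barObj m P).A a),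
    ((barAct P θ).f a).hom w = barGen n x → y = ((h m hm (simplexMap θ t)).f a).hom w

theorem exists_face {t : simplex (n + 1)} {i : Fin (n + 2)} (ht : t i = 0) :
    ∃ s : simplex n, simplexMap (SimplexCategory.δ i) s = t := by
  obtain ⟨σ, hσ⟩ := exists_retraction_δ i
  exact ⟨_, stdSimplex_map_face hσ ht⟩

theorem simplexMap_δ_injective (i : Fin (n + 2)) :
    Function.Injective (simplexMap (SimplexCategory.δ i)) := by
  obtain ⟨σ, hσ⟩ := exists_retraction_δ i
  refine Function.LeftInverse.injective (g := simplexMap σ) fun s => ?_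
  rw [simplexMap_comp, hσ]
  exact stdSimplex.map_id_apply s

theorem simplex_zero_ne (t : simplex 0) (i : Fin 1) : t i ≠ 0 := by
  have h : ∑ i : Fin 1, t i = 1 := t.2.2
  rw [Fin.sum_univ_one] at h
  obtain rfl : i = 0 := Subsingleton.elim _ _
  rw [h]
  exact one_ne_zero

theorem barAct_δ_σ (j : Fin (n + 1)) (w : (barObj n P).A a) :
    ((barAct P (SimplexCategory.δ j.castSucc)).f a).hom
      (((barAct P (SimplexCategory.σ j)).f a).hom w) = w := by
  rw [barAct_comp_apply, SimplexCategory.δ_comp_σ_self, barAct_id]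
  rfl

theorem IsBoundaryValue.unique {h : ∀ m, m < n → simplex m → (barObj m P ⟶ Y)}
    {x : (lev n P).A a} {t : simplex n} (hxt : OnBoundary x t) {y y' : Y.A a}
    (hy : IsBoundaryValue h x t y) (hy' : IsBoundaryValue h x t y') : y = y' := by
  rcases hxt with ⟨i, hi⟩ | ⟨m, hm, θ, w, hw⟩
  · cases n with
    | zero => exact absurd hi (simplex_zero_ne t i)
    | succ n =>
      obtain ⟨s, hs⟩ := exists_face hi
      exact (hy.1 n n.lt_succ_self _ s hs).trans (hy'.1 n n.lt_succ_self _ s hs).symm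
  · exact (hy.2 m hm θ w hw).trans (hy'.2 m hm θ w hw).symm

theorem IsBoundaryValue.map {h : ∀ m, m < n → simplex m → (barObj m P ⟶ Y)}
    {h' : ∀ m, m < n → simplex m → (barObj m P' ⟶ Y)} {f : P ⟶ P'}
    (hf : ∀ m hm s, barObjMap m f ≫ h' m hm s = h m hm s)
    {x : (lev n P).A a} {t : simplex n} {y : Y.A a}
    (hy : IsBoundaryValue h' (((levMap n f).f a).hom x) t y) : IsBoundaryValue h x t y := by
  refine ⟨fun m hm θ s hs => ?_, fun m hm θ w hw => ?_⟩
  · rw [hy.1 m hm θ s hs, ← hf, ← barObjMap_barGen, barAct_naturality_apply]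
    rfl
  · rw [hy.2 m hm θ (((barObjMap m f).f a).hom w), ← hf]
    · rfl
    · rw [barAct_naturality_apply, hw, barObjMap_barGen]

theorem IsBoundaryValue.congr {h h' : ∀ m, m < n → simplex m → (barObj m P ⟶ Y)}
    (hh : ∀ m hm s, h m hm s = h' m hm s) {x : (lev n P).A a} {t : simplex n} {y : Y.A a}
    (hy : IsBoundaryValue h x t y) : IsBoundaryValue h' x t y := by
  obtain rfl : h = h' := funext fun m => funext fun hm => funext fun s => hh m hm s
  exact hy

theorem onBoundary_levMap (f : P ⟶ P') {x : (lev n P).A a} {t : simplex n} :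
    OnBoundary (((levMap n f).f a).hom x) t ↔ OnBoundary x t :=
  or_congr Iff.rfl (levMap_mem_degen f)

theorem isBoundaryValue_of_compat {h : ∀ m, m < n → simplex m → (barObj m P ⟶ Y)}
    {d : simplex n → (barObj n P ⟶ Y)} (hd : ∀ m hm, Compat (h m hm) d)
    (hd' : ∀ m hm, Compat d (h m hm)) (x : (lev n P).A a) (t : simplex n) :
    IsBoundaryValue h x t (((d t).f a).hom (barGen n x)) := by
  refine ⟨fun m hm θ s hs => ?_, fun m hm θ w hw => ?_⟩
  · rw [(hd m hm).apply, hs]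
  · rw [← hw, (hd' m hm).apply]

section succ

variable {h : ∀ m, m < n + 1 → simplex m → (barObj m P ⟶ Y)}
  (hc : ∀ l hl m hm, Compat (h l hl) (h m hm))

include hc

theorem isBoundaryValue_of_elementary {x : (lev (n + 1) P).A a} {t : simplex (n + 1)} {y : Y.A a}
    (h1 : ∀ i s, simplexMap (SimplexCategory.δ i) s = t → y = ((h n n.lt_succ_self s).f a).hom
      (((barAct P (SimplexCategory.δ i)).f a).hom (barGen (n + 1) x)))
    (h2 : ∀ j w, ((barAct P (SimplexCategory.σ j)).f a).hom w = barGen (n + 1) x →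
      y = ((h n n.lt_succ_self (simplexMap (SimplexCategory.σ j) t)).f a).hom w) :
    IsBoundaryValue h x t y := by
  refine ⟨fun m hm θ s hs => ?_, fun m hm θ w hw => ?_⟩
  · obtain ⟨i, θ', rfl⟩ := SimplexCategory.eq_comp_δ_of_not_surjective θ
      (SimplexCategory.not_surjective_of_lt hm θ)
    rw [h1 i (simplexMap θ' s) ((simplexMap_comp _ _ _).trans hs), ← barAct_comp_apply,
      (hc m hm n n.lt_succ_self).apply]
  · obtain ⟨j, θ', rfl⟩ := SimplexCategory.eq_σ_comp_of_not_injective θ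
      (SimplexCategory.not_injective_of_lt hm θ)
    rw [h2 j (((barAct P θ').f a).hom w) ((barAct_comp_apply _ _ _).trans hw),
      (hc n n.lt_succ_self m hm).apply]
    exact congrArg (fun s => ((h m hm s).f a).hom w) (simplexMap_comp _ _ _)

theorem face_face_value (x : (lev (n + 1) P).A a) {i j : Fin (n + 2)} {s s' : simplex n}
    (hs : simplexMap (SimplexCategory.δ i) s = simplexMap (SimplexCategory.δ j) s') :
    ((h n n.lt_succ_self s).f a).hom
      (((barAct P (SimplexCategory.δ i)).f a).hom (barGen (n + 1) x)) =
    ((h n n.lt_succ_self s').f a).hom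
      (((barAct P (SimplexCategory.δ j)).f a).hom (barGen (n + 1) x)) := by
  wlog hij : i < j generalizing i j s s'
  · rcases (not_lt.1 hij).lt_or_eq with hij | rfl
    · exact (this hs.symm hij).symm
    · rw [simplexMap_δ_injective _ hs]
  have hj : simplexMap (SimplexCategory.δ i) s j = 0 := by
    rw [hs]
    exact stdSimplex_map_eq_zero (θ := SimplexCategory.δ j) (fun x => Fin.succAbove_ne j x) s'
  obtain ⟨j, rfl⟩ := Fin.exists_succ_eq.2 (Fin.ne_zero_of_lt hij)
  obtain ⟨i, rfl⟩ := Fin.exists_castSucc_eq.2 (Fin.ne_last_of_lt hij)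
  have hij' : i ≤ j := Fin.castSucc_lt_succ_iff.1 hij
  rw [← Fin.succAbove_castSucc_of_le i j hij'] at hj
  have hj' : s j = 0 := (stdSimplex_map_δ_apply _ s j).symm.trans hj
  cases n with
  | zero => exact absurd hj' (simplex_zero_ne s j)
  | succ n =>
    obtain ⟨r, rfl⟩ := exists_face hj'
    obtain rfl : simplexMap (SimplexCategory.δ i) r = s' := by
      refine simplexMap_δ_injective j.succ (.trans ?_ hs)
      rw [simplexMap_comp, simplexMap_comp, SimplexCategory.δ_comp_δ hij']
    have hn : n < n + 1 + 1 := by omega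
    rw [← (hc n hn (n + 1) (n + 1).lt_succ_self).apply,
      ← (hc n hn (n + 1) (n + 1).lt_succ_self).apply, barAct_comp_apply, barAct_comp_apply,
      SimplexCategory.δ_comp_δ hij']

theorem face_degen_value (x : (lev (n + 1) P).A a) (i : Fin (n + 2)) (s : simplex n)
    {j : Fin (n + 1)} {w : (barObj n P).A a}
    (hw : ((barAct P (SimplexCategory.σ j)).f a).hom w = barGen (n + 1) x) :
    ((h n n.lt_succ_self s).f a).hom
      (((barAct P (SimplexCategory.δ i)).f a).hom (barGen (n + 1) x)) =
    ((h n n.lt_succ_self (simplexMap (SimplexCategory.σ j)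
      (simplexMap (SimplexCategory.δ i) s))).f a).hom w := by
  rw [← hw, barAct_comp_apply, (hc n n.lt_succ_self n n.lt_succ_self).apply, simplexMap_comp]

theorem degen_degen_value (t : simplex (n + 1)) {i j : Fin (n + 1)} {w w' : (barObj n P).A a}
    (hw : ((barAct P (SimplexCategory.σ i)).f a).hom w =
      ((barAct P (SimplexCategory.σ j)).f a).hom w') :
    ((h n n.lt_succ_self (simplexMap (SimplexCategory.σ i) t)).f a).hom w =
      ((h n n.lt_succ_self (simplexMap (SimplexCategory.σ j) t)).f a).hom w' := by
  wlog hij : i < j generalizing i j w w'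
  · rcases (not_lt.1 hij).lt_or_eq with hij | rfl
    · exact (this hw.symm hij).symm
    · rw [← barAct_δ_σ j w, hw, barAct_δ_σ]
  cases n with
  | zero => exact absurd hij (by omega)
  | succ n =>
    obtain ⟨j, rfl⟩ := Fin.exists_succ_eq.2 (Fin.ne_zero_of_lt hij)
    obtain ⟨i, rfl⟩ := Fin.exists_castSucc_eq.2 (Fin.ne_last_of_lt hij)
    have hij' : i ≤ j := Fin.castSucc_lt_succ_iff.1 hij
    obtain ⟨W, rfl⟩ : ∃ W, ((barAct P (SimplexCategory.σ j)).f a).hom W = w := by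
      refine ⟨((barAct P (SimplexCategory.δ i.castSucc)).f a).hom w', ?_⟩
      rw [barAct_comp_apply, ← SimplexCategory.δ_comp_σ_of_le (Fin.castSucc_le_castSucc_iff.2 hij'),
        ← barAct_comp_apply, ← hw, barAct_δ_σ]
    obtain rfl : ((barAct P (SimplexCategory.σ i)).f a).hom W = w' := by
      have hW : ((barAct P (SimplexCategory.σ j.succ)).f a).hom
          (((barAct P (SimplexCategory.σ i)).f a).hom W) =
          ((barAct P (SimplexCategory.σ j.succ)).f a).hom w' := by
        rw [← hw, barAct_comp_apply, barAct_comp_apply, SimplexCategory.σ_comp_σ hij']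
      rw [← barAct_δ_σ j.succ w', ← hW, barAct_δ_σ]
    have hn : n < n + 1 + 1 := by omega
    rw [(hc (n + 1) (n + 1).lt_succ_self n hn).apply, (hc (n + 1) (n + 1).lt_succ_self n hn).apply,
      simplexMap_comp, simplexMap_comp, SimplexCategory.σ_comp_σ hij']

end succ

theorem exists_isBoundaryValue {h : ∀ m, m < n → simplex m → (barObj m P ⟶ Y)}
    (hc : ∀ l hl m hm, Compat (h l hl) (h m hm)) {x : (lev n P).A a} {t : simplex n}
    (hxt : OnBoundary x t) : ∃ y, IsBoundaryValue h x t y := by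
  cases n with
  | zero =>
    rcases hxt with ⟨i, hi⟩ | ⟨m, hm, _⟩
    · exact absurd hi (simplex_zero_ne t i)
    · exact absurd hm m.not_lt_zero
  | succ n =>
    rcases hxt with ⟨i, hi⟩ | hx
    · obtain ⟨s, rfl⟩ := exists_face hi
      exact ⟨_, isBoundaryValue_of_elementary hc
        (fun j s' hs => face_face_value hc x hs.symm)
        fun j w hw => face_degen_value hc x i s hw⟩
    · obtain ⟨j, w, hw⟩ := mem_degen_succ.1 hx
      refine ⟨_, isBoundaryValue_of_elementary hc
        (fun i s hs => ?_) fun i w' hw' => degen_degen_value hc t (hw.trans hw'.symm)⟩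
      obtain rfl := hs
      exact (face_degen_value hc x i s hw).symm

/-- A map with the prescribed boundary values is compatible with the maps in lower dimensions. -/
theorem compat_of_isBoundaryValue {h : ∀ m, m < n → simplex m → (barObj m P ⟶ Y)}
    (hc : ∀ l hl m hm, Compat (h l hl) (h m hm)) {d : simplex n → (barObj n P ⟶ Y)}
    (hd : ∀ a (x : (lev n P).A a) t, OnBoundary x t →
      IsBoundaryValue h x t (((d t).f a).hom (barGen n x))) :
    (∀ m hm, Compat (h m hm) d) ∧ (∀ m hm, Compat d (h m hm)) ∧ Compat d d := by
  have h1 : ∀ m hm, Compat (h m hm) d := by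
    intro m hm θ t
    refine bar_hom_ext fun a x => ?_
    refine (((hd a x _ (.inl ?_)).1 m hm θ t rfl)).symm
    obtain ⟨i, hi⟩ := not_forall.1 (SimplexCategory.not_surjective_of_lt hm θ)
    exact ⟨i, stdSimplex_map_eq_zero (not_exists.1 hi) t⟩
  have h2 : ∀ m hm, Compat d (h m hm) := by
    intro m hm θ t
    cases n with
    | zero => exact absurd hm m.not_lt_zero
    | succ n =>
      obtain ⟨j, θ', rfl⟩ := SimplexCategory.eq_σ_comp_of_not_injective θ
        (SimplexCategory.not_injective_of_lt hm θ)
      have hσ : barAct P (SimplexCategory.σ j) ≫ d t =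
          h n n.lt_succ_self (simplexMap (SimplexCategory.σ j) t) := by
        refine bar_hom_ext fun a y => ?_
        obtain ⟨x, hx⟩ := barAct_σ_barGen j y
        refine (congrArg ((d t).f a).hom hx).trans ?_
        exact (hd a x t (.inr ⟨n, n.lt_succ_self, _, _, hx⟩)).2 n n.lt_succ_self _ _ hx
      rw [barAct_comp, Category.assoc, hσ, hc n n.lt_succ_self m hm]
      exact congrArg (h m hm) (simplexMap_comp _ _ _)
  refine ⟨h1, h2, fun θ t => ?_⟩
  by_cases hθ : Function.Surjective θ.toOrderHom
  · have := SimplexCategory.epi_iff_surjective.2 hθ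
    obtain rfl := SimplexCategory.eq_id_of_epi θ
    rw [barAct_id, Category.id_comp]
    exact congrArg d (stdSimplex.map_id_apply t).symm
  · cases n with
    | zero => exact absurd (fun x => ⟨x, Subsingleton.elim (α := Fin 1) _ _⟩) hθ
    | succ n =>
      obtain ⟨i, θ', rfl⟩ := SimplexCategory.eq_comp_δ_of_not_surjective θ hθ
      rw [barAct_comp, Category.assoc, h2 n n.lt_succ_self, h1 n n.lt_succ_self]
      exact congrArg d (simplexMap_comp _ _ _)

/-- Boundary values depend continuously on the parameters. -/
theorem continuous_boundaryValue {K : Type} [TopologicalSpace K]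
    (φ : ∀ m, m < n → Family (barObj m P) (simplex m × K) Y)
    {β : {p : (lev n P).A a × (simplex n × K) // OnBoundary p.1 p.2.1} → Y.A a}
    (hβ : ∀ p, IsBoundaryValue (fun m hm s => (φ m hm).hom (s, p.1.2.2)) p.1.1 p.1.2.1 (β p)) :
    Continuous β := by
  cases n with
  | zero =>
    refine continuous_iff_continuousAt.2 ?_
    rintro ⟨p, ⟨i, hi⟩ | ⟨m, hm, _⟩⟩
    · exact absurd hi (simplex_zero_ne _ i)
    · exact absurd hm m.not_lt_zero
  | succ n =>
    let D := {p : (lev (n + 1) P).A a × (simplex (n + 1) × K) // OnBoundary p.1 p.2.1}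
    let C : Fin (n + 2) ⊕ Fin (n + 1) → Set D :=
      Sum.elim (fun i => {p | p.1.2.1 i = 0}) fun j => {p | barGen (n + 1) p.1.1 ∈
        Set.range ((barAct P (SimplexCategory.σ j)).f a).hom}
    have hC : ⋃ i, C i = Set.univ := by
      ext ⟨p, hp⟩
      rw [Set.mem_iUnion, Sum.exists]
      exact ⟨fun _ => trivial, fun _ => hp.imp id mem_degen_succ.1⟩
    have hval : ∀ (δ : ⦋n⦌ ⟶ ⦋n + 1⦌) (σ : ⦋n + 1⦌ ⟶ ⦋n⦌), Continuous fun p : D =>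
          (((φ n n.lt_succ_self).hom (simplexMap σ p.1.2.1, p.1.2.2)).f a).hom
            (((barAct P δ).f a).hom (barGen (n + 1) p.1.1)) :=
      fun δ σ => ((φ n n.lt_succ_self).continuous a).comp
        ((((barAct P δ).f a).hom.continuous.comp ((continuous_barGen _ _ _).comp
          (continuous_fst.comp continuous_subtype_val))).prodMk
          (((stdSimplex.continuous_map _).comp (continuous_fst.comp (continuous_snd.comp
            continuous_subtype_val))).prodMk
            (continuous_snd.comp (continuous_snd.comp continuous_subtype_val))))
    refine (locallyFinite_of_finite C).continuous hC ?_ ?_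
    · rintro (i | j)
      · exact isClosed_eq ((continuous_apply i).comp (continuous_subtype_val.comp
          (continuous_fst.comp (continuous_snd.comp continuous_subtype_val)))) continuous_const
      · exact (isClopen_range_barAct_σ P n j a).1.preimage
          ((continuous_barGen _ _ _).comp (continuous_fst.comp continuous_subtype_val))
    · rintro (i | j)
      · obtain ⟨σ, hσ⟩ := exists_retraction_δ i
        refine (hval (SimplexCategory.δ i) σ).continuousOn.congr fun p hp => ?_
        exact (hβ p).1 n n.lt_succ_self _ _ (stdSimplex_map_face hσ hp)
      · refine (hval (SimplexCategory.δ j.castSucc) (SimplexCategory.σ j)).continuousOn.congr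
          fun p hp => ?_
        obtain ⟨w, hw⟩ := hp
        refine ((hβ p).2 n n.lt_succ_self _ w hw).trans ?_
        have hw' : ((barAct P (SimplexCategory.δ j.castSucc)).f a).hom (barGen (n + 1) p.1.1) =
            w := by
          rw [← hw, barAct_δ_σ]
        exact congrArg _ hw'.symm

theorem isClosed_simplex_boundary (n : ℕ) : IsClosed ({t | ∃ i, t i = 0} : Set (simplex n)) := by
  rw [Set.ofPred_exists]
  exact isClosed_iUnion_of_finite fun i =>
    isClosed_eq ((continuous_apply i).comp continuous_subtype_val) continuous_const

theorem isClosed_onBoundary (n : ℕ) (P : IoProperad.{u}) (a : Arity) (K : Type)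
    [TopologicalSpace K] : IsClosed
      ({p | OnBoundary p.1 p.2.1} : Set ((lev n P).A a × (simplex n × K))) := by
  exact ((isClosed_simplex_boundary n).preimage (continuous_fst.comp continuous_snd)).union
    ((isClopen_degen n P a).1.preimage continuous_fst)

/-- Boundary values together with values prescribed over a closed set of parameters. -/
theorem exists_boundaryValue {K : Type} [TopologicalSpace K] {L : Set K} (hL : IsClosed L)
    (φ : ∀ m, m < n → Family (barObj m P) (simplex m × K) Y)
    (hφ : ∀ k l hl m hm, Compat (fun s => (φ l hl).hom (s, k)) (fun s => (φ m hm).hom (s, k)))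
    (ω : C({p : (lev n P).A a × (simplex n × K) // p.2.2 ∈ L}, Y.A a))
    (hω : ∀ p, OnBoundary p.1.1 p.1.2.1 →
      IsBoundaryValue (fun m hm s => (φ m hm).hom (s, p.1.2.2)) p.1.1 p.1.2.1 (ω p)) :
    ∃ β : C({p : (lev n P).A a × (simplex n × K) // OnBoundary p.1 p.2.1 ∨ p.2.2 ∈ L}, Y.A a),
      (∀ p, OnBoundary p.1.1 p.1.2.1 →
        IsBoundaryValue (fun m hm s => (φ m hm).hom (s, p.1.2.2)) p.1.1 p.1.2.1 (β p)) ∧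
      ∀ p (hp : p.1.2.2 ∈ L), β p = ω ⟨p.1, hp⟩ := by
  choose β hβ using fun p : {p : (lev n P).A a × (simplex n × K) // OnBoundary p.1 p.2.1} =>
    exists_isBoundaryValue (hφ p.1.2.2) p.2
  have hc := continuous_boundaryValue φ hβ
  let D := {p : (lev n P).A a × (simplex n × K) // OnBoundary p.1 p.2.1 ∨ p.2.2 ∈ L}
  obtain ⟨F, hF1, hF2⟩ := exists_glue (W := D) (s := {p | OnBoundary p.1.1 p.1.2.1})
    (t := {p | p.1.2.2 ∈ L}) ((isClosed_onBoundary n P a K).preimage continuous_subtype_val)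
    (hL.preimage (continuous_snd.comp (continuous_snd.comp continuous_subtype_val)))
    (fun p => p.2)
    ⟨fun p => β ⟨p.1.1, p.2⟩, hc.comp ((continuous_subtype_val.comp continuous_subtype_val).subtype_mk
      fun p => p.2)⟩
    ⟨fun p => ω ⟨p.1.1, p.2⟩, ω.continuous.comp
      ((continuous_subtype_val.comp continuous_subtype_val).subtype_mk fun p => p.2)⟩
    fun p h1 h2 => (hβ ⟨p.1, h1⟩).unique h1 (hω ⟨p.1, h2⟩ h1)
  refine ⟨F, fun p hp => ?_, fun p hp => hF2 p hp⟩
  rw [hF1 p hp]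
  exact hβ ⟨p.1, hp⟩

/-- A map on generators is changed at the degenerate ones to have the given boundary values. -/
theorem exists_extend_boundaryValue {K : Type} [TopologicalSpace K] {L : Set K}
    (β : C({p : (lev n P).A a × (simplex n × K) // OnBoundary p.1 p.2.1 ∨ p.2.2 ∈ L}, Y.A a))
    (F : C((lev n P).A a × (simplex n × K), Y.A a))
    (hF : ∀ p (hp : (∃ i, p.2.1 i = 0) ∨ p.2.2 ∈ L), F p = β ⟨p, hp.imp .inl id⟩) :
    ∃ F' : C((lev n P).A a × (simplex n × K), Y.A a), (∀ p, F' p.1 = β p) ∧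
      ∀ p, p.1 ∉ degen n P a → F' p = F p := by
  have hd := (isClopen_degen n P a).preimage
    (continuous_fst (X := (lev n P).A a) (Y := simplex n × K))
  obtain ⟨F', h1, h2⟩ := exists_glue hd.1 hd.compl.1 (fun p => em _)
    ⟨fun p => β ⟨p.1, .inl (.inr p.2)⟩, β.continuous.comp
      (continuous_subtype_val.subtype_mk fun p => .inl (.inr p.2))⟩
    ⟨fun p => F p.1, F.continuous.comp continuous_subtype_val⟩
    fun p h1 h2 => absurd h1 h2
  refine ⟨F', fun p => ?_, fun p hp => h2 p hp⟩
  by_cases hp : p.1.1 ∈ degen n P a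
  · exact h1 p.1 hp
  · exact (h2 p.1 hp).trans (hF p.1 (p.2.imp (fun h => h.resolve_right hp) id))

end boundary

end IoProperad

/-- Dependent choice along the natural numbers. -/
theorem exists_seq_of_extend {D : ℕ → Type*} (C : ∀ n, (∀ m, m < n → D m) → D n → Prop)
    (h : ∀ n (f : ∀ m, m < n → D m),
      (∀ m hm, C m (fun k hk => f k (hk.trans hm)) (f m hm)) → ∃ d, C n f d) :
    ∃ f : ∀ n, D n, ∀ n, C n (fun m _ => f m) (f n) := by
  classical
  let Pre : ℕ → Type _ := fun n =>
    {f : ∀ m, m < n → D m // ∀ m hm, C m (fun k hk => f k (hk.trans hm)) (f m hm)}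
  choose next hnext using fun (n : ℕ) (p : Pre n) => h n p.1 p.2
  have step : ∀ n (p : Pre n), ∃ q : Pre (n + 1),
      (∀ m hm, q.1 m (hm.trans n.lt_succ_self) = p.1 m hm) ∧
      q.1 n n.lt_succ_self = next n p := by
    intro n p
    let g : ∀ m, m < n + 1 → D m := fun m hm =>
      if h : m < n then p.1 m h else (show n = m by omega) ▸ next n p
    have g1 : ∀ m (hm : m < n) hm', g m hm' = p.1 m hm := fun m hm hm' => dif_pos hm
    have g2 : g n n.lt_succ_self = next n p := dif_neg (lt_irrefl n)
    refine ⟨⟨g, fun m hm => ?_⟩, fun m hm => g1 m hm (hm.trans n.lt_succ_self), g2⟩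
    rcases Nat.lt_succ_iff_lt_or_eq.1 hm with hm' | rfl
    · have hg : (fun k hk => g k (hk.trans hm)) = fun k (hk : k < m) => p.1 k (hk.trans hm') :=
        funext fun k => funext fun hk => g1 k (hk.trans hm') (hk.trans hm)
      rw [hg, g1 m hm' hm]
      exact p.2 m hm'
    · have hg : (fun k hk => g k (hk.trans hm)) = p.1 :=
        funext fun k => funext fun hk => g1 k hk (hk.trans hm)
      rw [hg]
      exact g2 ▸ hnext m p
  choose succ hs1 hs2 using step
  let pre : ∀ n, Pre n := fun n => Nat.rec ⟨fun m hm => absurd hm m.not_lt_zero,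
    fun m hm => absurd hm m.not_lt_zero⟩ (fun n p => succ n p) n
  have hpre : ∀ n m (hm : m < n), (pre n).1 m hm = next m (pre m) := by
    intro n
    induction n with
    | zero => exact fun m hm => absurd hm m.not_lt_zero
    | succ n ih =>
      intro m hm
      rcases Nat.lt_succ_iff_lt_or_eq.1 hm with hm' | rfl
      · exact (hs1 n (pre n) m hm').trans (ih m hm')
      · exact hs2 m (pre m)
  refine ⟨fun n => next n (pre n), fun n => ?_⟩
  have hn := hnext n (pre n)
  have : (fun m (_ : m < n) => next m (pre m)) = (pre n).1 :=
    funext fun m => funext fun hm => (hpre n m hm).symm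
  rwa [this]

namespace IoProperad

/-! ### Extension of families of maps out of the bar construction -/

section extension

variable {P P' R R' Y : IoProperad.{u}} {n : ℕ} {a : Arity} {K : Type} [TopologicalSpace K]

/-- Continuous families of compatible maps out of the simplices of the bar construction. -/
structure Sys (P : IoProperad.{u}) (K : Type) [TopologicalSpace K] (Y : IoProperad.{u}) where
  fam : ∀ n, Family (barObj n P) (simplex n × K) Y
  compat : ∀ k l m, Compat (fun t => (fam l).hom (t, k)) (fun t => (fam m).hom (t, k))

/-- The values of a family on the generators. -/
noncomputable def barVal {T : Type} [TopologicalSpace T] (φ : Family (barObj n P) T Y) (a : Arity) :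
    C((lev n P).A a × T, Y.A a) := Family.gen (X := lev n P) φ a

theorem Sys.isBoundaryValue (U : Sys P K Y) (x : (lev n P).A a) (t : simplex n) (k : K) :
    IsBoundaryValue (fun m (_ : m < n) s => (U.fam m).hom (s, k)) x t
      (barVal (U.fam n) a (x, (t, k))) :=
  isBoundaryValue_of_compat (d := fun t => (U.fam n).hom (t, k)) (fun m _ => U.compat k m n)
    (fun m _ => U.compat k n m) x t

theorem barVal_map {T T' : Type} [TopologicalSpace T] [TopologicalSpace T']
    {φ : Family (barObj n P) T Y} {φ' : Family (barObj n P') T' Y} {f : P ⟶ P'} {τ : T} {τ' : T'}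
    (h : barObjMap n f ≫ φ'.hom τ' = φ.hom τ) (x : (lev n P).A a) :
    barVal φ' a (((levMap n f).f a).hom x, τ') = barVal φ a (x, τ) := by
  refine .trans ?_ (congrArg (fun g : barObj n P ⟶ Y => (g.f a).hom (barGen n x)) h)
  exact congrArg ((φ'.hom τ').f a).hom (barObjMap_barGen f x).symm

/-- The data of an extension problem: families of maps given on `B P`, and over a closed set of
parameters or on the subobjects on `B P'`, and homotopies between them. -/
structure ExtensionProblem (P P' R R' Y : IoProperad.{u}) (K : Type) [TopologicalSpace K] where
  p : P ⟶ P'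
  r : R ⟶ R'
  i : R ⟶ P
  i' : R' ⟶ P'
  comm : i ≫ p = r ≫ i'
  hp : ∀ a, _root_.IsHomotopyEquiv (p.f a).hom
  hr : ∀ a, _root_.IsHomotopyEquiv (r.f a).hom
  hi : ∀ a, IsClosedEmbedding (i.f a).hom
  hi' : ∀ a, IsClosedEmbedding (i'.f a).hom
  iNDR : ∀ a, IsNDR (Set.range (i.f a).hom)
  iNDR' : ∀ a, IsNDR (Set.range (i'.f a).hom)
  L : Set K
  closed : IsClosed L
  ndr : IsNDR L
  u : Sys P K Y
  v' : Sys R' K Y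
  v : Sys R (K × I) Y
  w' : Sys P' L Y
  w : Sys P (L × I) Y
  v_zero : ∀ n t k, barObjMap n i ≫ (u.fam n).hom (t, k) = (v.fam n).hom (t, (k, 0))
  v_one : ∀ n t k, barObjMap n r ≫ (v'.fam n).hom (t, k) = (v.fam n).hom (t, (k, 1))
  w_zero : ∀ n t (k : L), (u.fam n).hom (t, k.1) = (w.fam n).hom (t, (k, 0))
  w_one : ∀ n t k, barObjMap n p ≫ (w'.fam n).hom (t, k) = (w.fam n).hom (t, (k, 1))
  w'_i' : ∀ n t (k : L), barObjMap n i' ≫ (w'.fam n).hom (t, k) = (v'.fam n).hom (t, k.1)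
  w_i : ∀ n t (k : L) s, barObjMap n i ≫ (w.fam n).hom (t, (k, s)) = (v.fam n).hom (t, (k.1, s))

/-- Solutions of an extension problem in one dimension. -/
structure ExtensionProblem.Solves (E : ExtensionProblem P P' R R' Y K) (n : ℕ)
    (φ : Family (barObj n P') (simplex n × K) Y)
    (H : Family (barObj n P) (simplex n × (K × I)) Y) : Prop where
  zero : ∀ t k, (E.u.fam n).hom (t, k) = H.hom (t, (k, 0))
  one : ∀ t k, barObjMap n E.p ≫ φ.hom (t, k) = H.hom (t, (k, 1))
  restr' : ∀ t k, barObjMap n E.i' ≫ φ.hom (t, k) = (E.v'.fam n).hom (t, k)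
  restr : ∀ t k, barObjMap n E.i ≫ H.hom (t, k) = (E.v.fam n).hom (t, k)
  param' : ∀ t (k : E.L), φ.hom (t, k.1) = (E.w'.fam n).hom (t, k)
  param : ∀ t (k : E.L) s, H.hom (t, (k.1, s)) = (E.w.fam n).hom (t, (k, s))

theorem ExtensionProblem.exists_arity [CompactSpace K] [T2Space K]
    (E : ExtensionProblem P P' R R' Y K)
    (φ : ∀ m, m < n → Family (barObj m P') (simplex m × K) Y)
    (H : ∀ m, m < n → Family (barObj m P) (simplex m × (K × I)) Y)
    (hφ : ∀ k l hl m hm, Compat (fun s => (φ l hl).hom (s, k)) (fun s => (φ m hm).hom (s, k)))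
    (hH : ∀ k l hl m hm, Compat (fun s => (H l hl).hom (s, k)) (fun s => (H m hm).hom (s, k)))
    (hE : ∀ m hm, E.Solves m (φ m hm) (H m hm)) (a : Arity) :
    ∃ (F : C((lev n P').A a × (simplex n × K), Y.A a))
      (G : C((lev n P).A a × (simplex n × (K × I)), Y.A a)),
      (∀ x t k, OnBoundary x t →
        IsBoundaryValue (fun m hm s => (φ m hm).hom (s, k)) x t (F (x, (t, k)))) ∧
      (∀ x t k, OnBoundary x t →
        IsBoundaryValue (fun m hm s => (H m hm).hom (s, k)) x t (G (x, (t, k)))) ∧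
      (∀ x t k, barVal (E.u.fam n) a (x, (t, k)) = G (x, (t, (k, 0)))) ∧
      (∀ x t k, F (((levMap n E.p).f a).hom x, (t, k)) = G (x, (t, (k, 1)))) ∧
      (∀ x t k, F (((levMap n E.i').f a).hom x, (t, k)) = barVal (E.v'.fam n) a (x, (t, k))) ∧
      (∀ x t k, G (((levMap n E.i).f a).hom x, (t, k)) = barVal (E.v.fam n) a (x, (t, k))) ∧
      (∀ x t (k : E.L), F (x, (t, k.1)) = barVal (E.w'.fam n) a (x, (t, k))) ∧
      ∀ x t (k : E.L) s, G (x, (t, (k.1, s))) = barVal (E.w.fam n) a (x, (t, (k, s))) := by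
  obtain ⟨β, hβ, hβL⟩ := exists_boundaryValue (a := a) E.closed φ hφ
    ⟨fun p => barVal (E.w'.fam n) a (p.1.1, (p.1.2.1, ⟨p.1.2.2, p.2⟩)), by
      refine (barVal (E.w'.fam n) a).continuous.comp ?_
      fun_prop⟩ (fun p _ => (E.w'.isBoundaryValue p.1.1 p.1.2.1 ⟨p.1.2.2, p.2⟩).congr
        fun m hm s => ((hE m hm).param' s ⟨p.1.2.2, p.2⟩).symm)
  obtain ⟨γ, hγ, hγL⟩ := exists_boundaryValue (a := a)
    (L := (Prod.fst ⁻¹' E.L : Set (K × I))) (E.closed.preimage continuous_fst) H hH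
    ⟨fun p => barVal (E.w.fam n) a (p.1.1, (p.1.2.1, (⟨p.1.2.2.1, p.2⟩, p.1.2.2.2))), by
      refine (barVal (E.w.fam n) a).continuous.comp ?_
      fun_prop⟩
    (fun p _ => (E.w.isBoundaryValue p.1.1 p.1.2.1 (⟨p.1.2.2.1, p.2⟩, p.1.2.2.2)).congr
        fun m hm s => ((hE m hm).param s ⟨p.1.2.2.1, p.2⟩ p.1.2.2.2).symm)
  replace hβ : ∀ x t k h, OnBoundary x t →
      IsBoundaryValue (fun m hm s => (φ m hm).hom (s, k)) x t (β ⟨(x, (t, k)), h⟩) :=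
    fun x t k h => hβ ⟨(x, (t, k)), h⟩
  replace hγ : ∀ x t k h, OnBoundary x t →
      IsBoundaryValue (fun m hm s => (H m hm).hom (s, k)) x t (γ ⟨(x, (t, k)), h⟩) :=
    fun x t k h => hγ ⟨(x, (t, k)), h⟩
  have hβL : ∀ x t (k : E.L) h, β ⟨(x, (t, k.1)), h⟩ = barVal (E.w'.fam n) a (x, (t, k)) :=
    fun x t k h => hβL ⟨(x, (t, k.1)), h⟩ k.2
  have hγL : ∀ x t (k : E.L) s h, γ ⟨(x, (t, (k.1, s))), h⟩ =
      barVal (E.w.fam n) a (x, (t, (k, s))) :=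
    fun x t k s h => hγL ⟨(x, (t, (k.1, s))), h⟩ k.2
  have e0 : ∀ x t k h, barVal (E.u.fam n) a (x, (t, k)) = γ ⟨(x, (t, (k, 0))), h⟩ := by
    intro x t k h
    rcases h with h | h
    · exact (E.u.isBoundaryValue x t k).unique h ((hγ x t (k, 0) _ h).congr
        fun m hm s => ((hE m hm).zero s k).symm)
    · rw [hγL x t ⟨k, h⟩]
      exact congrArg (fun g : barObj n P ⟶ Y => (g.f a).hom (barGen n x)) (E.w_zero n t ⟨k, h⟩)
  have e1 : ∀ x t k h h', β ⟨(((levMap n E.p).f a).hom x, (t, k)), h'⟩ =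
      γ ⟨(x, (t, (k, 1))), h⟩ := by
    intro x t k h h'
    rcases h with h | h
    · exact IsBoundaryValue.unique h ((hβ _ t k _ ((onBoundary_levMap E.p).2 h)).map
        fun m hm s => (hE m hm).one s k) (hγ x t (k, 1) _ h)
    · rw [hγL x t ⟨k, h⟩, hβL _ t ⟨k, h⟩]
      exact barVal_map (E.w_one n t ⟨k, h⟩) x
  have e2 : ∀ x t k h, β ⟨(((levMap n E.i').f a).hom x, (t, k)), h⟩ =
      barVal (E.v'.fam n) a (x, (t, k)) := by
    intro x t k h
    rcases h with h | h
    · exact IsBoundaryValue.unique ((onBoundary_levMap E.i').1 h) ((hβ _ t k _ h).map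
        fun m hm s => (hE m hm).restr' s k) (E.v'.isBoundaryValue x t k)
    · rw [hβL _ t ⟨k, h⟩]
      exact barVal_map (E.w'_i' n t ⟨k, h⟩) x
  have e3 : ∀ x t k h, γ ⟨(((levMap n E.i).f a).hom x, (t, k)), h⟩ =
      barVal (E.v.fam n) a (x, (t, k)) := by
    intro x t k h
    rcases h with h | h
    · exact IsBoundaryValue.unique ((onBoundary_levMap E.i).1 h) ((hγ _ t k _ h).map
        fun m hm s => (hE m hm).restr s k) (E.v.isBoundaryValue x t k)
    · rw [hγL _ t ⟨k.1, h⟩ k.2]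
      exact barVal_map (E.w_i n t ⟨k.1, h⟩ k.2) x
  let S : Set (simplex n × K) := {τ | τ.1 ∈ ({t | ∃ i, t i = 0} : Set (simplex n)) ∨ τ.2 ∈ E.L}
  have hS : IsClosed S := ((isClosed_simplex_boundary n).preimage continuous_fst).union
    (E.closed.preimage continuous_snd)
  have hcomm : ∀ x, ((levMap n E.p).f a).hom (((levMap n E.i).f a).hom x) =
      ((levMap n E.i').f a).hom (((levMap n E.r).f a).hom x) := by
    intro x
    have h : levMap n E.i ≫ levMap n E.p = levMap n E.r ≫ levMap n E.i' := by
      rw [← levMap_comp, E.comm, levMap_comp]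
    exact congrArg (fun g : lev n R ⟶ lev n P' => (g.f a).hom x) h
  obtain ⟨F, G, hF, hG, hF2, hG3, h0, h1⟩ := (levMap_isHomotopyEquiv E.hp n a).extend_rel
    (levMap_isHomotopyEquiv E.hr n a) (levMap_isClosedEmbedding E.hi n a)
    (levMap_isClosedEmbedding E.hi' n a) (levMap_isNDR E.iNDR n a) (levMap_isNDR E.iNDR' n a)
    hcomm hS ((IsNDR.stdSimplex_boundary n).prod_union E.ndr) (barVal (E.u.fam n) a)
    (barVal (E.v'.fam n) a)
    ⟨fun q => barVal (E.v.fam n) a (q.1.1, (q.2.1, (q.2.2, q.1.2))), by fun_prop⟩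
    ⟨fun q => β ⟨(q.1, q.2.1), q.2.2.imp .inl id⟩, by
      refine β.continuous.comp (Continuous.subtype_mk ?_ _)
      fun_prop⟩
    ⟨fun q => γ ⟨(q.1.1, (q.2.1.1, (q.2.1.2, q.1.2))), q.2.2.imp .inl id⟩, by
      refine γ.continuous.comp (Continuous.subtype_mk ?_ _)
      fun_prop⟩
    (fun x t => (barVal_map (E.v_zero n t.1 t.2) x).symm)
    (fun x t => (barVal_map (E.v_one n t.1 t.2) x).symm)
    (fun x t => (e0 x t.1.1 t.1.2 _).symm)
    (fun x t => (e1 x t.1.1 t.1.2 _ _).symm)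
    (fun x t => e2 x t.1.1 t.1.2 _)
    (fun x s t => e3 x t.1.1 (t.1.2, s) _)
  obtain ⟨F', hF', hFd⟩ := exists_extend_boundaryValue β F fun p hp => hF p.1 ⟨p.2, hp⟩
  obtain ⟨G', hG', hGd⟩ := exists_extend_boundaryValue γ
    ⟨fun q => G ((q.1, q.2.2.2), (q.2.1, q.2.2.1)), by fun_prop⟩
    fun p hp => hG (p.1, p.2.2.2) ⟨(p.2.1, p.2.2.1), hp⟩
  refine ⟨F', G', fun x t k h => ?_, fun x t k h => ?_, fun x t k => ?_, fun x t k => ?_,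
    fun x t k => ?_, fun x t k => ?_, fun x t k => ?_, fun x t k s => ?_⟩
  · rw [hF' ⟨(x, (t, k)), .inl h⟩]
    exact hβ x t k _ h
  · rw [hG' ⟨(x, (t, k)), .inl h⟩]
    exact hγ x t k _ h
  · by_cases hx : x ∈ degen n P a
    · exact (e0 x t k _).trans (hG' ⟨(x, (t, (k, 0))), .inl (.inr hx)⟩).symm
    · exact ((hGd (x, (t, (k, 0))) hx).trans (h0 x (t, k))).symm
  · by_cases hx : x ∈ degen n P a
    · exact (hF' ⟨(_, (t, k)), .inl (.inr ((levMap_mem_degen E.p).2 hx))⟩).trans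
        ((e1 x t k _ _).trans (hG' ⟨(x, (t, (k, 1))), .inl (.inr hx)⟩).symm)
    · exact (hFd (_, (t, k)) (mt (levMap_mem_degen E.p).1 hx)).trans
        ((hGd (x, (t, (k, 1))) hx).trans (h1 x (t, k))).symm
  · by_cases hx : x ∈ degen n R' a
    · exact (hF' ⟨(_, (t, k)), .inl (.inr ((levMap_mem_degen E.i').2 hx))⟩).trans (e2 x t k _)
    · exact (hFd (_, (t, k)) (mt (levMap_mem_degen E.i').1 hx)).trans (hF2 x (t, k))
  · by_cases hx : x ∈ degen n R a
    · exact (hG' ⟨(_, (t, k)), .inl (.inr ((levMap_mem_degen E.i).2 hx))⟩).trans (e3 x t k _)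
    · exact (hGd (_, (t, k)) (mt (levMap_mem_degen E.i).1 hx)).trans (hG3 x k.2 (t, k.1))
  · exact (hF' ⟨(x, (t, k.1)), .inr k.2⟩).trans (hβL x t k _)
  · exact (hG' ⟨(x, (t, (k.1, s))), .inr k.2⟩).trans (hγL x t k s _)

/-- Compatibility with the maps in lower dimensions and with itself. -/
def CompatBelow (f : ∀ m, m < n → Family (barObj m P) (simplex m × K) Y)
    (d : Family (barObj n P) (simplex n × K) Y) : Prop :=
  ∀ k, (∀ m hm, Compat (fun t => (f m hm).hom (t, k)) (fun t => d.hom (t, k))) ∧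
    (∀ m hm, Compat (fun t => d.hom (t, k)) (fun t => (f m hm).hom (t, k))) ∧
    Compat (fun t => d.hom (t, k)) (fun t => d.hom (t, k))

theorem CompatBelow.compat {f : ∀ m, m < n → Family (barObj m P) (simplex m × K) Y}
    (h : ∀ m hm, CompatBelow (fun k hk => f k (hk.trans hm)) (f m hm)) (k : K) :
    ∀ l hl m hm, Compat (fun t => (f l hl).hom (t, k)) (fun t => (f m hm).hom (t, k)) := by
  intro l hl m hm
  rcases lt_trichotomy l m with h1 | rfl | h1
  · exact (h m hm k).1 l h1
  · exact (h l hl k).2.2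
  · exact (h l hl k).2.1 m h1

theorem compatBelow_of_isBoundaryValue {f : ∀ m, m < n → Family (barObj m P) (simplex m × K) Y}
    (h : ∀ m hm, CompatBelow (fun k hk => f k (hk.trans hm)) (f m hm))
    {d : Family (barObj n P) (simplex n × K) Y}
    (hd : ∀ a (x : (lev n P).A a) t k, OnBoundary x t →
      IsBoundaryValue (fun m hm s => (f m hm).hom (s, k)) x t (barVal d a (x, (t, k)))) :
    CompatBelow f d := fun k =>
  compat_of_isBoundaryValue (CompatBelow.compat h k) (d := fun t => d.hom (t, k))
    fun a x t hx => hd a x t k hx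

theorem barObjMap_comp_hom {Q : IoProperad.{u}} {T T' : Type} [TopologicalSpace T]
    [TopologicalSpace T'] {φ : Family (barObj n P) T Y} {φ' : Family (barObj n Q) T' Y}
    {f : P ⟶ Q} {τ : T} {τ' : T'}
    (h : ∀ a (x : (lev n P).A a), barVal φ' a (((levMap n f).f a).hom x, τ') = barVal φ a (x, τ)) :
    barObjMap n f ≫ φ'.hom τ' = φ.hom τ :=
  bar_hom_ext fun a x => (congrArg ((φ'.hom τ').f a).hom (barObjMap_barGen f x)).trans (h a x)

/-- Extension problems have solutions. -/
theorem ExtensionProblem.exists_solution [CompactSpace K] [T2Space K]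
    (E : ExtensionProblem P P' R R' Y K) :
    ∃ (φ : Sys P' K Y) (H : Sys P (K × I) Y), ∀ n, E.Solves n (φ.fam n) (H.fam n) := by
  let D : ℕ → Type _ := fun n => Family (barObj n P') (simplex n × K) Y ×
    Family (barObj n P) (simplex n × (K × I)) Y
  let C : ∀ n, (∀ m, m < n → D m) → D n → Prop := fun n f d =>
    CompatBelow (fun m hm => (f m hm).1) d.1 ∧ CompatBelow (fun m hm => (f m hm).2) d.2 ∧
      E.Solves n d.1 d.2
  have step : ∀ n (f : ∀ m, m < n → D m),
      (∀ m hm, C m (fun k hk => f k (hk.trans hm)) (f m hm)) → ∃ d, C n f d := by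
    intro n f hf
    choose F G hF hG h0 h1 h2 h3 h4 h5 using E.exists_arity (fun m hm => (f m hm).1)
      (fun m hm => (f m hm).2) (CompatBelow.compat fun m hm => (hf m hm).1)
      (CompatBelow.compat fun m hm => (hf m hm).2.1) fun m hm => (hf m hm).2.2
    have hF' : ∀ a x τ, barVal (n := n) (Family.ofGen (X := lev n P') F) a (x, τ) = F a (x, τ) :=
      fun a x τ => Family.ofGen_hom (X := lev n P') F τ x
    have hG' : ∀ a x τ, barVal (n := n) (Family.ofGen (X := lev n P) G) a (x, τ) = G a (x, τ) :=
      fun a x τ => Family.ofGen_hom (X := lev n P) G τ x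
    refine ⟨⟨Family.ofGen (X := lev n P') F, Family.ofGen (X := lev n P) G⟩,
      compatBelow_of_isBoundaryValue (fun m hm => (hf m hm).1) fun a x t k hx => ?_,
      compatBelow_of_isBoundaryValue (fun m hm => (hf m hm).2.1) fun a x t k hx => ?_,
      ⟨fun t k => ?_, fun t k => ?_, fun t k => ?_, fun t k => ?_, fun t k => ?_,
        fun t k s => ?_⟩⟩
    · rw [hF']
      exact hF a x t k hx
    · rw [hG']
      exact hG a x t k hx
    · exact bar_hom_ext fun a x => (h0 a x t k).trans (hG' a x _).symm
    · exact barObjMap_comp_hom fun a x => (hF' a _ _).trans ((h1 a x t k).trans (hG' a x _).symm)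
    · exact barObjMap_comp_hom fun a x => (hF' a _ _).trans (h2 a x t k)
    · exact barObjMap_comp_hom fun a x => (hG' a _ _).trans (h3 a x t k)
    · exact bar_hom_ext fun a x => (hF' a x _).trans (h4 a x t k)
    · exact bar_hom_ext fun a x => (hG' a x _).trans (h5 a x t k s)
  obtain ⟨f, hf⟩ := exists_seq_of_extend C step
  refine ⟨⟨fun n => (f n).1, fun k l m => ?_⟩, ⟨fun n => (f n).2, fun k l m => ?_⟩,
    fun n => (hf n).2.2⟩
  · exact CompatBelow.compat (n := l + m + 1) (f := fun n _ => (f n).1) (fun n _ => (hf n).1) k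
      l (by omega) m (by omega)
  · exact CompatBelow.compat (n := l + m + 1) (f := fun n _ => (f n).2) (fun n _ => (hf n).2.1) k
      l (by omega) m (by omega)

end extension

end IoProperad

namespace IoProperad

/-! ### Families of maps out of the bar resolution and of pushouts -/

section families

variable {W P P' Q Y : IoProperad.{u}} {K : Type} [TopologicalSpace K]

/-- Restriction of a family along a map. -/
noncomputable def Family.precomp (f : P ⟶ Q) (φ : Family Q K Y) : Family P K Y where
  hom k := f ≫ φ.hom k
  continuous a := (φ.continuous a).comp
    (((f.f a).hom.continuous.comp continuous_fst).prodMk continuous_snd)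

/-- Composition of a family with a map. -/
noncomputable def Family.postcomp (φ : Family P K Q) (f : Q ⟶ Y) : Family P K Y where
  hom k := φ.hom k ≫ f
  continuous a := (f.f a).hom.continuous.comp (φ.continuous a)

/-- Change of parameters. -/
noncomputable def Family.reparam {K' : Type} [TopologicalSpace K'] (φ : Family P K Y)
    (g : C(K', K)) : Family P K' Y where
  hom k := φ.hom (g k)
  continuous a := (φ.continuous a).comp
    (continuous_fst.prodMk (g.continuous.comp continuous_snd))

/-- A family with discrete parameters. -/
noncomputable def Family.ofDiscrete [DiscreteTopology K] (φ : K → (P ⟶ Y)) : Family P K Y where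
  hom := φ
  continuous a := continuous_prod_of_discrete_right.2 fun k => ((φ k).f a).hom.continuous

/-- Currying of families. -/
noncomputable def Family.curry [CompactSpace K] [T2Space K] {Z : Type} [TopologicalSpace Z]
    [CompactSpace Z] [T2Space Z] (φ : Family W (Z × K) Y) : Family W Z (cotensor K Y) where
  hom z := Family.toCotensor
    { hom := fun k => φ.hom (z, k)
      continuous := fun a => (φ.continuous a).comp
        (continuous_fst.prodMk (continuous_const.prodMk continuous_snd)) }
  continuous a := by
    have := prod_cg (W.A a) Z
    exact CotensorPt.continuous_mk (A := W.A a × Z) ⟨fun p => ((φ.hom (p.1.2, p.2)).f a).hom p.1.1,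
      (φ.continuous a).comp ((continuous_fst.comp continuous_fst).prodMk
        ((continuous_snd.comp continuous_fst).prodMk continuous_snd))⟩

/-- A geometric realization of the bar construction. -/
noncomputable abbrev barReal (P : IoProperad.{u}) : Realization (bar.obj P) :=
  (nonempty_realization (bar.obj P)).some

/-- The structure maps of the bar resolution. -/
noncomputable abbrev barι (P : IoProperad.{u}) (n : ℕ) (t : simplex n) :
    barObj n P ⟶ barResolution.obj P :=
  ((barReal P).cocone.ι n).hom t

theorem barι_map (f : P ⟶ Q) (n : ℕ) (t : simplex n) :
    barι P n t ≫ barResolution.map f = barObjMap n f ≫ barι Q n t :=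
  (barReal P).fac ((barReal Q).cocone.precomp (bar.map f)) n t

theorem barι_map_assoc (f : P ⟶ Q) (n : ℕ) (t : simplex n) (h : barResolution.obj Q ⟶ Y) :
    barι P n t ≫ barResolution.map f ≫ h = barObjMap n f ≫ barι Q n t ≫ h := by
  rw [← Category.assoc, barι_map, Category.assoc]

theorem barResolution_hom_ext {f g : barResolution.obj P ⟶ Y}
    (h : ∀ n t, barι P n t ≫ f = barι P n t ≫ g) : f = g :=
  (barReal P).hom_ext h

/-- The system of maps given by a family of maps out of the bar resolution. -/
noncomputable def Sys.ofFamily (φ : Family (barResolution.obj P) K Y) : Sys P K Y where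
  fam n :=
    { hom := fun τ => barι P n τ.1 ≫ φ.hom τ.2
      continuous := fun a => (φ.continuous a).comp
        ((((barReal P).cocone.ι n).continuous a |>.comp
          (continuous_fst.prodMk (continuous_fst.comp continuous_snd))).prodMk
          (continuous_snd.comp continuous_snd)) }
  compat k l m θ t := by
    have h := (barReal P).cocone.compat θ t
    exact (Category.assoc _ _ _).symm.trans (congrArg (· ≫ φ.hom k) h)

/-- A system of maps gives a family of maps out of the bar resolution. -/
theorem Sys.exists_family [CompactSpace K] [T2Space K] (U : Sys P K Y) :
    ∃ φ : Family (barResolution.obj P) K Y,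
      ∀ n t k, barι P n t ≫ φ.hom k = (U.fam n).hom (t, k) := by
  let c : Cocone (bar.obj P) (cotensor K Y) :=
    { ι := fun n => (U.fam n).curry
      compat := fun θ t => cotensor_hom_ext fun k => U.compat k _ _ θ t }
  refine ⟨Family.ofCotensor ((barReal P).desc c), fun n t k => ?_⟩
  have h := (barReal P).fac c n t
  exact (Category.assoc _ _ _).symm.trans (congrArg (· ≫ cotensorEv k) h)

theorem exists_family_pushout [CompactSpace K] [T2Space K] {R : IoProperad.{u}} {i : R ⟶ P}
    {j : R ⟶ Q} (α : Family P K Y) (β : Family Q K Y) (h : ∀ k, i ≫ α.hom k = j ≫ β.hom k) :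
    ∃ γ : Family (Limits.pushout i j) K Y, (∀ k, Limits.pushout.inl i j ≫ γ.hom k = α.hom k) ∧
      ∀ k, Limits.pushout.inr i j ≫ γ.hom k = β.hom k := by
  have hc : i ≫ α.toCotensor = j ≫ β.toCotensor := cotensor_hom_ext fun k => h k
  refine ⟨Family.ofCotensor (Limits.pushout.desc _ _ hc), fun k => ?_, fun k => ?_⟩
  · refine (Category.assoc _ _ _).symm.trans ?_
    rw [Limits.pushout.inl_desc]
    rfl
  · refine (Category.assoc _ _ _).symm.trans ?_
    rw [Limits.pushout.inr_desc]
    rfl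

end families

/-! ### The empty io-properad -/

section empty

theorem isEmpty_gObj {X : IoSeq.{u}} (h : ∀ b, IsEmpty (X b)) (a : Arity) : IsEmpty (X.gObj a) :=
  ⟨fun z => z.1.rep.graph.nonempty.elim fun v => (h _).false (z.2 v)⟩

theorem continuous_of_isEmpty {X Z : Type*} [TopologicalSpace X] [TopologicalSpace Z] [IsEmpty X]
    (f : X → Z) : Continuous f := continuous_iff_continuousAt.2 fun x => isEmptyElim x

/-- The empty io-sequence. -/
def emptySeq : IoSeq.{u} := fun _ => CGHaus.mk PEmpty

theorem isEmpty_emptySeq (a : Arity) : IsEmpty (emptySeq.{u} a) := inferInstanceAs (IsEmpty PEmpty)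

/-- The io-properad without operations. -/
noncomputable def emptyProperad : IoProperad.{u} where
  A := emptySeq
  a := fun a =>
    have : IsEmpty (gMonad.obj emptySeq.{u} a) := isEmpty_gObj isEmpty_emptySeq a
    ⟨⟨isEmptyElim, continuous_of_isEmpty _⟩⟩
  unit := funext fun a => CGHaus.hom_ext fun x => ((isEmpty_emptySeq a).false x).elim
  assoc := funext fun a => CGHaus.hom_ext fun x =>
    ((isEmpty_gObj (isEmpty_gObj isEmpty_emptySeq) a).false x).elim

variable {W Y : IoProperad.{u}}

/-- The family of maps out of an io-properad without operations. -/
noncomputable def Family.ofIsEmpty (h : ∀ a, IsEmpty (W.A a)) (K : Type) [TopologicalSpace K]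
    (Y : IoProperad.{u}) : Family W K Y where
  hom _ :=
    { f := fun a => ⟨⟨(h a).elim, have := h a; continuous_of_isEmpty _⟩⟩
      h := funext fun a => CGHaus.hom_ext fun x => ((isEmpty_gObj h a).false x).elim }
  continuous a := have := h a; continuous_of_isEmpty _

theorem hom_ext_of_isEmpty (h : ∀ a, IsEmpty (W.A a)) (f g : W ⟶ Y) : f = g :=
  hom_ext' fun a x => ((h a).false x).elim

theorem isEmpty_lev (h : ∀ a, IsEmpty (W.A a)) (n : ℕ) (a : Arity) : IsEmpty ((lev n W).A a) := by
  induction n generalizing a with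
  | zero => exact h a
  | succ n ih => exact isEmpty_gObj ih a

theorem isEmpty_barObj (h : ∀ a, IsEmpty (W.A a)) (n : ℕ) (a : Arity) :
    IsEmpty ((barObj n W).A a) := isEmpty_lev h (n + 1) a

theorem barResolution_hom_ext_of_isEmpty (h : ∀ a, IsEmpty (W.A a))
    (f g : barResolution.obj W ⟶ Y) : f = g :=
  barResolution_hom_ext fun n _ => hom_ext_of_isEmpty (isEmpty_barObj h n) _ _

theorem nonempty_family_of_isEmpty (h : ∀ a, IsEmpty (W.A a)) (K : Type) [TopologicalSpace K]
    [CompactSpace K] [T2Space K] (Y : IoProperad.{u}) :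
    Nonempty (Family (barResolution.obj W) K Y) :=
  ⟨(Sys.exists_family ⟨fun n => Family.ofIsEmpty (isEmpty_barObj h n) _ Y,
    fun _ _ _ _ _ => hom_ext_of_isEmpty (isEmpty_barObj h _) _ _⟩).choose⟩

/-- The map from the empty io-properad. -/
noncomputable def emptyProperadTo (Y : IoProperad.{u}) : emptyProperad ⟶ Y :=
  (Family.ofIsEmpty (W := emptyProperad) isEmpty_emptySeq Unit Y).hom ()

end empty

/-! ### Extension of families of maps out of bar resolutions -/

section main

variable {P P' Q Q' R R' Y : IoProperad.{u}}

/-- The hypotheses on a square of io-properads which make extension possible. -/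
structure CofibrantSquare (p : P ⟶ P') (r : R ⟶ R') (i : R ⟶ P) (i' : R' ⟶ P') : Prop where
  comm : i ≫ p = r ≫ i'
  hp : ∀ a, _root_.IsHomotopyEquiv (p.f a).hom
  hr : ∀ a, _root_.IsHomotopyEquiv (r.f a).hom
  hi : ∀ a, IsClosedEmbedding (i.f a).hom
  hi' : ∀ a, IsClosedEmbedding (i'.f a).hom
  iNDR : ∀ a, IsNDR (Set.range (i.f a).hom)
  iNDR' : ∀ a, IsNDR (Set.range (i'.f a).hom)

variable {p : P ⟶ P'} {q : Q ⟶ Q'} {r : R ⟶ R'} {i : R ⟶ P} {i' : R' ⟶ P'} {j : R ⟶ Q}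
  {j' : R' ⟶ Q'} {K : Type} [TopologicalSpace K] [CompactSpace K] [T2Space K]

theorem CofibrantSquare.exists_extension (E : CofibrantSquare p r i i') {L : Set K}
    (hL : IsClosed L) (hN : IsNDR L) (u : Family (barResolution.obj P) K Y)
    (v' : Family (barResolution.obj R') K Y) (v : Family (barResolution.obj R) (K × I) Y)
    (w' : Family (barResolution.obj P') L Y) (w : Family (barResolution.obj P) (L × I) Y)
    (v_zero : ∀ k, barResolution.map i ≫ u.hom k = v.hom (k, 0))
    (v_one : ∀ k, barResolution.map r ≫ v'.hom k = v.hom (k, 1))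
    (w_zero : ∀ k : L, u.hom k.1 = w.hom (k, 0))
    (w_one : ∀ k, barResolution.map p ≫ w'.hom k = w.hom (k, 1))
    (w'_i' : ∀ k : L, barResolution.map i' ≫ w'.hom k = v'.hom k.1)
    (w_i : ∀ (k : L) s, barResolution.map i ≫ w.hom (k, s) = v.hom (k.1, s)) :
    ∃ (φ : Family (barResolution.obj P') K Y) (H : Family (barResolution.obj P) (K × I) Y),
      (∀ k, u.hom k = H.hom (k, 0)) ∧ (∀ k, barResolution.map p ≫ φ.hom k = H.hom (k, 1)) ∧
      (∀ k, barResolution.map i' ≫ φ.hom k = v'.hom k) ∧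
      (∀ k, barResolution.map i ≫ H.hom k = v.hom k) ∧ (∀ k : L, φ.hom k.1 = w'.hom k) ∧
      ∀ (k : L) s, H.hom (k.1, s) = w.hom (k, s) := by
  have conv : ∀ {A B : IoProperad.{u}} {f : A ⟶ B} {g : barResolution.obj B ⟶ Y}
      {g' : barResolution.obj A ⟶ Y}, barResolution.map f ≫ g = g' →
      ∀ n t, barObjMap n f ≫ barι B n t ≫ g = barι A n t ≫ g' := by
    intro A B f g g' h n t
    rw [← barι_map_assoc, h]
  obtain ⟨φ, H, hφ⟩ := ExtensionProblem.exists_solution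
    { p := p, r := r, i := i, i' := i', comm := E.comm, hp := E.hp, hr := E.hr, hi := E.hi
      hi' := E.hi', iNDR := E.iNDR, iNDR' := E.iNDR', L := L, closed := hL, ndr := hN
      u := Sys.ofFamily u, v' := Sys.ofFamily v', v := Sys.ofFamily v, w' := Sys.ofFamily w'
      w := Sys.ofFamily w
      v_zero := fun n t k => conv (v_zero k) n t
      v_one := fun n t k => conv (v_one k) n t
      w_zero := fun n t k => congrArg (barι P n t ≫ ·) (w_zero k)
      w_one := fun n t k => conv (w_one k) n t
      w'_i' := fun n t k => conv (w'_i' k) n t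
      w_i := fun n t k s => conv (w_i k s) n t }
  obtain ⟨φ₁, h₁⟩ := φ.exists_family
  obtain ⟨H₁, h₂⟩ := H.exists_family
  refine ⟨φ₁, H₁, fun k => ?_, fun k => ?_, fun k => ?_, fun k => ?_, fun k => ?_, fun k s => ?_⟩
  · refine barResolution_hom_ext fun n t => ?_
    rw [h₂]
    exact (hφ n).zero t k
  · refine barResolution_hom_ext fun n t => ?_
    rw [barι_map_assoc, h₁, h₂]
    exact (hφ n).one t k
  · refine barResolution_hom_ext fun n t => ?_
    rw [barι_map_assoc, h₁]
    exact (hφ n).restr' t k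
  · refine barResolution_hom_ext fun n t => ?_
    rw [barι_map_assoc, h₂]
    exact (hφ n).restr t k
  · refine barResolution_hom_ext fun n t => ?_
    rw [h₁]
    exact (hφ n).param' t k
  · refine barResolution_hom_ext fun n t => ?_
    rw [h₂]
    exact (hφ n).param t k s

theorem CofibrantSquare.empty {q : Q ⟶ Q'} (hq : ∀ a, _root_.IsHomotopyEquiv (q.f a).hom) :
    CofibrantSquare q (𝟙 emptyProperad) (emptyProperadTo Q) (emptyProperadTo Q') := by
  have hcl : ∀ (Z : IoProperad.{u}) a, IsClosedEmbedding ((emptyProperadTo Z).f a).hom := by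
    intro Z a
    have : IsEmpty (emptyProperad.{u}.A a) := isEmpty_emptySeq a
    exact .of_continuous_injective_isClosedMap (ContinuousMap.continuous _)
      (fun x => isEmptyElim x) fun s _ => by
        rw [Set.eq_empty_of_isEmpty s, Set.image_empty]
        exact isClosed_empty
  have hN : ∀ (Z : IoProperad.{u}) a, IsNDR (Set.range ((emptyProperadTo Z).f a).hom) := by
    intro Z a
    have : IsEmpty (emptyProperad.{u}.A a) := isEmpty_emptySeq a
    rw [Set.range_eq_empty]
    exact IsNDR.empty
  refine ⟨hom_ext_of_isEmpty (W := emptyProperad) isEmpty_emptySeq _ _, hq, fun a => ?_,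
    hcl Q, hcl Q', hN Q, hN Q'⟩
  exact ⟨ContinuousMap.id _, ⟨Prod.fst, continuous_fst⟩, ⟨Prod.fst, continuous_fst⟩,
    fun _ => rfl, fun _ => rfl, fun _ => rfl, fun _ => rfl⟩

/-- The induced map of pushouts of bar resolutions. -/
noncomputable abbrev pushoutMap (hi : i ≫ p = r ≫ i') (hj : j ≫ q = r ≫ j') :
    Limits.pushout (barResolution.map i) (barResolution.map j) ⟶
      Limits.pushout (barResolution.map i') (barResolution.map j') :=
  Limits.pushout.map _ _ _ _ (barResolution.map p) (barResolution.map q) (barResolution.map r)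
    (by rw [← Functor.map_comp, hi, Functor.map_comp])
    (by rw [← Functor.map_comp, hj, Functor.map_comp])

theorem CofibrantSquare.exists_extension_pushout (E : CofibrantSquare p r i i')
    (hq : ∀ a, _root_.IsHomotopyEquiv (q.f a).hom) (hj : j ≫ q = r ≫ j') {L : Set K}
    (hL : IsClosed L) (hN : IsNDR L)
    (u : Family (Limits.pushout (barResolution.map i) (barResolution.map j)) K Y)
    (w' : Family (Limits.pushout (barResolution.map i') (barResolution.map j')) L Y)
    (w : Family (Limits.pushout (barResolution.map i) (barResolution.map j)) (L × I) Y)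
    (w_zero : ∀ k : L, u.hom k.1 = w.hom (k, 0))
    (w_one : ∀ k, pushoutMap E.comm hj ≫ w'.hom k = w.hom (k, 1)) :
    ∃ (φ : Family (Limits.pushout (barResolution.map i') (barResolution.map j')) K Y)
      (H : Family (Limits.pushout (barResolution.map i) (barResolution.map j)) (K × I) Y),
      (∀ k, u.hom k = H.hom (k, 0)) ∧ (∀ k, pushoutMap E.comm hj ≫ φ.hom k = H.hom (k, 1)) ∧
      (∀ k : L, φ.hom k.1 = w'.hom k) ∧ ∀ (k : L) s, H.hom (k.1, s) = w.hom (k, s) := by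
  have hinl : Limits.pushout.inl _ _ ≫ pushoutMap E.comm hj =
      barResolution.map p ≫ Limits.pushout.inl _ _ := Limits.pushout.inl_desc _ _ _
  have hinr : Limits.pushout.inr _ _ ≫ pushoutMap E.comm hj =
      barResolution.map q ≫ Limits.pushout.inr _ _ := Limits.pushout.inr_desc _ _ _
  have hjq : barResolution.map j ≫ barResolution.map q =
      barResolution.map r ≫ barResolution.map j' := by
    rw [← Functor.map_comp, hj, Functor.map_comp]
  have hc := Limits.pushout.condition (f := barResolution.map i) (g := barResolution.map j)
  have hc' := Limits.pushout.condition (f := barResolution.map i') (g := barResolution.map j')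
  obtain ⟨e'⟩ := nonempty_family_of_isEmpty (W := emptyProperad) isEmpty_emptySeq K Y
  obtain ⟨e⟩ := nonempty_family_of_isEmpty (W := emptyProperad) isEmpty_emptySeq (K × I) Y
  have he : ∀ f g : barResolution.obj emptyProperad ⟶ Y, f = g :=
    barResolution_hom_ext_of_isEmpty (W := emptyProperad) isEmpty_emptySeq
  obtain ⟨φQ, HQ, q0, q1, -, -, q2, q3⟩ := (CofibrantSquare.empty hq).exists_extension hL hN
    (u.precomp (Limits.pushout.inr _ _)) e' e (w'.precomp (Limits.pushout.inr _ _))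
    (w.precomp (Limits.pushout.inr _ _)) (fun _ => he _ _) (fun _ => he _ _)
    (fun k => congrArg (Limits.pushout.inr _ _ ≫ ·) (w_zero k))
    (fun k => by
      change _ ≫ _ ≫ _ = _ ≫ _
      rw [← w_one, ← Category.assoc, ← Category.assoc, hinr])
    (fun _ => he _ _) (fun _ _ => he _ _)
  obtain ⟨φP, HP, p0, p1, p2, p3, p4, p5⟩ := E.exists_extension hL hN
    (u.precomp (Limits.pushout.inl _ _)) (φQ.precomp (barResolution.map j'))
    (HQ.precomp (barResolution.map j)) (w'.precomp (Limits.pushout.inl _ _))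
    (w.precomp (Limits.pushout.inl _ _))
    (fun k => by
      change _ ≫ _ ≫ _ = _ ≫ _
      rw [← q0, ← Category.assoc, hc, Category.assoc]
      rfl)
    (fun k => by
      change _ ≫ _ ≫ _ = _ ≫ _
      rw [← q1, ← Category.assoc, ← Category.assoc, hjq])
    (fun k => congrArg (Limits.pushout.inl _ _ ≫ ·) (w_zero k))
    (fun k => by
      change _ ≫ _ ≫ _ = _ ≫ _
      rw [← w_one, ← Category.assoc, ← Category.assoc, hinl])
    (fun k => by
      change _ ≫ _ ≫ _ = _ ≫ _
      rw [q2, ← Category.assoc, hc', Category.assoc]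
      rfl)
    (fun k s => by
      change _ ≫ _ ≫ _ = _ ≫ _
      rw [q3, ← Category.assoc, hc, Category.assoc]
      rfl)
  obtain ⟨φ, f1, f2⟩ := exists_family_pushout φP φQ p2
  obtain ⟨H, h1, h2⟩ := exists_family_pushout HP HQ p3
  refine ⟨φ, H, fun k => Limits.pushout.hom_ext ?_ ?_, fun k => Limits.pushout.hom_ext ?_ ?_,
    fun k => Limits.pushout.hom_ext ?_ ?_, fun k s => Limits.pushout.hom_ext ?_ ?_⟩
  · rw [h1]
    exact p0 k
  · rw [h2]
    exact q0 k
  · rw [h1, ← Category.assoc, hinl, Category.assoc, f1, p1]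
  · rw [h2, ← Category.assoc, hinr, Category.assoc, f2, q1]
  · rw [f1]
    exact p4 k
  · rw [f2]
    exact q2 k
  · rw [h1]
    exact p5 k s
  · rw [h2]
    exact q3 k s

/-- The map of pushouts is a homotopy equivalence of io-properads. -/
theorem CofibrantSquare.exists_homotopy_inverse (E : CofibrantSquare p r i i')
    (hq : ∀ a, _root_.IsHomotopyEquiv (q.f a).hom) (hj : j ≫ q = r ≫ j') :
    ∃ (g : Limits.pushout (barResolution.map i') (barResolution.map j') ⟶
        Limits.pushout (barResolution.map i) (barResolution.map j))
      (G : Family (Limits.pushout (barResolution.map i) (barResolution.map j)) I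
        (Limits.pushout (barResolution.map i) (barResolution.map j)))
      (G' : Family (Limits.pushout (barResolution.map i') (barResolution.map j')) I
        (Limits.pushout (barResolution.map i') (barResolution.map j'))),
      G.hom 0 = 𝟙 _ ∧ G.hom 1 = pushoutMap E.comm hj ≫ g ∧ G'.hom 0 = 𝟙 _ ∧
        G'.hom 1 = g ≫ pushoutMap E.comm hj := by
  obtain ⟨φ, H, h0, h1, -, -⟩ := E.exists_extension_pushout hq hj (K := Unit) (L := ∅)
    isClosed_empty IsNDR.empty (Family.ofDiscrete fun _ => 𝟙 _)
    (Family.ofDiscrete fun k => k.2.elim)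
    { hom := fun k => k.1.2.elim
      continuous := fun a => continuous_iff_continuousAt.2 fun x => x.2.1.2.elim }
    (fun k => k.2.elim) (fun k => k.2.elim)
  let G : Family _ I _ := H.reparam ⟨fun s => ((), s), by fun_prop⟩
  have hL : ({0, 1} : Set I).Finite := Set.toFinite _
  let w' : ({0, 1} : Set I) → (Limits.pushout (barResolution.map i') (barResolution.map j') ⟶
      Limits.pushout (barResolution.map i') (barResolution.map j')) := fun k =>
    open Classical in if k.1 = 0 then 𝟙 _ else φ.hom () ≫ pushoutMap E.comm hj
  have hw0 : ∀ h, w' ⟨0, h⟩ = 𝟙 _ := fun h => if_pos rfl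
  have hw1 : ∀ h, w' ⟨1, h⟩ = φ.hom () ≫ pushoutMap E.comm hj := fun h => if_neg one_ne_zero
  obtain ⟨φ', H', -, -, h2, -⟩ := E.exists_extension_pushout hq hj (K := I) (L := {0, 1})
    hL.isClosed IsNDR.interval_ends (G.postcomp (pushoutMap E.comm hj)) (Family.ofDiscrete w')
    ((G.postcomp (pushoutMap E.comm hj)).reparam
      ⟨fun k => k.1.1, continuous_subtype_val.comp continuous_fst⟩) (fun k => rfl) (by
      rintro ⟨k, rfl | rfl⟩
      · change _ ≫ w' _ = H.hom ((), 0) ≫ _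
        rw [hw0 (.inl rfl), ← h0]
        exact (Category.comp_id _).trans (Category.id_comp _).symm
      · change _ ≫ w' _ = H.hom ((), 1) ≫ _
        rw [hw1 (.inr rfl), ← h1, Category.assoc])
  exact ⟨φ.hom (), G, φ', (h0 ()).symm, (h1 ()).symm, (h2 ⟨0, .inl rfl⟩).trans (hw0 _),
    (h2 ⟨1, .inr rfl⟩).trans (hw1 _)⟩

theorem IsHurewiczWeakEquiv.isHomotopyEquiv {f : P ⟶ Q} (hf : IsHurewiczWeakEquiv f) (a : Arity) :
    _root_.IsHomotopyEquiv (f.f a).hom := by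
  obtain ⟨e, he⟩ := hf a
  obtain ⟨G⟩ := e.left_inv
  obtain ⟨G'⟩ := e.right_inv
  refine ⟨e.invFun, ⟨fun x => G.symm (x.2, x.1), by fun_prop⟩,
    ⟨fun x => G'.symm (x.2, x.1), by fun_prop⟩, fun x => ?_, fun x => ?_, fun x => ?_, fun x => ?_⟩
  · exact G.symm.apply_zero x
  · rw [← he]
    exact G.symm.apply_one x
  · exact G'.symm.apply_zero x
  · rw [← he]
    exact G'.symm.apply_one x

theorem isHurewiczWeakEquiv_of_homotopies {f : P ⟶ Q} {g : Q ⟶ P} (G : Family P I P)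
    (G' : Family Q I Q) (h0 : G.hom 0 = 𝟙 _) (h1 : G.hom 1 = f ≫ g) (h0' : G'.hom 0 = 𝟙 _)
    (h1' : G'.hom 1 = g ≫ f) : IsHurewiczWeakEquiv f := by
  intro a
  refine ⟨⟨(f.f a).hom, (g.f a).hom, ContinuousMap.Homotopic.symm ⟨⟨⟨fun x =>
    ((G.hom x.1).f a).hom x.2, (G.continuous a).comp continuous_swap⟩, fun x => ?_, fun x => ?_⟩⟩,
    ContinuousMap.Homotopic.symm ⟨⟨⟨fun x => ((G'.hom x.1).f a).hom x.2,
      (G'.continuous a).comp continuous_swap⟩, fun x => ?_, fun x => ?_⟩⟩⟩, rfl⟩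
  · exact congrArg (fun h : P ⟶ P => (h.f a).hom x) h0
  · exact congrArg (fun h : P ⟶ P => (h.f a).hom x) h1
  · exact congrArg (fun h : Q ⟶ Q => (h.f a).hom x) h0'
  · exact congrArg (fun h : Q ⟶ Q => (h.f a).hom x) h1'

end main

end IoProperad

theorem mainTheorem7 {P Q R P' Q' R' : IoProperad.{u}}
    (i : R ⟶ P) (j : R ⟶ Q) (i' : R' ⟶ P') (j' : R' ⟶ Q')
    (p : P ⟶ P') (q : Q ⟶ Q') (r : R ⟶ R')
    (hi : i ≫ p = r ≫ i') (hj : j ≫ q = r ≫ j')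
    (hp : IoProperad.IsHurewiczWeakEquiv p) (hq : IoProperad.IsHurewiczWeakEquiv q)
    (hr : IoProperad.IsHurewiczWeakEquiv r)
    (ci : IoSeq.IsHurewiczCofibration i.f) (ci' : IoSeq.IsHurewiczCofibration i'.f) :
    IoProperad.IsHurewiczWeakEquiv
      (Limits.pushout.map
        (IoProperad.barResolution.map i) (IoProperad.barResolution.map j)
        (IoProperad.barResolution.map i') (IoProperad.barResolution.map j')
        (IoProperad.barResolution.map p) (IoProperad.barResolution.map q)
        (IoProperad.barResolution.map r)
        (by rw [← Functor.map_comp, hi, Functor.map_comp])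
        (by rw [← Functor.map_comp, hj, Functor.map_comp])) := by
  have E : IoProperad.CofibrantSquare p r i i' :=
    { comm := hi
      hp := hp.isHomotopyEquiv
      hr := hr.isHomotopyEquiv
      hi := fun a => (ci a).isClosedEmbedding
      hi' := fun a => (ci' a).isClosedEmbedding
      iNDR := fun a => (ci a).isNDR
      iNDR' := fun a => (ci' a).isNDR }
  obtain ⟨g, G, G', h0, h1, h0', h1'⟩ := E.exists_homotopy_inverse hq.isHomotopyEquiv hj
  exact IoProperad.isHurewiczWeakEquiv_of_homotopies G G' h0 h1 h0' h1'
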